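/- **Setting.** Let $N\ge 0$, let $\mathcal C$ be a finite arrangement of affine hyperplanes in $X=\mathbb C^N$, and let $\mathcal D_X$ be the sheaf of algebraic differential operators on $X$. Let $F$ be the space of affine functions and $T$ the space of constant vector fields on $X$, with the pairing $\langle\xi,f\rangle=i_\xi(df)$. The arrangement stratifies $X$; the closures of the strata are the nonempty intersections of hyperplanes of $\mathcal C$ (including $X$ itself). The graph $\Gamma$ has one vertex $\alpha$ for each stratum $X_\alpha$. Write $\alpha\succ\beta$ if $\overline X_\alpha\supset\overline X_\beta$ with codimension $1$; call $\alpha,\beta$ adjacent if $\alpha\succ\beta$ or $\beta\succ\alpha$. Put $l(\alpha)=\operatorname{codim}_X X_\alpha$, let $F_\alpha\subset F$ be the space of affine functions vanishing on $X_\alpha$, $T_\alpha\subset T$ the space of constant vector fields tangent to $X_\alpha$, and $\overline\Omega_\alpha$ the one-dimensional space of translation invariant top exterior forms on $X_\alpha$. An *edge framing* is a choice, for all $\alpha\succ\beta$, of $f_{\beta,\alpha}\in F_\beta\setminus F_\alpha$ and $\xi_{\alpha,\beta}\in T_\alpha\setminus T_\beta$. Fix one. For adjacent $\alpha,\beta$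 it determines an isomorphism $\pi_{\beta,\alpha}:\overline\Omega_\alpha\to\overline\Omega_\beta$ by $$\pi_{\beta,\alpha}(\omega_\alpha)=\omega_\beta\iff df_{\beta,\alpha}\wedge\omega_\beta=\omega_\alpha\ \ (\alpha\succ\beta),\qquad \pi_{\beta,\alpha}(\omega_\alpha)=\omega_\beta\iff i_{\xi_{\beta,\alpha}}\omega_\beta=\omega_\alpha\ \ (\beta\succ\alpha).$$ A *quiver* $\mathcal V=\{V_\alpha,A_{\alpha,\beta}\}$ of $\Gamma$ consists of finite-dimensional complex vector spaces $V_\alpha$ and linear maps $A_{\alpha,\beta}:V_\beta\to V_\alpha$ such that (a) $A_{\alpha,\beta}=0$ if $\alpha,\beta$ are not adjacent; (b) $\sum_\beta A_{\alpha,\beta}A_{\beta,\gamma}=0$ if $|l(\alpha)-l(\gamma)|=2$; (c) $\sum_\beta A_{\alpha,\beta}A_{\beta,\gamma}=0$ if $l(\alpha)=l(\gamma)$, $\alpha\ne\gamma$ and there is $\delta$ with $\alpha\succ\delta$ and $\gamma\succ\delta$. The *quiver $\mathcal D_X$-module* $E\mathcal V$ is the quotient of the left $\mathcal D_X$-module $\bigoplus_\alpha\mathcal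 D_X\otimes_{\mathbb C}\overline\Omega_\alpha\otimes V_\alpha$ by the submodule generated by $$\xi\otimes\omega\otimes v-\sum_{\beta:\,\alpha\succ\beta}\langle\xi,f_{\beta,\alpha}\rangle\,1\otimes\pi_{\beta,\alpha}(\omega)\otimes A_{\beta,\alpha}(v),\qquad f\otimes\omega\otimes v-\sum_{\beta:\,\beta\succ\alpha}\langle\xi_{\beta,\alpha},f\rangle\,1\otimes\pi_{\beta,\alpha}(\omega)\otimes A_{\beta,\alpha}(v)$$ for all $\alpha$, $\omega\in\overline\Omega_\alpha$, $v\in V_\alpha$, $\xi\in T_\alpha$, $f\in F_\alpha$. **The complex.** For $0\le r\le N$ put $$\mathcal R^{-r}E\mathcal V=\bigoplus_\alpha\mathcal D_X\otimes_{\mathbb C}\textstyle\bigwedge^r(T_\alpha\oplus F_\alpha)\otimes\overline\Omega_\alpha\otimes V_\alpha$$ (the right-hand side is $0$ for $r>N$, since $\dim(T_\alpha\oplus F_\alpha)=N$). For $r\ge1$, adjacent $\alpha,\beta$, $\vec\xi\in\bigwedge^pT_\alpha$, $\vec f\in\bigwedge^{r-p}F_\alpha$, $\omega\in\overline\Omega_\alpha$,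 $v\in V_\alpha$ put $$A^r_{\beta,\alpha}(\vec\xi\wedge\vec f\otimes\omega\otimes v)=\begin{cases} i_{f_{\beta,\alpha}}(\vec\xi)\wedge\vec f\otimes\pi_{\beta,\alpha}(\omega)\otimes A_{\beta,\alpha}(v),&\alpha\succ\beta,\\ (-1)^p\,\vec\xi\wedge i_{\xi_{\beta,\alpha}}(\vec f)\otimes\pi_{\beta,\alpha}(\omega)\otimes A_{\beta,\alpha}(v),&\beta\succ\alpha,\end{cases}$$ where $i_f(t_1\wedge\dots\wedge t_p)=\sum_i(-1)^{i+1}\langle t_i,f\rangle\,t_1\wedge\dots\widehat{t_i}\dots\wedge t_p\in\bigwedge^{p-1}T_\beta$ and likewise $i_\xi(f_1\wedge\dots\wedge f_q)=\sum_i(-1)^{i+1}\langle\xi,f_i\rangle\,f_1\wedge\dots\widehat{f_i}\dots\wedge f_q\in\bigwedge^{q-1}F_\beta$, and the inclusions $F_\alpha\subset F_\beta$ (if $\alpha\succ\beta$), $T_\alpha\subset T_\beta$ (if $\beta\succ\alpha$) are used. Define $\mathcal D_X$-linear maps $\mathcal R^{-r}E\mathcal V\to\mathcal R^{-r+1}E\mathcal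 V$ by $$d_1(1\otimes t_1\wedge\dots\wedge t_r\otimes\omega\otimes v)=\sum_{i=1}^r(-1)^{i+1}t_i\otimes t_1\wedge\dots\widehat{t_i}\dots\wedge t_r\otimes\omega\otimes v,$$ $$d_0(1\otimes t_1\wedge\dots\wedge t_r\otimes\omega\otimes v)=\sum_{\beta\text{ adjacent to }\alpha}1\otimes A^r_{\beta,\alpha}(t_1\wedge\dots\wedge t_r\otimes\omega\otimes v)$$ for $t_i\in T_\alpha\oplus F_\alpha$, and let $d=d_1-d_0$. Let $\nu:\mathcal R^0E\mathcal V\to E\mathcal V$ be the $\mathcal D_X$-linear map sending $1\otimes\omega\otimes v$ to its class. **Theorem.** For every arrangement $\mathcal C$, every edge framing and every quiver $\mathcal V$ of $\Gamma$, the sequence $$0\to\mathcal R^{-N}E\mathcal V\xrightarrow{d}\mathcal R^{-N+1}E\mathcal V\xrightarrow{d}\cdots\xrightarrow{d}\mathcal R^0E\mathcal V\xrightarrow{\nu}E\mathcal V\to0$$ is a complex and is exact (acyclic), and each $\mathcal R^{-r}E\mathcal V$ is a free left $\mathcal D_X$-module of finite rank; so it is a finite free resolution of $E\mathcal V$. Exactness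 holds on the level of all localizations: for every multiplicative set $S\subset\mathbb C[z_1,\dots,z_N]$ and $R=S^{-1}\mathbb C[z_1,\dots,z_N]$, the corresponding sequence of left modules over the ring $D_R$ of differential operators of $R$ is exact with finitely generated free terms (global sections for $S=\{1\}$, sections over $g\ne0$ for $S=\{g^k\}$, stalks for $S$ the complement of a prime ideal). -/

import Mathlib

open scoped TensorProduct DirectSum

universe v

noncomputable section

namespace QuiverD

/-! ### The affine space, constant vector fields, affine functions -/

/-- The affine space `X = ℂ^N`. The same vector space is used as the space `T` of vector fields
with constant coefficients: `ξ` stands for `∑ i, ξ i • ∂/∂z_i`. -/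
abbrev Aff (N : ℕ) : Type := Fin N → ℂ

/-- The space `F` of affine functions on `ℂ^N`. The pairing `⟨ξ, f⟩ = i_ξ(df)` of a constant vector
field with an affine function is `f.linear ξ`. -/
abbrev AffFun (N : ℕ) : Type := Aff N →ᵃ[ℂ] ℂ

/-- The pairing `f ↦ ⟨ξ, f⟩` with a constant vector field, as a linear form on `F`. -/
def pairField {N : ℕ} (ξ : Aff N) : AffFun N →ₗ[ℂ] ℂ where
  toFun f := f.linear ξ
  map_add' f g := by simp
  map_smul' c f := by simp

@[simp] theorem pairField_apply {N : ℕ} (ξ : Aff N) (f : AffFun N) :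
    pairField ξ f = f.linear ξ := rfl

/-- The polynomial ring `ℂ[z_1, …, z_N]` of regular functions on `ℂ^N`. -/
abbrev PolyRing (N : ℕ) : Type := MvPolynomial (Fin N) ℂ

/-- An affine function `f = a_0 + ∑ a_i z_i` as a polynomial. -/
def affPoly {N : ℕ} : AffFun N →ₗ[ℂ] PolyRing N where
  toFun f := MvPolynomial.C (f 0) +
    ∑ i, MvPolynomial.C (f.linear (Pi.single i 1)) * MvPolynomial.X i
  map_add' f g := by
    simp [add_mul, Finset.sum_add_distrib]
    ring
  map_smul' c f := by
    simp [MvPolynomial.smul_eq_C_mul, Finset.mul_sum, mul_assoc]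

/-! ### Differential operators -/

/-- The algebra of differential operators of a commutative `ℂ`-algebra `R`: the subalgebra of
`End_ℂ(R)` generated by the multiplications by elements of `R` and by the derivations of `R`
(for smooth affine varieties this is the ring of all linear algebraic differential operators). -/
def diffOp (R : Type) [CommRing R] [Algebra ℂ R] : Subalgebra ℂ (Module.End ℂ R) :=
  Algebra.adjoin ℂ (Set.range (Algebra.lmul ℂ R) ∪
    Set.range (fun δ : Derivation ℂ R R => (δ : R →ₗ[ℂ] R)))

/-- The ring `D_R` of differential operators of `R`. -/
def DiffOp (R : Type) [CommRing R] [Algebra ℂ R] : Type := diffOp R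

instance (R : Type) [CommRing R] [Algebra ℂ R] : Ring (DiffOp R) :=
  inferInstanceAs (Ring (diffOp R))

instance (R : Type) [CommRing R] [Algebra ℂ R] : Algebra ℂ (DiffOp R) :=
  inferInstanceAs (Algebra ℂ (diffOp R))

/-! ### Localizations

The sheaf `𝒟_X` and the sheaves of `𝒟_X`-modules on `X = ℂ^N` are handled through a localization
`R` of `ℂ[z_1, …, z_N]` at an arbitrary submonoid `S`: for `S = {1}` and `R = ℂ[z_1, …, z_N]` one
gets the global sections over `X`, for `S` the powers of a polynomial `g` the sections over the
principal open set `g ≠ 0`, and for `S` the complement of a prime ideal the stalk at a point. -/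

section Localization

variable {N : ℕ} (S : Submonoid (PolyRing N)) (R : Type) [CommRing R] [Algebra ℂ R]
  [Algebra (PolyRing N) R] [IsScalarTower ℂ (PolyRing N) R] [IsLocalization S R]

/-- The extension of a derivation of `ℂ[z_1, …, z_N]` to a localization `R`. -/
def locDerivation (δ : Derivation ℂ (PolyRing N) (PolyRing N)) : Derivation ℂ R R :=
  have : Algebra.FormallyEtale (PolyRing N) R := Algebra.FormallyEtale.of_isLocalization S
  ((LinearMap.liftBaseChange R
      ((Algebra.linearMap (PolyRing N) R) ∘ₗ δ.liftKaehlerDifferential)) ∘ₗ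
    (KaehlerDifferential.tensorKaehlerEquivOfFormallyEtale ℂ (PolyRing N) R).symm.toLinearMap).compDer
      (KaehlerDifferential.D ℂ R)

theorem locDerivation_algebraMap (δ : Derivation ℂ (PolyRing N) (PolyRing N)) (p : PolyRing N) :
    locDerivation S R δ (algebraMap (PolyRing N) R p) = algebraMap (PolyRing N) R (δ p) := by
  have : Algebra.FormallyEtale (PolyRing N) R := Algebra.FormallyEtale.of_isLocalization S
  simp [locDerivation, KaehlerDifferential.tensorKaehlerEquivOfFormallyEtale_symm_D_algebraMap]

/-- The constant vector field `∑ i, ξ i • ∂/∂z_i`, acting on a localization `R` of the ring of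
polynomials. -/
def constField : Aff N →ₗ[ℂ] Derivation ℂ R R where
  toFun ξ := ∑ i, ξ i • locDerivation S R (MvPolynomial.pderiv i)
  map_add' ξ η := by simp [add_smul, Finset.sum_add_distrib]
  map_smul' c ξ := by simp [mul_smul, Finset.smul_sum]

/-- Constant vector fields as differential operators on `R`. -/
def fieldOp : Aff N →ₗ[ℂ] DiffOp R where
  toFun ξ := (⟨(constField S R ξ : R →ₗ[ℂ] R), Algebra.subset_adjoin (Or.inr ⟨_, rfl⟩)⟩ : diffOp R)
  map_add' ξ η := Subtype.ext (by ext; simp; rfl)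
  map_smul' c ξ := Subtype.ext (by ext; simp; rfl)

/-- Affine functions as differential operators (of order zero) on `R`. -/
def funOp : AffFun N →ₗ[ℂ] DiffOp R where
  toFun f := (⟨Algebra.lmul ℂ R (algebraMap (PolyRing N) R (affPoly f)),
    Algebra.subset_adjoin (Or.inl ⟨_, rfl⟩)⟩ : diffOp R)
  map_add' f g := Subtype.ext (by ext; simp; rfl)
  map_smul' c f := Subtype.ext (by
    have h : algebraMap (PolyRing N) R (c • affPoly f) = c • algebraMap (PolyRing N) R (affPoly f) :=
      map_smul (IsScalarTower.toAlgHom ℂ (PolyRing N) R) c (affPoly f)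
    ext
    simp [h]
    rfl)

end Localization

/-! ### Arrangements and their graphs -/

/-- A finite arrangement of affine hyperplanes in `ℂ^N`. -/
structure Arrangement (N : ℕ) where
  /-- the hyperplanes -/
  hyperplanes : Finset (AffineSubspace ℂ (Aff N))
  isHyperplane : ∀ H ∈ hyperplanes,
    (H : Set (Aff N)).Nonempty ∧ Module.finrank ℂ H.direction + 1 = N

namespace Arrangement

variable {N : ℕ} (𝒜 : Arrangement N)

/-- The vertices `α` of the graph of the arrangement correspond to the strata `X_α`; a stratum is
given by its closure, a nonempty intersection of hyperplanes of the arrangement (the empty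
intersection being `ℂ^N`). -/
def Vertex : Type :=
  {L : AffineSubspace ℂ (Aff N) // (L : Set (Aff N)).Nonempty ∧
    ∃ J : Finset (AffineSubspace ℂ (Aff N)), J ⊆ 𝒜.hyperplanes ∧ L = sInf (J : Set _)}

instance : Finite 𝒜.Vertex := by
  have h : Set.Finite {L : AffineSubspace ℂ (Aff N) | (L : Set (Aff N)).Nonempty ∧
      ∃ J : Finset (AffineSubspace ℂ (Aff N)), J ⊆ 𝒜.hyperplanes ∧ L = sInf (J : Set _)} := by
    refine (Set.Finite.image
      (fun J : Finset (AffineSubspace ℂ (Aff N)) => sInf (J : Set (AffineSubspace ℂ (Aff N))))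
      (𝒜.hyperplanes.powerset.finite_toSet)).subset ?_
    rintro L ⟨-, J, hJ, rfl⟩
    exact ⟨J, by simpa using hJ, rfl⟩
  exact h.to_subtype

instance : Fintype 𝒜.Vertex := Fintype.ofFinite _

instance : DecidableEq 𝒜.Vertex := Classical.decEq _

variable {𝒜}

/-- The closure of the stratum `X_α`. -/
abbrev Vertex.closure (α : 𝒜.Vertex) : AffineSubspace ℂ (Aff N) := α.1

/-- The space `T_α` of constant vector fields parallel to the stratum `X_α`. -/
abbrev Vertex.T (α : 𝒜.Vertex) : Submodule ℂ (Aff N) := α.closure.direction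

/-- The space `F_α` of affine functions vanishing on the stratum `X_α` (equivalently, on its
closure). -/
def Vertex.F (α : 𝒜.Vertex) : Submodule ℂ (AffFun N) where
  carrier := {f | ∀ x ∈ α.closure, f x = 0}
  add_mem' {f g} hf hg x hx := by simp [hf x hx, hg x hx]
  zero_mem' x hx := by simp
  smul_mem' c f hf x hx := by simp [hf x hx]

/-- The dimension of the stratum `X_α`. -/
def Vertex.dim (α : 𝒜.Vertex) : ℕ := Module.finrank ℂ α.T

/-- The codimension `l(α)` of the stratum `X_α`. -/
def Vertex.l (α : 𝒜.Vertex) : ℕ := N - α.dim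

/-- `α ≻ β`: the closure of `X_β` is contained in the closure of `X_α`, with codimension one.
The edges of the graph are the pairs `α, β` with `α ≻ β` or `β ≻ α`. -/
def Vertex.Succ (α β : 𝒜.Vertex) : Prop := β.closure ≤ α.closure ∧ α.dim = β.dim + 1

/-- The space `T_α ⊕ F_α`. -/
abbrev Vertex.TF (α : 𝒜.Vertex) : Type := α.T × α.F

/-- The one-dimensional space `Ω̄_α` of translation invariant top exterior forms on `X_α`. -/
abbrev Vertex.Ω (α : 𝒜.Vertex) : Type := α.T [⋀^Fin α.dim]→ₗ[ℂ] ℂ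

theorem Vertex.Succ.T_le {α β : 𝒜.Vertex} (h : α.Succ β) : β.T ≤ α.T :=
  AffineSubspace.direction_le h.1

theorem Vertex.Succ.F_le {α β : 𝒜.Vertex} (h : α.Succ β) : α.F ≤ β.F :=
  fun _ hf x hx => hf x (h.1 hx)

theorem Vertex.linear_eq_zero {α : 𝒜.Vertex} {f : AffFun N} (hf : f ∈ α.F) {ξ : Aff N}
    (hξ : ξ ∈ α.T) : f.linear ξ = 0 := by
  obtain ⟨x, hx⟩ := α.2.1
  have h1 := hf (ξ +ᵥ x) (AffineSubspace.vadd_mem_of_mem_direction hξ hx)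
  rw [AffineMap.map_vadd, hf x hx] at h1
  simpa using h1

theorem Vertex.Succ.mem_or_mem {α β : 𝒜.Vertex} (h : α.Succ β) {f : AffFun N} (hf : f ∈ β.F)
    {ξ : Aff N} (hξ : ξ ∈ α.T) (h0 : f.linear ξ = 0) : f ∈ α.F ∨ ξ ∈ β.T := by
  by_contra! hcon
  obtain ⟨hfα, hξβ⟩ := hcon
  apply hfα
  obtain ⟨x, hx⟩ := β.2.1
  have hlt : β.T < α.T ⊓ LinearMap.ker f.linear := by
    refine lt_of_le_of_ne (le_inf h.T_le fun η hη => Vertex.linear_eq_zero hf hη) ?_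
    intro he
    exact hξβ (he ▸ ⟨hξ, h0⟩)
  have h1 := Submodule.finrank_lt_finrank_of_lt hlt
  have hle : α.T ⊓ LinearMap.ker f.linear ≤ α.T := inf_le_left
  have h2 := h.2
  have heq : α.T ⊓ LinearMap.ker f.linear = α.T := by
    apply Submodule.eq_of_le_of_finrank_le hle
    unfold Vertex.dim at h2
    omega
  intro y hy
  have hd : y -ᵥ x ∈ α.T := AffineSubspace.vsub_mem_direction hy (h.1 hx)
  rw [← heq] at hd
  have h3 : f.linear (y -ᵥ x) = 0 := hd.2
  rw [AffineMap.linearMap_vsub, hf x hx] at h3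
  simpa using h3

end Arrangement

open Arrangement

/-- An edge framing: for every edge `α ≻ β` a function `f_{βα} ∈ F_β ∖ F_α` (here `f α β`) and a
vector field `ξ_{αβ} ∈ T_α ∖ T_β` (here `ξ α β`). The values at other pairs are never used. -/
structure EdgeFraming {N : ℕ} (𝒜 : Arrangement N) where
  /-- the functions -/
  f : 𝒜.Vertex → 𝒜.Vertex → AffFun N
  /-- the vector fields -/
  ξ : 𝒜.Vertex → 𝒜.Vertex → Aff N
  f_mem : ∀ {α β}, α.Succ β → f α β ∈ β.F
  f_notMem : ∀ {α β}, α.Succ β → f α β ∉ α.F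
  ξ_mem : ∀ {α β}, α.Succ β → ξ α β ∈ α.T
  ξ_notMem : ∀ {α β}, α.Succ β → ξ α β ∉ β.T

/-- A quiver of the graph of the arrangement. -/
structure ArrQuiver {N : ℕ} (𝒜 : Arrangement N) where
  /-- the vector spaces `V_α` -/
  V : 𝒜.Vertex → Type v
  [addCommGroup : ∀ α, AddCommGroup (V α)]
  [module : ∀ α, Module ℂ (V α)]
  [finiteDimensional : ∀ α, FiniteDimensional ℂ (V α)]
  /-- the linear maps `A_{αβ} : V_β → V_α` -/
  A : ∀ α β, V β →ₗ[ℂ] V α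
  A_eq_zero : ∀ α β, ¬ (α.Succ β ∨ β.Succ α) → A α β = 0
  sum_eq_zero_of_two : ∀ α γ : 𝒜.Vertex, |(α.l : ℤ) - γ.l| = 2 →
    ∑ β, A α β ∘ₗ A β γ = 0
  sum_eq_zero_of_ne : ∀ α γ : 𝒜.Vertex, α.l = γ.l → α ≠ γ →
    (∃ δ : 𝒜.Vertex, α.Succ δ ∧ γ.Succ δ) → ∑ β, A α β ∘ₗ A β γ = 0

attribute [instance] ArrQuiver.addCommGroup ArrQuiver.module ArrQuiver.finiteDimensional

/-! ### Multilinear algebra -/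

section Multilinear

variable {M M' : Type} [AddCommGroup M] [Module ℂ M] [AddCommGroup M'] [Module ℂ M']

/-- The contraction `⋀^{r+1} M → ⋀^r M` with a linear form `φ`, followed by the map
`⋀^r M → ⋀^r M'` induced by `p`:
`t_0 ∧ ⋯ ∧ t_r ↦ ∑ i, (-1)^i φ(t_i) p(t_0) ∧ ⋯ (omit i) ⋯ ∧ p(t_r)`. -/
def contract (φ : M →ₗ[ℂ] ℂ) (p : M →ₗ[ℂ] M') (r : ℕ) : ⋀[ℂ]^(r + 1) M →ₗ[ℂ] ⋀[ℂ]^r M' :=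
  exteriorPower.alternatingMapLinearEquiv (AlternatingMap.alternatizeUncurryFin
    (φ.smulRight ((exteriorPower.ιMulti ℂ r).compLinearMap p)))

theorem contract_ιMulti (φ : M →ₗ[ℂ] ℂ) (p : M →ₗ[ℂ] M') (r : ℕ) (t : Fin (r + 1) → M) :
    contract φ p r (exteriorPower.ιMulti ℂ (r + 1) t) =
      ∑ i : Fin (r + 1), (-1 : ℤ) ^ (i : ℕ) •
        φ (t i) • exteriorPower.ιMulti ℂ r (fun j => p (i.removeNth t j)) := by
  simp [contract, AlternatingMap.alternatizeUncurryFin_apply]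

variable {D : Type} [Ring D] [Algebra ℂ D]

/-- For a linear map `τ : M → D` the map
`t_0 ∧ ⋯ ∧ t_r ↦ ∑ i, (-1)^i τ(t_i) ⊗ t_0 ∧ ⋯ (omit i) ⋯ ∧ t_r`. -/
def koszul (τ : M →ₗ[ℂ] D) (r : ℕ) : ⋀[ℂ]^(r + 1) M →ₗ[ℂ] D ⊗[ℂ] ⋀[ℂ]^r M :=
  exteriorPower.alternatingMapLinearEquiv (AlternatingMap.alternatizeUncurryFin
    { toFun := fun t =>
        (TensorProduct.mk ℂ D (⋀[ℂ]^r M) (τ t)).compAlternatingMap (exteriorPower.ιMulti ℂ r)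
      map_add' := fun s t => by ext; simp
      map_smul' := fun c t => by ext; simp [TensorProduct.smul_tmul'] })

theorem koszul_ιMulti (τ : M →ₗ[ℂ] D) (r : ℕ) (t : Fin (r + 1) → M) :
    koszul τ r (exteriorPower.ιMulti ℂ (r + 1) t) =
      ∑ i : Fin (r + 1), (-1 : ℤ) ^ (i : ℕ) •
        (τ (t i) ⊗ₜ[ℂ] exteriorPower.ιMulti ℂ r (i.removeNth t)) := by
  simp [koszul, AlternatingMap.alternatizeUncurryFin_apply]

end Multilinear

section Free

variable (D : Type) [Ring D] [Algebra ℂ D]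

/-- The free left `D`-module `D ⊗ G` on a complex vector space `G`. -/
def FreeOn (G : Type v) [AddCommGroup G] [Module ℂ G] : Type v := D ⊗[ℂ] G

variable {G : Type v} [AddCommGroup G] [Module ℂ G]

instance : AddCommGroup (FreeOn D G) := inferInstanceAs (AddCommGroup (D ⊗[ℂ] G))

instance : Module D (FreeOn D G) := inferInstanceAs (Module D (D ⊗[ℂ] G))

instance : Module ℂ (FreeOn D G) := inferInstanceAs (Module ℂ (D ⊗[ℂ] G))

instance : IsScalarTower ℂ D (FreeOn D G) := inferInstanceAs (IsScalarTower ℂ D (D ⊗[ℂ] G))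

/-- The tautological identification. -/
def FreeOn.equiv : D ⊗[ℂ] G ≃ₗ[ℂ] FreeOn D G := LinearEquiv.refl ℂ _

/-- The element `a ⊗ x` of `D ⊗ G`. -/
def FreeOn.tmul (a : D) (x : G) : FreeOn D G := FreeOn.equiv D (a ⊗ₜ[ℂ] x)

/-- The inclusion `x ↦ 1 ⊗ x` of `G` into `D ⊗ G`. -/
def FreeOn.incl : G →ₗ[ℂ] FreeOn D G := (FreeOn.equiv D).toLinearMap ∘ₗ TensorProduct.mk ℂ D G 1

variable {P : Type v} [AddCommGroup P] [Module ℂ P] [Module D P] [IsScalarTower ℂ D P]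

/-- The `D`-linear extension `a ⊗ x ↦ a • g x` of a `ℂ`-linear map `g`. -/
def FreeOn.extend (g : G →ₗ[ℂ] P) : FreeOn D G →ₗ[D] P :=
  TensorProduct.AlgebraTensorModule.lift (LinearMap.toSpanSingleton D (G →ₗ[ℂ] P) g)

theorem FreeOn.extend_tmul (g : G →ₗ[ℂ] P) (a : D) (x : G) :
    FreeOn.extend D g (FreeOn.tmul D a x) = a • g x := rfl

end Free

section ExtCoef

variable (M : Type) [AddCommGroup M] [Module ℂ M] (W : Type v) [AddCommGroup W] [Module ℂ W]

/-- The space `⋀^r M ⊗ W`. -/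
def ExtCoef (r : ℕ) : Type v := ⋀[ℂ]^r M ⊗[ℂ] W

instance (r : ℕ) : AddCommGroup (ExtCoef M W r) :=
  inferInstanceAs (AddCommGroup (⋀[ℂ]^r M ⊗[ℂ] W))

instance (r : ℕ) : Module ℂ (ExtCoef M W r) := inferInstanceAs (Module ℂ (⋀[ℂ]^r M ⊗[ℂ] W))

namespace ExtCoef

/-- The tautological identification. -/
def equiv (r : ℕ) : ⋀[ℂ]^r M ⊗[ℂ] W ≃ₗ[ℂ] ExtCoef M W r := LinearEquiv.refl ℂ _

variable {M W}

/-- The element `t_1 ∧ ⋯ ∧ t_r ⊗ w`. -/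
def mk {r : ℕ} (t : Fin r → M) (w : W) : ExtCoef M W r :=
  equiv M W r (exteriorPower.ιMulti ℂ r t ⊗ₜ[ℂ] w)

variable {M' : Type} [AddCommGroup M'] [Module ℂ M'] {W' : Type v} [AddCommGroup W'] [Module ℂ W']

/-- The tensor product of two linear maps `c` and `g`. -/
def map {r s : ℕ} (c : ⋀[ℂ]^r M →ₗ[ℂ] ⋀[ℂ]^s M') (g : W →ₗ[ℂ] W') :
    ExtCoef M W r →ₗ[ℂ] ExtCoef M' W' s :=
  (equiv M' W' s).toLinearMap ∘ₗ TensorProduct.map c g ∘ₗ (equiv M W r).symm.toLinearMap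

/-- The identification `⋀^0 M ⊗ W → W`. -/
def ofZero : ExtCoef M W 0 →ₗ[ℂ] W :=
  (TensorProduct.lid ℂ W).toLinearMap ∘ₗ (exteriorPower.zeroEquiv ℂ M).toLinearMap.rTensor W ∘ₗ
    (equiv M W 0).symm.toLinearMap

variable {D : Type} [Ring D] [Algebra ℂ D]

/-- The map `t_0 ∧ ⋯ ∧ t_r ⊗ w ↦ ∑ i, (-1)^i τ(t_i) ⊗ t_0 ∧ ⋯ (omit i) ⋯ ∧ t_r ⊗ w`. -/
def koszulMap (τ : M →ₗ[ℂ] D) (r : ℕ) : ExtCoef M W (r + 1) →ₗ[ℂ] FreeOn D (ExtCoef M W r) :=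
  (FreeOn.equiv D).toLinearMap ∘ₗ (equiv M W r).toLinearMap.lTensor D ∘ₗ
    (TensorProduct.assoc ℂ D (⋀[ℂ]^r M) W).toLinearMap ∘ₗ (koszul τ r).rTensor W ∘ₗ
    (equiv M W (r + 1)).symm.toLinearMap

theorem ofZero_mk (t : Fin 0 → M) (w : W) : ofZero (mk t w) = w := by
  simp [ofZero, mk]

end ExtCoef

end ExtCoef

/-! ### Maps attached to an edge -/

namespace EdgeFraming

variable {N : ℕ} {𝒜 : Arrangement N} (fr : EdgeFraming 𝒜) {α β : 𝒜.Vertex}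

/-- The number `⟨ξ_{αβ}, f_{βα}⟩` of an edge `α ≻ β`. -/
def pairing (α β : 𝒜.Vertex) : ℂ := (fr.f α β).linear (fr.ξ α β)

theorem pairing_ne_zero (h : α.Succ β) : fr.pairing α β ≠ 0 := fun h0 =>
  (h.mem_or_mem (fr.f_mem h) (fr.ξ_mem h) h0).elim (fr.f_notMem h) (fr.ξ_notMem h)

/-- The projection `T_α → T_β` along `ξ_{αβ}`, for `α ≻ β`. -/
def projT (h : α.Succ β) : α.T →ₗ[ℂ] β.T :=
  LinearMap.codRestrict β.T
    (α.T.subtype - (((fr.pairing α β)⁻¹ • (fr.f α β).linear) ∘ₗ α.T.subtype).smulRight (fr.ξ α β))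
    (fun η => by
      have h0 := fr.pairing_ne_zero h
      refine (h.mem_or_mem (fr.f_mem h) ?_ ?_).resolve_left (fr.f_notMem h)
      · exact α.T.sub_mem η.2 (α.T.smul_mem _ (fr.ξ_mem h))
      · unfold pairing at *
        simp
        field_simp
        simp)

/-- The projection `F_β → F_α` along `f_{βα}`, for `α ≻ β`. -/
def projF (h : α.Succ β) : β.F →ₗ[ℂ] α.F :=
  LinearMap.codRestrict α.F
    (β.F.subtype -
      (((fr.pairing α β)⁻¹ • pairField (fr.ξ α β)) ∘ₗ β.F.subtype).smulRight (fr.f α β))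
    (fun g => by
      have h0 := fr.pairing_ne_zero h
      refine (h.mem_or_mem ?_ (fr.ξ_mem h) ?_).resolve_right (fr.ξ_notMem h)
      · exact β.F.sub_mem g.2 (β.F.smul_mem _ (fr.f_mem h))
      · unfold pairing at *
        simp
        field_simp
        simp)

theorem projT_apply (h : α.Succ β) (η : α.T) : (fr.projT h η : Aff N) =
    η - ((fr.pairing α β)⁻¹ * (fr.f α β).linear η) • fr.ξ α β := by
  simp [projT]

theorem projF_apply (h : α.Succ β) (g : β.F) : (fr.projF h g : AffFun N) =
    g - ((fr.pairing α β)⁻¹ * (g : AffFun N).linear (fr.ξ α β)) • fr.f α β := by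
  simp [projF]

/-- For `α ≻ β`, the substitution `i_ξ : Ω̄_α → Ω̄_β` of the vector field `ξ = ξ_{αβ}`. -/
def contractForm (h : α.Succ β) : α.Ω →ₗ[ℂ] β.Ω where
  toFun ω := ((ω.domDomCongr (finCongr h.2)).curryLeft ⟨fr.ξ α β, fr.ξ_mem h⟩).compLinearMap
    (Submodule.inclusion h.T_le)
  map_add' _ _ := by
    ext
    rfl
  map_smul' _ _ := by
    ext
    rfl

/-- For `α ≻ β`, the exterior product `df ∧ · : Ω̄_β → Ω̄_α` with the differential of
`f = f_{βα}` (a form on `X_β` is extended to `X_α` along the projection `T_α → T_β`; the product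
with `df` does not depend on the extension). -/
def wedgeForm (h : α.Succ β) : β.Ω →ₗ[ℂ] α.Ω where
  toFun ω := (AlternatingMap.alternatizeUncurryFin
    (((fr.f α β).linear ∘ₗ α.T.subtype).smulRight
      (ω.compLinearMap (fr.projT h)))).domDomCongr (finCongr h.2.symm)
  map_add' ω ω' := by
    ext v
    simp [AlternatingMap.alternatizeUncurryFin_apply, Finset.sum_add_distrib]
  map_smul' c ω := by
    ext v
    simp [AlternatingMap.alternatizeUncurryFin_apply, Finset.mul_sum, mul_left_comm]

/-- For `α ≻ β`, the map `π_{βα} : Ω̄_α → Ω̄_β`. It is the inverse of `df_{βα} ∧ ·`, that is,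
`i_ξ` divided by `⟨ξ, f_{βα}⟩` for `ξ = ξ_{αβ}`. -/
def piDown (h : α.Succ β) : α.Ω →ₗ[ℂ] β.Ω := (fr.pairing α β)⁻¹ • fr.contractForm h

/-- For `α ≻ β`, the map `π_{αβ} : Ω̄_β → Ω̄_α`. It is the inverse of `i_ξ` with `ξ = ξ_{αβ}`, that
is, `df ∧ ·` divided by `⟨ξ, f⟩` for `f = f_{βα}`. -/
def piUp (h : α.Succ β) : β.Ω →ₗ[ℂ] α.Ω := (fr.pairing α β)⁻¹ • fr.wedgeForm h

theorem contractForm_wedgeForm (h : α.Succ β) (ω : β.Ω) :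
    fr.contractForm h (fr.wedgeForm h ω) = fr.pairing α β • ω := by
  ext v
  have h1 : ∀ η : β.T, fr.projT h (Submodule.inclusion h.T_le η) = η := by
    intro η
    apply Subtype.ext
    rw [projT_apply]
    simp [Vertex.linear_eq_zero (fr.f_mem h) η.2]
  have h2 : ∀ i, (fr.f α β).linear (v i : Aff N) = 0 := fun i =>
    Vertex.linear_eq_zero (fr.f_mem h) (v i).2
  have h3 : fr.contractForm h (fr.wedgeForm h ω) v = AlternatingMap.alternatizeUncurryFin
      (((fr.f α β).linear ∘ₗ α.T.subtype).smulRight (ω.compLinearMap (fr.projT h)))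
      (Matrix.vecCons ⟨fr.ξ α β, fr.ξ_mem h⟩ fun i => Submodule.inclusion h.T_le (v i)) := rfl
  rw [h3, AlternatingMap.alternatizeUncurryFin_apply]
  rw [Fin.sum_univ_succ, Finset.sum_eq_zero]
  · simp only [LinearMap.smulRight_apply, AlternatingMap.smul_apply,
      AlternatingMap.compLinearMap_apply]
    simp [pairing, Fin.removeNth, h1]
  · intro i _
    simp [h2]

theorem wedgeForm_contractForm (h : α.Succ β) (ω : α.Ω) :
    fr.wedgeForm h (fr.contractForm h ω) = fr.pairing α β • ω := by
  let b : Module.Basis (Fin α.dim) ℂ α.T := Module.finBasis ℂ α.T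
  let b' : Module.Basis (Fin β.dim) ℂ β.T := Module.finBasis ℂ β.T
  have hb : ∀ ω : α.Ω, ω = ω b • b.det := fun ω => ω.eq_smul_basis_det b
  have hc := fr.pairing_ne_zero h
  have hdet : fr.contractForm h b.det ≠ 0 := by
    intro h0
    have h1 := fr.contractForm_wedgeForm h b'.det
    rw [hb (fr.wedgeForm h b'.det), map_smul, h0, smul_zero] at h1
    exact smul_ne_zero hc b'.det_ne_zero h1.symm
  obtain ⟨k, hk⟩ : ∃ k : ℂ, fr.wedgeForm h (fr.contractForm h b.det) = k • b.det :=
    ⟨_, hb _⟩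
  have hkc : k = fr.pairing α β := by
    have h1 := fr.contractForm_wedgeForm h (fr.contractForm h b.det)
    rw [hk, map_smul] at h1
    exact smul_left_injective ℂ hdet h1
  rw [hb ω, map_smul, map_smul, hk, hkc, smul_comm]

/-- `π_{βα}(ω_α) = ω_β` if and only if `df_{βα} ∧ ω_β = ω_α`, for `α ≻ β`. -/
theorem piDown_eq_iff (h : α.Succ β) (ω : α.Ω) (ω' : β.Ω) :
    fr.piDown h ω = ω' ↔ fr.wedgeForm h ω' = ω := by
  have hc := fr.pairing_ne_zero h
  constructor
  · rintro rfl
    simp [piDown, wedgeForm_contractForm, hc]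
  · rintro rfl
    simp [piDown, contractForm_wedgeForm, hc]

/-- `π_{αβ}(ω_β) = ω_α` if and only if `i_ξ(ω_α) = ω_β`, for `α ≻ β` and `ξ = ξ_{αβ}`. -/
theorem piUp_eq_iff (h : α.Succ β) (ω : β.Ω) (ω' : α.Ω) :
    fr.piUp h ω = ω' ↔ fr.contractForm h ω' = ω := by
  have hc := fr.pairing_ne_zero h
  constructor
  · rintro rfl
    simp [piUp, contractForm_wedgeForm, hc]
  · rintro rfl
    simp [piUp, wedgeForm_contractForm, hc]

/-- For `α ≻ β` and `f = f_{βα}`, the substitution of `df` into the factor `⋀ T_α` of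
`⋀ (T_α ⊕ F_α) = ⋀ T_α ⊗ ⋀ F_α`, with values in `⋀ (T_β ⊕ F_β)`. The contraction of a polyvector
with `df` is a polyvector of `T_β = T_α ∩ ker df`, which the projection `T_α → T_β` fixes. -/
def contractDown (h : α.Succ β) (r : ℕ) : ⋀[ℂ]^(r + 1) α.TF →ₗ[ℂ] ⋀[ℂ]^r β.TF :=
  contract ((fr.f α β).linear ∘ₗ α.T.subtype ∘ₗ LinearMap.fst ℂ α.T α.F)
    ((fr.projT h).prodMap (Submodule.inclusion h.F_le)) r

/-- For `α ≻ β` and `ξ = ξ_{αβ}`, the substitution of `ξ` into the factor `⋀ F_β` of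
`⋀ (T_β ⊕ F_β) = ⋀ T_β ⊗ ⋀ F_β` (with the sign `(-1)^p` on `⋀^p T_β`), with values in
`⋀ (T_α ⊕ F_α)`. The contraction of an element of `⋀ F_β` with `ξ` is an element of the exterior
algebra of `F_α = {f ∈ F_β | ⟨ξ, f⟩ = 0}`, which the projection `F_β → F_α` fixes. -/
def contractUp (h : α.Succ β) (r : ℕ) : ⋀[ℂ]^(r + 1) β.TF →ₗ[ℂ] ⋀[ℂ]^r α.TF :=
  contract (pairField (fr.ξ α β) ∘ₗ β.F.subtype ∘ₗ LinearMap.snd ℂ β.T β.F)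
    ((Submodule.inclusion h.T_le).prodMap (fr.projF h)) r

end EdgeFraming

/-! ### The quiver `D`-module and the complex -/

namespace ArrQuiver

variable {N : ℕ} {𝒜 : Arrangement N} (𝒱 : ArrQuiver.{v} 𝒜) (fr : EdgeFraming 𝒜)

/-- The space `Ω̄_α ⊗ V_α`. -/
def Coef (α : 𝒜.Vertex) : Type v := α.Ω ⊗[ℂ] 𝒱.V α

instance (α : 𝒜.Vertex) : AddCommGroup (𝒱.Coef α) :=
  inferInstanceAs (AddCommGroup (α.Ω ⊗[ℂ] 𝒱.V α))

instance (α : 𝒜.Vertex) : Module ℂ (𝒱.Coef α) := inferInstanceAs (Module ℂ (α.Ω ⊗[ℂ] 𝒱.V α))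

/-- The tautological identification. -/
def coefEquiv (α : 𝒜.Vertex) : α.Ω ⊗[ℂ] 𝒱.V α ≃ₗ[ℂ] 𝒱.Coef α := LinearEquiv.refl ℂ _

variable {𝒱} in
/-- The element `ω ⊗ v` of `Ω̄_α ⊗ V_α`. -/
def coef {α : 𝒜.Vertex} (ω : α.Ω) (v : 𝒱.V α) : 𝒱.Coef α := 𝒱.coefEquiv α (ω ⊗ₜ[ℂ] v)

/-- The tensor product `Ω̄_α ⊗ V_α → Ω̄_β ⊗ V_β` of two linear maps. -/
def coefMap {α β : 𝒜.Vertex} (p : α.Ω →ₗ[ℂ] β.Ω) (A : 𝒱.V α →ₗ[ℂ] 𝒱.V β) :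
    𝒱.Coef α →ₗ[ℂ] 𝒱.Coef β :=
  (𝒱.coefEquiv β).toLinearMap ∘ₗ TensorProduct.map p A ∘ₗ (𝒱.coefEquiv α).symm.toLinearMap

/-- The space `⋀^r (T_α ⊕ F_α) ⊗ Ω̄_α ⊗ V_α`. -/
abbrev Gen (r : ℕ) (α : 𝒜.Vertex) : Type v := ExtCoef α.TF (𝒱.Coef α) r

/-- The map `A^{r+1}_{βα}` from `⋀^{r+1} (T_α ⊕ F_α) ⊗ Ω̄_α ⊗ V_α` to
`⋀^r (T_β ⊕ F_β) ⊗ Ω̄_β ⊗ V_β`; it is zero unless `α` and `β` are adjacent. -/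
def edgeMap (r : ℕ) (β α : 𝒜.Vertex) : 𝒱.Gen (r + 1) α →ₗ[ℂ] 𝒱.Gen r β :=
  open Classical in
  if h : α.Succ β then ExtCoef.map (fr.contractDown h r) (𝒱.coefMap (fr.piDown h) (𝒱.A β α))
  else if h : β.Succ α then
    ExtCoef.map (fr.contractUp h r) (𝒱.coefMap (fr.piUp h) (𝒱.A β α))
  else 0

section

variable (S : Submonoid (PolyRing N)) (R : Type) [CommRing R] [Algebra ℂ R]
  [Algebra (PolyRing N) R] [IsScalarTower ℂ (PolyRing N) R] [IsLocalization S R]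

/-- The free left `D_R`-module `⨁_α D_R ⊗ ⋀^r (T_α ⊕ F_α) ⊗ Ω̄_α ⊗ V_α`, the term of degree `-r`
of the complex. -/
abbrev Res (r : ℕ) : Type v := ⨁ α : 𝒜.Vertex, FreeOn (DiffOp R) (𝒱.Gen r α)

/-- The inclusion `T_α ⊕ F_α → D_R`. -/
def symbolOp (α : 𝒜.Vertex) : α.TF →ₗ[ℂ] DiffOp R :=
  (fieldOp S R ∘ₗ α.T.subtype).coprod (funOp R ∘ₗ α.F.subtype)

/-- The differential `d_1`:
`1 ⊗ t_0 ∧ ⋯ ∧ t_r ⊗ ω ⊗ v ↦ ∑ i, (-1)^i t_i ⊗ t_0 ∧ ⋯ (omit i) ⋯ ∧ t_r ⊗ ω ⊗ v`. -/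
def d₁ (r : ℕ) : 𝒱.Res R (r + 1) →ₗ[DiffOp R] 𝒱.Res R r :=
  DirectSum.toModule (DiffOp R) 𝒜.Vertex _ fun α =>
    DirectSum.lof (DiffOp R) 𝒜.Vertex (fun α => FreeOn (DiffOp R) (𝒱.Gen r α)) α ∘ₗ
      FreeOn.extend (DiffOp R) (ExtCoef.koszulMap (symbolOp S R α) r)

/-- The differential `d_0`, the sum of the maps `A^{r+1}_{βα}` over all edges. -/
def d₀ (r : ℕ) : 𝒱.Res R (r + 1) →ₗ[DiffOp R] 𝒱.Res R r :=
  DirectSum.toModule (DiffOp R) 𝒜.Vertex _ fun α => ∑ β : 𝒜.Vertex,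
    DirectSum.lof (DiffOp R) 𝒜.Vertex (fun α => FreeOn (DiffOp R) (𝒱.Gen r α)) β ∘ₗ
      FreeOn.extend (DiffOp R) (FreeOn.incl (DiffOp R) ∘ₗ 𝒱.edgeMap fr r β α)

/-- The differential `d = d_1 - d_0`. -/
def d (r : ℕ) : 𝒱.Res R (r + 1) →ₗ[DiffOp R] 𝒱.Res R r := 𝒱.d₁ S R r - 𝒱.d₀ fr R r

/-- The free left `D_R`-module `⨁_α D_R ⊗ Ω̄_α ⊗ V_α`. -/
abbrev FreeMod : Type v := ⨁ α : 𝒜.Vertex, FreeOn (DiffOp R) (𝒱.Coef α)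

/-- The element `a ⊗ ω ⊗ v` of `⨁_α D_R ⊗ Ω̄_α ⊗ V_α`. -/
def gen (α : 𝒜.Vertex) (a : DiffOp R) (ω : α.Ω) (v : 𝒱.V α) : 𝒱.FreeMod R :=
  DirectSum.lof (DiffOp R) 𝒜.Vertex (fun α => FreeOn (DiffOp R) (𝒱.Coef α)) α
    (FreeOn.tmul (DiffOp R) a (coef ω v))

open Classical in
/-- The submodule of relations defining the quiver `D`-module:
`ξ ⊗ ω_α ⊗ v_α = ∑_{β, α ≻ β} ⟨ξ, f_{βα}⟩ ⊗ π_{βα}(ω_α) ⊗ A_{βα}(v_α)` for `ξ ∈ T_α`, and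
`f ⊗ ω_α ⊗ v_α = ∑_{β, β ≻ α} ⟨ξ_{βα}, f⟩ ⊗ π_{βα}(ω_α) ⊗ A_{βα}(v_α)` for `f ∈ F_α`. -/
def relations : Submodule (DiffOp R) (𝒱.FreeMod R) :=
  Submodule.span (DiffOp R)
    ({x | ∃ (α : 𝒜.Vertex) (ξ : α.T) (ω : α.Ω) (v : 𝒱.V α),
        x = 𝒱.gen R α (fieldOp S R (ξ : Aff N)) ω v - ∑ β : 𝒜.Vertex,
          if h : α.Succ β then
            (fr.f α β).linear (ξ : Aff N) • 𝒱.gen R β 1 (fr.piDown h ω) (𝒱.A β α v)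
          else 0} ∪
      {x | ∃ (α : 𝒜.Vertex) (f : α.F) (ω : α.Ω) (v : 𝒱.V α),
        x = 𝒱.gen R α (funOp R (f : AffFun N)) ω v - ∑ β : 𝒜.Vertex,
          if h : β.Succ α then
            (f : AffFun N).linear (fr.ξ β α) • 𝒱.gen R β 1 (fr.piUp h ω) (𝒱.A β α v)
          else 0})

/-- The quiver `D_R`-module `E𝒱`: the quotient of `⨁_α D_R ⊗ Ω̄_α ⊗ V_α` by the relations. -/
abbrev E : Type v := 𝒱.FreeMod R ⧸ 𝒱.relations fr S R

/-- The map `ν` from the term of degree zero to `E𝒱` which sends `1 ⊗ 1 ⊗ ω ⊗ v` to the class of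
`1 ⊗ ω ⊗ v`. -/
def ν : 𝒱.Res R 0 →ₗ[DiffOp R] 𝒱.E fr S R :=
  (𝒱.relations fr S R).mkQ ∘ₗ
    DirectSum.toModule (DiffOp R) 𝒜.Vertex _ fun α =>
      DirectSum.lof (DiffOp R) 𝒜.Vertex (fun α => FreeOn (DiffOp R) (𝒱.Coef α)) α ∘ₗ
        FreeOn.extend (DiffOp R) (FreeOn.incl (DiffOp R) ∘ₗ ExtCoef.ofZero)

end

end ArrQuiver

end QuiverD

end

/-! Write d = d₁ - d₀. On the summand of a stratum α, d₁ is the Koszul differential for right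
multiplication by the commuting operators in T_α ⊕ F_α; d₀ is a perturbation which moves between
adjacent strata. The proof shows that d² = 0, that d₁ is exact in positive degrees compatibly with a
filtration, and that d₀ strictly lowers this filtration.

The equation d² = 0 splits into three. For d₁² = 0 and d₁d₀ + d₀d₁ = 0 the terms cancel in pairs
(`sum_sum_removeNth_eq_zero`); in the second, the projection of the framing changes the operator
attached to t only by φ(t) times a fixed operator, where φ is the form being contracted
(`dK_baseMap_add`). For d₀² = 0 consider the two-step paths from α to γ. Each contributes a double
contraction, a map of top forms and a composite A A. Changing the middle stratum rescales the first
two factors by constants which cancel in the tensor product (`down_down`, `up_up`, `up_down`), so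
the sum factors through ∑ A A and the quiver relations kill it. Where no relation is available, the
double contraction itself vanishes (`sum_edgeMap_comp`).

For the exactness of d₁, adapted linear coordinates present the polynomial differential operators as
a Weyl algebra with generators x_i, the images of a basis of T_α ⊕ F_α, and dual generators y_i.
With the homotopy h = ∑ [·, y_i] ⊗ (e_i ∧ ·) one has dh + hd = E + r in exterior degree r, where E P
= ∑ [P, y_i] x_i is diagonalizable with eigenvalues in ℕ. For r > 0 this operator is inverted on
each given element by a polynomial in itself, which respects every filtration that d and h respect
(`KoszulFrame.exists_sub_d_mem_kFil`).

Filter by the order of the operator plus the number of vector fields in the exterior factor,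
functions counting zero, and bound this by about (w + dim α - N)/2 on the summand of α. Along α ≻ β
the map d₀ removes a vector field; along β ≻ α it does not raise the filtration while the dimension
grows. The halving turns both into a drop of w by one (`edgeOp_mem_kFil`), so a cycle can be
corrected one step of w at a time until it is zero (`exists_d_eq_of_bounded`).

Over a localization, left multiplication by an element of S makes the coefficients of a cycle
polynomial, commutes with d and is invertible, so exactness follows in general. In degree zero the
relations defining the quiver module are precisely the images of generators under d
(`relations_eq`). -/

noncomputable section

namespace QuiverD

/-! ### Alternating double sums -/

/-- The double alternating sum of a function which is symmetric in the two omitted entries. -/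
theorem sum_sum_removeNth_eq_zero {M G : Type*} [AddCommGroup G] {r : ℕ}
    (F : M → M → (Fin r → M) → G) (hF : ∀ x y t, F x y t = F y x t) (t : Fin (r + 2) → M) :
    ∑ i : Fin (r + 2), (-1 : ℤ) ^ (i : ℕ) • ∑ j : Fin (r + 1), (-1 : ℤ) ^ (j : ℕ) •
      F (t i) (i.removeNth t j) (j.removeNth (i.removeNth t)) = 0 := by
  simp only [Finset.smul_sum]
  rw [Fin.sum_sum_eq_sum_triangle_add]
  refine Finset.sum_eq_zero fun i _ => Finset.sum_eq_zero fun j hj => ?_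
  rw [Finset.mem_Ici] at hj
  have h₁ : i.castSucc.removeNth t j = t j.succ := by
    simp [Fin.removeNth_apply, Fin.succAbove_of_le_castSucc, hj]
  have h₂ : j.succ.removeNth t i = t i.castSucc := by
    simp [Fin.removeNth_apply, Fin.succAbove_of_castSucc_lt, hj]
  have h₃ : i.removeNth (j.succ.removeNth t) = j.removeNth (i.castSucc.removeNth t) := by
    rw [Fin.removeNth_removeNth_eq_swap]
    simp [Fin.predAbove, hj, Fin.succAbove]
  rw [h₁, h₂, h₃, hF (t j.succ)]
  simp only [Fin.val_castSucc, Fin.val_succ, pow_succ, smul_smul]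
  rw [← add_smul]
  convert zero_smul ℤ _ using 2
  ring

/-! ### Elements of `D ⊗ ⋀^r M ⊗ W` -/

section Kos

variable {D : Type} [Ring D] [Algebra ℂ D]
variable {M M' : Type} [AddCommGroup M] [Module ℂ M] [AddCommGroup M'] [Module ℂ M']
variable {W W' : Type v} [AddCommGroup W] [Module ℂ W] [AddCommGroup W'] [Module ℂ W']

/-- The trilinear map `(P, ω, w) ↦ P ⊗ ω ⊗ w`. -/
def triple (r : ℕ) : D →ₗ[ℂ] ⋀[ℂ]^r M →ₗ[ℂ] W →ₗ[ℂ] FreeOn D (ExtCoef M W r) where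
  toFun P := (TensorProduct.mk ℂ (⋀[ℂ]^r M) W).compr₂
    ((FreeOn.equiv D).toLinearMap ∘ₗ TensorProduct.mk ℂ D (ExtCoef M W r) P ∘ₗ
      (ExtCoef.equiv M W r).toLinearMap)
  map_add' P Q := by
    ext
    simp
  map_smul' c P := by
    ext
    simp

/-- The element `P ⊗ t_1 ∧ ⋯ ∧ t_r ⊗ w`. -/
def kos {r : ℕ} (P : D) (t : Fin r → M) (w : W) : FreeOn D (ExtCoef M W r) :=
  triple r P (exteriorPower.ιMulti ℂ r t) w

theorem kos_add {r : ℕ} (P Q : D) (t : Fin r → M) (w : W) :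
    kos (P + Q) t w = kos P t w + kos Q t w := by
  simp [kos]

theorem smul_triple {r : ℕ} (Q P : D) (ω : ⋀[ℂ]^r M) (w : W) :
    Q • triple r P ω w = triple r (Q * P) ω w := rfl

theorem smul_kos {r : ℕ} (Q P : D) (t : Fin r → M) (w : W) :
    Q • kos P t w = kos (Q * P) t w := rfl

theorem kos_eq_smul {r : ℕ} (P : D) (t : Fin r → M) (w : W) :
    kos P t w = P • kos 1 t w := by
  rw [smul_kos, mul_one]

theorem span_tmul (G : Type v) [AddCommGroup G] [Module ℂ G] :
    Submodule.span ℂ {x : FreeOn D G | ∃ P g, x = FreeOn.tmul D P g} = ⊤ := by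
  have h := TensorProduct.span_tmul_eq_top ℂ D G
  refine Eq.trans ?_ h
  congr 1
  ext x
  exact ⟨fun ⟨P, g, h⟩ => ⟨P, g, h.symm⟩, fun ⟨P, g, h⟩ => ⟨P, g, h.symm⟩⟩

theorem span_mk (r : ℕ) :
    Submodule.span ℂ {x : ExtCoef M W r | ∃ t w, x = ExtCoef.mk t w} = ⊤ := by
  rw [eq_top_iff]
  rintro x -
  induction x using TensorProduct.induction_on with
  | zero => exact Submodule.zero_mem _
  | add x y hx hy => exact Submodule.add_mem _ hx hy
  | tmul ω w =>
    have hω : ω ∈ Submodule.span ℂ (Set.range (exteriorPower.ιMulti ℂ r (M := M))) := by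
      rw [exteriorPower.ιMulti_span]
      trivial
    induction hω using Submodule.span_induction with
    | mem ω h =>
      obtain ⟨t, rfl⟩ := h
      exact Submodule.subset_span ⟨t, w, rfl⟩
    | zero =>
      rw [TensorProduct.zero_tmul]
      exact Submodule.zero_mem _
    | add a b _ _ ha hb =>
      rw [TensorProduct.add_tmul]
      exact Submodule.add_mem _ ha hb
    | smul c a _ ha =>
      rw [← TensorProduct.smul_tmul']
      exact Submodule.smul_mem _ c ha

theorem span_kos (r : ℕ) :
    Submodule.span ℂ {x : FreeOn D (ExtCoef M W r) | ∃ P t w, x = kos P t w} = ⊤ := by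
  rw [eq_top_iff, ← span_tmul, Submodule.span_le]
  rintro _ ⟨P, g, rfl⟩
  have hg : g ∈ Submodule.span ℂ {x : ExtCoef M W r | ∃ t w, x = ExtCoef.mk t w} := by
    rw [span_mk]
    trivial
  let f : ExtCoef M W r →ₗ[ℂ] FreeOn D (ExtCoef M W r) :=
    (FreeOn.equiv D).toLinearMap ∘ₗ TensorProduct.mk ℂ D (ExtCoef M W r) P
  have h := Submodule.mem_map_of_mem (f := f) hg
  rw [Submodule.map_span] at h
  refine Submodule.span_mono ?_ h
  rintro _ ⟨_, ⟨t, w, rfl⟩, rfl⟩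
  exact ⟨P, t, w, rfl⟩

/-- No scalar case is needed: a complex factor is absorbed by the operator P, so sums of the
elements `kos P t w` already exhaust the module. -/
theorem kos_induction {r : ℕ} {p : FreeOn D (ExtCoef M W r) → Prop} (h0 : p 0)
    (hadd : ∀ x y, p x → p y → p (x + y)) (hkos : ∀ P t w, p (kos P t w))
    (x : FreeOn D (ExtCoef M W r)) : p x := by
  have hx : x ∈ Submodule.span ℂ {x : FreeOn D (ExtCoef M W r) | ∃ P t w, x = kos P t w} := by
    rw [span_kos]
    trivial
  have h : x ∈ AddSubmonoid.closure {x : FreeOn D (ExtCoef M W r) | ∃ P t w, x = kos P t w} := by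
    induction hx using Submodule.closure_induction with
    | zero => exact AddSubmonoid.zero_mem _
    | add x y _ _ hx hy => exact AddSubmonoid.add_mem _ hx hy
    | smul_mem c x hx =>
      obtain ⟨P, t, w, rfl⟩ := hx
      refine AddSubmonoid.subset_closure ⟨c • P, t, w, ?_⟩
      simp [kos]
  clear hx
  induction h using AddSubmonoid.closure_induction with
  | mem x hx =>
    obtain ⟨P, t, w, rfl⟩ := hx
    exact hkos P t w
  | zero => exact h0
  | add x y _ _ hx hy => exact hadd x y hx hy

theorem hom_ext_kos' {r : ℕ} {Q : Type*} [AddCommGroup Q] [Module D Q]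
    {f g : FreeOn D (ExtCoef M W r) →ₗ[D] Q} (h : ∀ t w, f (kos 1 t w) = g (kos 1 t w)) :
    f = g := by
  refine LinearMap.ext fun x => ?_
  induction x using kos_induction with
  | h0 => simp
  | hadd x y hx hy => simp [hx, hy]
  | hkos P t w => rw [kos_eq_smul, map_smul, map_smul, h]

/-- The tensor product of three linear maps. -/
def tripleMap {r s : ℕ} (a : D →ₗ[ℂ] D) (c : ⋀[ℂ]^r M →ₗ[ℂ] ⋀[ℂ]^s M') (g : W →ₗ[ℂ] W') :
    FreeOn D (ExtCoef M W r) →ₗ[ℂ] FreeOn D (ExtCoef M' W' s) :=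
  (FreeOn.equiv D).toLinearMap ∘ₗ TensorProduct.map a (ExtCoef.map c g) ∘ₗ
    (FreeOn.equiv D).symm.toLinearMap

theorem tripleMap_triple {r s : ℕ} (a : D →ₗ[ℂ] D) (c : ⋀[ℂ]^r M →ₗ[ℂ] ⋀[ℂ]^s M')
    (g : W →ₗ[ℂ] W') (P : D) (ω : ⋀[ℂ]^r M) (w : W) :
    tripleMap a c g (triple r P ω w) = triple s (a P) (c ω) (g w) := rfl

/-- The Koszul differential on `D ⊗ ⋀^r M ⊗ W`. -/
def dK (W : Type v) [AddCommGroup W] [Module ℂ W] (τ : M →ₗ[ℂ] D) (r : ℕ) :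
    FreeOn D (ExtCoef M W (r + 1)) →ₗ[D] FreeOn D (ExtCoef M W r) :=
  FreeOn.extend D (ExtCoef.koszulMap τ r)

theorem koszulMap_mk (τ : M →ₗ[ℂ] D) (r : ℕ) (t : Fin (r + 1) → M) (w : W) :
    ExtCoef.koszulMap τ r (ExtCoef.mk t w) =
      ∑ i : Fin (r + 1), (-1 : ℤ) ^ (i : ℕ) • kos (τ (t i)) (i.removeNth t) w := by
  have h : ExtCoef.koszulMap τ r (ExtCoef.mk t w) =
      ((FreeOn.equiv D).toLinearMap ∘ₗ (ExtCoef.equiv M W r).toLinearMap.lTensor D ∘ₗ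
        (TensorProduct.assoc ℂ D (⋀[ℂ]^r M) W).toLinearMap ∘ₗ
        (TensorProduct.mk ℂ (D ⊗[ℂ] ⋀[ℂ]^r M) W).flip w)
        (koszul τ r (exteriorPower.ιMulti ℂ (r + 1) t)) := rfl
  rw [h, koszul_ιMulti, map_sum]
  refine Finset.sum_congr rfl fun i _ => ?_
  rw [map_zsmul]
  rfl

theorem dK_kos (τ : M →ₗ[ℂ] D) (r : ℕ) (P : D) (t : Fin (r + 1) → M) (w : W) :
    dK W τ r (kos P t w) =
      ∑ i : Fin (r + 1), (-1 : ℤ) ^ (i : ℕ) • kos (P * τ (t i)) (i.removeNth t) w := by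
  have h : dK W τ r (kos P t w) = P • ExtCoef.koszulMap τ r (ExtCoef.mk t w) := rfl
  rw [h, koszulMap_mk, Finset.smul_sum]
  refine Finset.sum_congr rfl fun i _ => ?_
  rw [smul_comm, smul_kos]

/-- The `D`-linear map `P ⊗ ω ⊗ w ↦ P ⊗ c ω ⊗ g w`. -/
def baseMap {r s : ℕ} (c : ⋀[ℂ]^r M →ₗ[ℂ] ⋀[ℂ]^s M') (g : W →ₗ[ℂ] W') :
    FreeOn D (ExtCoef M W r) →ₗ[D] FreeOn D (ExtCoef M' W' s) :=
  FreeOn.extend D (FreeOn.incl D ∘ₗ ExtCoef.map c g)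

theorem baseMap_triple {r s : ℕ} (c : ⋀[ℂ]^r M →ₗ[ℂ] ⋀[ℂ]^s M') (g : W →ₗ[ℂ] W')
    (P : D) (ω : ⋀[ℂ]^r M) (w : W) :
    baseMap c g (triple r P ω w) = triple s P (c ω) (g w) := by
  have h : baseMap c g (triple r P ω w) = P • triple s 1 (c ω) (g w) := rfl
  rw [h, smul_triple, mul_one]

theorem baseMap_contract_kos (φ : M →ₗ[ℂ] ℂ) (p : M →ₗ[ℂ] M') (g : W →ₗ[ℂ] W') {r : ℕ}
    (P : D) (t : Fin (r + 1) → M) (w : W) :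
    baseMap (contract φ p r) g (kos P t w) =
      ∑ i : Fin (r + 1), (-1 : ℤ) ^ (i : ℕ) • φ (t i) • kos P (p ∘ i.removeNth t) (g w) := by
  rw [kos, baseMap_triple, contract_ιMulti, map_sum, LinearMap.sum_apply]
  refine Finset.sum_congr rfl fun i _ => ?_
  rw [map_zsmul, map_smul]
  rfl

/-- Commutativity makes the coefficient τ x τ y symmetric in the two omitted entries, so the signed
double sum cancels. -/
theorem dK_comp_dK (τ : M →ₗ[ℂ] D) (hτ : ∀ s t, τ s * τ t = τ t * τ s) (r : ℕ) :
    dK W τ r ∘ₗ dK W τ (r + 1) = 0 := by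
  refine hom_ext_kos' fun t w => ?_
  have h := sum_sum_removeNth_eq_zero (fun x y (t : Fin r → M) => kos (τ x * τ y) t w)
    (fun x y t => by rw [hτ]) t
  rw [LinearMap.comp_apply, dK_kos, map_sum, LinearMap.zero_apply, ← h]
  refine Finset.sum_congr rfl fun i _ => ?_
  rw [map_zsmul, dK_kos, one_mul]

/-- The total coefficient of the two omitted entries is φ(x) τ(y) + φ(y) τ(x) - φ(x) φ(y) c, which
is symmetric. This applies to every edge, since there p is a projection along a framing element and
c is a multiple of the operator of that element. -/
theorem dK_baseMap_add (τ : M →ₗ[ℂ] D) (τ' : M' →ₗ[ℂ] D) (φ : M →ₗ[ℂ] ℂ) (p : M →ₗ[ℂ] M')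
    (c : D) (hp : ∀ t, τ' (p t) = τ t - φ t • c) (g : W →ₗ[ℂ] W') (r : ℕ) :
    dK W' τ' r ∘ₗ baseMap (contract φ p (r + 1)) g +
      baseMap (contract φ p r) g ∘ₗ dK W τ (r + 1) = 0 := by
  refine hom_ext_kos' fun t w => ?_
  have h := sum_sum_removeNth_eq_zero (fun x y (t : Fin r → M) =>
    triple r (φ x • τ' (p y) + φ y • τ x) (exteriorPower.ιMulti ℂ r (p ∘ t)) (g w))
    (fun x y t => by
      have h : φ x • τ' (p y) + φ y • τ x = φ y • τ' (p x) + φ x • τ y := by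
        rw [hp, hp, smul_sub, smul_sub, smul_smul, smul_smul, mul_comm (φ x)]
        abel
      rw [h]) t
  rw [LinearMap.add_apply, LinearMap.comp_apply, LinearMap.comp_apply, dK_kos,
    baseMap_contract_kos, map_sum, map_sum, LinearMap.zero_apply, ← h, ← Finset.sum_add_distrib]
  refine Finset.sum_congr rfl fun i _ => ?_
  rw [map_zsmul, map_zsmul, baseMap_contract_kos, LinearMap.map_smul_of_tower, dK_kos, ← smul_add]
  congr 1
  rw [Finset.smul_sum, ← Finset.sum_add_distrib]
  refine Finset.sum_congr rfl fun j _ => ?_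
  rw [smul_comm, ← smul_add]
  congr 1
  simp only [map_add, map_smul, LinearMap.add_apply, LinearMap.smul_apply, one_mul]
  rfl

end Kos

end QuiverD

/-! ### Koszul complexes of commuting elements with a dual family: the contracting homotopy. -/

namespace QuiverD

/-! ### Exterior multiplication -/

section Wedge

/-- Exterior multiplication by a vector on the left. -/
def wedge {M : Type} [AddCommGroup M] [Module ℂ M] (e : M) (r : ℕ) : ⋀[ℂ]^r M →ₗ[ℂ] ⋀[ℂ]^(r + 1) M :=
  exteriorPower.alternatingMapLinearEquiv ((exteriorPower.ιMulti ℂ (r + 1)).curryLeft e)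

theorem wedge_ιMulti {M : Type} [AddCommGroup M] [Module ℂ M] (e : M) {r : ℕ} (t : Fin r → M) :
    wedge e r (exteriorPower.ιMulti ℂ r t) =
      exteriorPower.ιMulti ℂ (r + 1) (Matrix.vecCons e t) := by
  simp [wedge]

theorem removeNth_zero_vecCons {M : Type} (e : M) {r : ℕ} (t : Fin r → M) :
    (0 : Fin (r + 1)).removeNth (Matrix.vecCons e t) = t := by
  ext i
  simp [Fin.removeNth]

theorem removeNth_succ_vecCons {M : Type} (e : M) {r : ℕ} (t : Fin (r + 1) → M) (i : Fin (r + 1)) :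
    i.succ.removeNth (Matrix.vecCons e t) = Matrix.vecCons e (i.removeNth t) := by
  ext j
  refine Fin.cases ?_ (fun j => ?_) j <;> simp [Fin.removeNth]

end Wedge

/-! ### The commutator with an element -/

section Ad

variable {D : Type} [Ring D] [Algebra ℂ D]

/-- The linear map `P ↦ P a - a P`. -/
def ad (a : D) : D →ₗ[ℂ] D := LinearMap.mulRight ℂ a - LinearMap.mulLeft ℂ a

theorem ad_apply (a P : D) : ad a P = P * a - a * P := rfl

theorem ad_mul (a P Q : D) : ad a (P * Q) = P * ad a Q + ad a P * Q := by
  simp only [ad_apply]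
  noncomm_ring

end Ad

/-! ### A filtered Koszul complex with a dual frame -/

/-- Commuting elements `τ t` of an algebra `D`, a basis of the space of the `t` with a dual family
of elements `y i` of `D`, and filtrations which are compatible with them. -/
structure KoszulFrame (D : Type) [Ring D] [Algebra ℂ D] (M : Type) [AddCommGroup M] [Module ℂ M]
    (ι : Type) [Fintype ι] where
  /-- the linear map to `D` -/
  τ : M →ₗ[ℂ] D
  /-- the basis -/
  b : Module.Basis ι ℂ M
  /-- the dual family -/
  y : ι → D
  comm : ∀ s t, τ s * τ t = τ t * τ s
  y_comm : ∀ i j, y i * y j = y j * y i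
  ad_y : ∀ t i, ad (y i) (τ t) = algebraMap ℂ D (b.coord i t)
  /-- the filtration of `D` -/
  Fil : ℕ → Submodule ℂ D
  /-- the elements of degree zero -/
  M₀ : Submodule ℂ M
  Fil_zero : Fil 0 = ⊥
  mem_adjoin : ∀ {k P}, P ∈ Fil k → P ∈ Algebra.adjoin ℂ (Set.range (τ ∘ b) ∪ Set.range y)
  mul_mem : ∀ {k P} (t : M), P ∈ Fil k → P * τ t ∈ Fil (k + 1)
  mul_mem₀ : ∀ {k P} {t : M}, t ∈ M₀ → P ∈ Fil k → P * τ t ∈ Fil k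
  ad_mem : ∀ i, (b i ∈ M₀ ∧ ∀ {k P}, P ∈ Fil k → ad (y i) P ∈ Fil k) ∨
    ∀ {k P}, P ∈ Fil (k + 1) → ad (y i) P ∈ Fil k

namespace KoszulFrame

variable {D : Type} [Ring D] [Algebra ℂ D] {M : Type} [AddCommGroup M] [Module ℂ M]
  {ι : Type} [Fintype ι] (K : KoszulFrame D M ι) (W : Type v) [AddCommGroup W] [Module ℂ W]

/-- The operator `P ↦ ∑ i, [P, y i] x i`, where `x i` is the image of the `i`-th basis vector. -/
def euler : D →ₗ[ℂ] D := ∑ i, LinearMap.mulRight ℂ (K.τ (K.b i)) ∘ₗ ad (K.y i)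

theorem euler_apply (P : D) : K.euler P = ∑ i, ad (K.y i) P * K.τ (K.b i) := by
  simp [euler]

/-- Since the y's commute, each [·, y_i] commutes with left multiplication by y_j. Together with the
next two lemmas this says that `euler` counts the x's once they are moved to the right of the y's.
-/
theorem euler_y_mul (j : ι) (P : D) : K.euler (K.y j * P) = K.y j * K.euler P := by
  simp only [euler_apply, Finset.mul_sum, ad_mul]
  refine Finset.sum_congr rfl fun i _ => ?_
  rw [ad_apply (K.y i) (K.y j), K.y_comm i j, sub_self, zero_mul, add_zero, mul_assoc]

theorem euler_mul_x (j : ι) (P : D) :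
    K.euler (P * K.τ (K.b j)) = K.euler P * K.τ (K.b j) + P * K.τ (K.b j) := by
  classical
  simp only [euler_apply, Finset.sum_mul, ad_mul, add_mul, Finset.sum_add_distrib]
  rw [add_comm]
  congr 1
  · refine Finset.sum_congr rfl fun i _ => ?_
    rw [mul_assoc, mul_assoc, K.comm]
  · rw [Finset.sum_eq_single j]
    · simp [K.ad_y]
    · intro i _ hij
      simp [K.ad_y, Finsupp.single_eq_of_ne hij]
    · simp

/-- The x's commute with each other and their commutators with the y's are scalars, so [·, x_j]
commutes with every [·, y_i]. -/
theorem euler_ad_x (j : ι) (P : D) :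
    K.euler (ad (K.τ (K.b j)) P) = ad (K.τ (K.b j)) (K.euler P) := by
  simp only [euler_apply, map_sum]
  refine Finset.sum_congr rfl fun i _ => ?_
  rw [ad_mul, ad_apply _ (K.τ (K.b i)), K.comm, sub_self, mul_zero, zero_add]
  congr 1
  have h1 : K.τ (K.b j) * K.y i =
      K.y i * K.τ (K.b j) + algebraMap ℂ D (K.b.coord i (K.b j)) := by
    rw [← K.ad_y, ad_apply]
    abel
  have h2 := Algebra.commutes (K.b.coord i (K.b j)) P
  simp only [ad_apply, sub_mul, mul_sub, mul_assoc]
  rw [h1]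
  simp only [← mul_assoc, h1]
  simp only [add_mul, mul_add, mul_assoc, h2]
  abel

/-- The sums of eigenvectors of `euler` with eigenvalues in `ℕ`. -/
def eigenSum : Submodule ℂ D := Submodule.span ℂ {P | ∃ n : ℕ, K.euler P = (n : ℂ) • P}

/-- It is enough that left multiplication by a generator preserves the span of eigenvectors: y_j
preserves the eigenvalue, and x_j produces the eigenvalues n and n + 1. -/
theorem mem_eigenSum {P : D}
    (hP : P ∈ Algebra.adjoin ℂ (Set.range (K.τ ∘ K.b) ∪ Set.range K.y)) : P ∈ K.eigenSum := by
  have hone : (1 : D) ∈ K.eigenSum :=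
    Submodule.subset_span ⟨0, by simp [euler_apply, ad_apply]⟩
  have hleft : ∀ a ∈ Set.range (K.τ ∘ K.b) ∪ Set.range K.y, ∀ Q ∈ K.eigenSum,
      a * Q ∈ K.eigenSum := by
    intro a ha Q hQ
    induction hQ using Submodule.span_induction with
    | zero => simp
    | add P Q _ _ hP hQ =>
      rw [mul_add]
      exact Submodule.add_mem _ hP hQ
    | smul c P _ hP =>
      rw [mul_smul_comm]
      exact Submodule.smul_mem _ c hP
    | mem Q hQ =>
      obtain ⟨n, hn⟩ := hQ
      obtain ⟨j, rfl⟩ | ⟨j, rfl⟩ := ha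
      · have h : (K.τ ∘ K.b) j * Q = Q * K.τ (K.b j) - ad (K.τ (K.b j)) Q := by
          rw [ad_apply, sub_sub_cancel]
          rfl
        rw [h]
        refine Submodule.sub_mem _ (Submodule.subset_span ⟨n + 1, ?_⟩)
          (Submodule.subset_span ⟨n, ?_⟩)
        · rw [euler_mul_x, hn, smul_mul_assoc, Nat.cast_add, Nat.cast_one, add_smul, one_smul]
        · rw [euler_ad_x, hn, map_smul]
      · refine Submodule.subset_span ⟨n, ?_⟩
        rw [euler_y_mul, hn, mul_smul_comm]
  rw [← Subalgebra.mem_toSubmodule, Algebra.adjoin_eq_span] at hP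
  refine Submodule.span_le.2 ?_ hP
  intro a ha
  induction ha using Submonoid.closure_induction_left with
  | one => exact hone
  | mul_left a ha Q _ hQ => exact hleft a ha Q hQ

/-- The Koszul differential. -/
abbrev d (r : ℕ) : FreeOn D (ExtCoef M W (r + 1)) →ₗ[D] FreeOn D (ExtCoef M W r) := dK W K.τ r

/-- The homotopy `P ⊗ ω ⊗ w ↦ ∑ i, [P, y i] ⊗ e i ∧ ω ⊗ w`. -/
def h (r : ℕ) : FreeOn D (ExtCoef M W r) →ₗ[ℂ] FreeOn D (ExtCoef M W (r + 1)) :=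
  ∑ i, tripleMap (ad (K.y i)) (wedge (K.b i) r) LinearMap.id

variable {W}

theorem h_kos {r : ℕ} (P : D) (t : Fin r → M) (w : W) :
    K.h W r (kos P t w) = ∑ i, kos (ad (K.y i) P) (Matrix.vecCons (K.b i) t) w := by
  simp only [h, LinearMap.sum_apply]
  refine Finset.sum_congr rfl fun i _ => ?_
  rw [kos, tripleMap_triple, wedge_ιMulti]
  rfl

variable (W) in
/-- The operator which is homotopic to zero. -/
def L (r : ℕ) : FreeOn D (ExtCoef M W r) →ₗ[ℂ] FreeOn D (ExtCoef M W r) :=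
  tripleMap K.euler LinearMap.id LinearMap.id + (r : ℂ) • LinearMap.id

theorem L_kos {r : ℕ} (P : D) (t : Fin r → M) (w : W) :
    K.L W r (kos P t w) = kos (K.euler P) t w + (r : ℂ) • kos P t w := rfl

/-- In dh, omitting the new vector e_i gives `euler`; the other terms cancel against the part of hd
where y_i is commuted with P. The part of hd where y_i meets τ(t_k) restores the original element
once for each of the r + 1 positions k. -/
theorem d_h_add_h_d (r : ℕ) (x : FreeOn D (ExtCoef M W (r + 1))) :
    K.d W (r + 1) (K.h W (r + 1) x) + K.h W r (K.d W r x) = K.L W (r + 1) x := by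
  induction x using kos_induction with
  | h0 => simp
  | hadd x y hx hy =>
    simp only [map_add, ← hx, ← hy]
    abel
  | hkos P t w =>
    have h1 : K.d W (r + 1) (K.h W (r + 1) (kos P t w)) = kos (K.euler P) t w -
        ∑ k : Fin (r + 1), (-1 : ℤ) ^ (k : ℕ) •
          ∑ i, kos (ad (K.y i) P * K.τ (t k)) (Matrix.vecCons (K.b i) (k.removeNth t)) w := by
      simp only [Finset.smul_sum]
      rw [h_kos, map_sum, Finset.sum_comm, euler_apply, kos, map_sum, LinearMap.sum_apply,
        LinearMap.sum_apply, ← Finset.sum_sub_distrib]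
      refine Finset.sum_congr rfl fun i _ => ?_
      rw [d, dK_kos, Fin.sum_univ_succ]
      simp only [Fin.val_zero, pow_zero, one_smul, Matrix.cons_val_zero, removeNth_zero_vecCons,
        Fin.val_succ, Matrix.cons_val_succ, removeNth_succ_vecCons, pow_succ, mul_neg, mul_one,
        neg_smul, Finset.sum_neg_distrib]
      rw [sub_eq_add_neg]
      rfl
    have h2 : K.h W r (K.d W r (kos P t w)) = ∑ k : Fin (r + 1), (-1 : ℤ) ^ (k : ℕ) •
          ∑ i, kos (ad (K.y i) P * K.τ (t k)) (Matrix.vecCons (K.b i) (k.removeNth t)) w +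
        (r + 1 : ℂ) • kos P t w := by
      -- Expanding t_k in the basis puts t_k in front of the remaining vectors; moving it back to
      -- position k costs exactly the sign (-1)^k.
      have h3 : ∀ k : Fin (r + 1), (-1 : ℤ) ^ (k : ℕ) • ∑ i, kos
          (algebraMap ℂ D (K.b.coord i (t k)) * P) (Matrix.vecCons (K.b i) (k.removeNth t)) w =
          kos P t w := by
        intro k
        have h4 : ∑ i, kos (algebraMap ℂ D (K.b.coord i (t k)) * P)
            (Matrix.vecCons (K.b i) (k.removeNth t)) w =
            triple (r + 1) P (wedge (t k) r (exteriorPower.ιMulti ℂ r (k.removeNth t))) w := by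
          conv_rhs => rw [← K.b.sum_repr (t k)]
          simp only [wedge, map_sum, map_smul, LinearMap.sum_apply, LinearMap.smul_apply]
          refine Finset.sum_congr rfl fun i _ => ?_
          rw [← Algebra.smul_def, ← wedge, wedge_ιMulti, kos, map_smul]
          rfl
        rw [h4, wedge_ιMulti, ← AlternatingMap.neg_one_pow_smul_map_insertNth,
          Fin.insertNth_self_removeNth]
        rw [map_zsmul, LinearMap.smul_apply, smul_smul, ← mul_pow]
        simp [kos]
      rw [d, dK_kos, map_sum]
      have h5 : (r + 1 : ℂ) • kos P t w = ∑ k : Fin (r + 1), kos P t w := by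
        rw [Finset.sum_const, Finset.card_univ, Fintype.card_fin, ← Nat.cast_smul_eq_nsmul ℂ,
          Nat.cast_add, Nat.cast_one]
      rw [h5, ← Finset.sum_add_distrib]
      refine Finset.sum_congr rfl fun k _ => ?_
      rw [map_zsmul, h_kos]
      conv_rhs => rw [← h3 k]
      rw [← smul_add, ← Finset.sum_add_distrib]
      congr 1
      refine Finset.sum_congr rfl fun i _ => ?_
      rw [ad_mul, K.ad_y, ← Algebra.commutes, kos_add]
      exact add_comm _ _
    rw [h1, h2, L_kos]
    push_cast
    abel

end KoszulFrame

end QuiverD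

/-! ### The filtered Koszul complex and its exactness in positive degrees. -/

namespace QuiverD

namespace KoszulFrame

variable {D : Type} [Ring D] [Algebra ℂ D] {M : Type} [AddCommGroup M] [Module ℂ M]
  {ι : Type} [Fintype ι] (K : KoszulFrame D M ι) (W : Type v) [AddCommGroup W] [Module ℂ W]

/-- The filtration of `D ⊗ ⋀^r M ⊗ W`. -/
def kFil (r k : ℕ) : Submodule ℂ (FreeOn D (ExtCoef M W r)) :=
  Submodule.span ℂ {x | ∃ (j : ℕ) (n : Fin r → ℕ) (P : D) (t : Fin r → M) (w : W),
    P ∈ K.Fil j ∧ (∀ i, n i = 0 → t i ∈ K.M₀) ∧ j + ∑ i, n i ≤ k ∧ x = kos P t w}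

variable {W}

theorem kos_mem_kFil {r k j : ℕ} (n : Fin r → ℕ) {P : D} {t : Fin r → M} (w : W)
    (hP : P ∈ K.Fil j) (ht : ∀ i, n i = 0 → t i ∈ K.M₀) (hk : j + ∑ i, n i ≤ k) :
    kos P t w ∈ K.kFil W r k := Submodule.subset_span ⟨j, n, P, t, w, hP, ht, hk, rfl⟩

theorem kos_mem_kFil_add {r j : ℕ} {P : D} (t : Fin r → M) (w : W) (hP : P ∈ K.Fil j) :
    kos P t w ∈ K.kFil W r (j + r) :=
  K.kos_mem_kFil (fun _ => 1) w hP (by simp) (by simp)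

theorem kFil_mono {r k l : ℕ} (h : k ≤ l) : K.kFil W r k ≤ K.kFil W r l :=
  Submodule.span_mono fun _ ⟨j, n, P, t, w, hP, ht, hk, hx⟩ =>
    ⟨j, n, P, t, w, hP, ht, hk.trans h, hx⟩

theorem kFil_zero (r : ℕ) : K.kFil W r 0 = ⊥ := by
  rw [eq_bot_iff, kFil, Submodule.span_le]
  rintro _ ⟨j, n, P, t, w, hP, -, hk, rfl⟩
  obtain rfl : j = 0 := by omega
  rw [K.Fil_zero, Submodule.mem_bot] at hP
  simp [hP, kos]

theorem kFil_le_comap {r s k l : ℕ} {M' : Type} [AddCommGroup M'] [Module ℂ M'] {W' : Type v}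
    [AddCommGroup W'] [Module ℂ W'] {ι' : Type} [Fintype ι'] (K' : KoszulFrame D M' ι')
    (f : FreeOn D (ExtCoef M W r) →ₗ[ℂ] FreeOn D (ExtCoef M' W' s))
    (hf : ∀ (j : ℕ) (n : Fin r → ℕ) (P : D) (t : Fin r → M) (w : W),
      P ∈ K.Fil j → (∀ i, n i = 0 → t i ∈ K.M₀) → j + ∑ i, n i ≤ k →
      f (kos P t w) ∈ K'.kFil W' s l)
    {x : FreeOn D (ExtCoef M W r)} (hx : x ∈ K.kFil W r k) : f x ∈ K'.kFil W' s l := by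
  have h : K.kFil W r k ≤ (K'.kFil W' s l).comap f := by
    rw [kFil, Submodule.span_le]
    rintro _ ⟨j, n, P, t, w, hP, ht, hk, rfl⟩
    exact hf j n P t w hP ht hk
  exact h hx

/-- The weight of the omitted vector pays for the growth of the operator: a vector of `M₀` costs
nothing and any other vector of the list has weight at least one. -/
theorem d_mem_kFil {r k : ℕ} {x : FreeOn D (ExtCoef M W (r + 1))} (hx : x ∈ K.kFil W (r + 1) k) :
    K.d W r x ∈ K.kFil W r k := by
  refine K.kFil_le_comap K ((K.d W r).restrictScalars ℂ) (fun j n P t w hP ht hk => ?_) hx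
  rw [LinearMap.restrictScalars_apply, d, dK_kos]
  refine Submodule.sum_mem _ fun i _ => ?_
  rw [← Int.cast_smul_eq_zsmul ℂ]
  refine Submodule.smul_mem _ _ ?_
  rw [Fin.sum_univ_succAbove n i] at hk
  by_cases hi : n i = 0
  · exact K.kos_mem_kFil (i.removeNth n) w (K.mul_mem₀ (ht i hi) hP) (fun j hj => ht _ hj)
      (by simpa [hi, Fin.removeNth] using hk)
  · exact K.kos_mem_kFil (i.removeNth n) w (K.mul_mem (t i) hP) (fun j hj => ht _ hj)
      (by simp only [Fin.removeNth]; omega)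

/-- By `ad_mem`, either e_i has weight zero and [·, y_i] preserves `Fil`, or e_i is given weight one
and [·, y_i] lowers `Fil` by one. -/
theorem h_mem_kFil {r k : ℕ} {x : FreeOn D (ExtCoef M W r)} (hx : x ∈ K.kFil W r k) :
    K.h W r x ∈ K.kFil W (r + 1) k := by
  refine K.kFil_le_comap K (K.h W r) (fun j n P t w hP ht hk => ?_) hx
  rw [h_kos]
  refine Submodule.sum_mem _ fun i _ => ?_
  obtain ⟨hi, had⟩ | had := K.ad_mem i
  · refine K.kos_mem_kFil (Matrix.vecCons 0 n) w (had hP) (fun l => ?_) ?_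
    · refine Fin.cases (fun _ => hi) (fun l hl => ht l hl) l
    · rw [Fin.sum_univ_succ]
      simpa using hk
  -- `Fil 0` is zero, so for j = 0 there is no level to lower and the element vanishes.
  · obtain _ | j := j
    · rw [K.Fil_zero, Submodule.mem_bot] at hP
      simp [hP, kos]
    · refine K.kos_mem_kFil (Matrix.vecCons 1 n) w (had hP) (fun l => ?_) ?_
      · refine Fin.cases (fun h => ?_) (fun l hl => ht l hl) l
        simp at h
      · rw [Fin.sum_univ_succ]
        simp only [Matrix.cons_val_zero, Matrix.cons_val_succ]
        omega

theorem L_mem_kFil {r k : ℕ} {x : FreeOn D (ExtCoef M W (r + 1))}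
    (hx : x ∈ K.kFil W (r + 1) k) : K.L W (r + 1) x ∈ K.kFil W (r + 1) k := by
  rw [← d_h_add_h_d]
  exact Submodule.add_mem _ (K.d_mem_kFil (K.h_mem_kFil hx)) (K.h_mem_kFil (K.d_mem_kFil hx))

theorem d_d (r : ℕ) (x : FreeOn D (ExtCoef M W (r + 2))) : K.d W r (K.d W (r + 1) x) = 0 :=
  LinearMap.congr_fun (dK_comp_dK K.τ K.comm r) x

theorem d_L (r : ℕ) (x : FreeOn D (ExtCoef M W (r + 2))) :
    K.d W (r + 1) (K.L W (r + 2) x) = K.L W (r + 1) (K.d W (r + 1) x) := by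
  rw [← d_h_add_h_d, ← d_h_add_h_d, map_add, d_d, d_d, map_zero, zero_add, add_zero]

open Polynomial in
theorem d_aeval_L (q : ℂ[X]) (r : ℕ) (x : FreeOn D (ExtCoef M W (r + 2))) :
    K.d W (r + 1) (aeval (K.L W (r + 2)) q x) = aeval (K.L W (r + 1)) q (K.d W (r + 1) x) := by
  induction q using Polynomial.induction_on generalizing x with
  | C a => simp [LinearMap.map_smul_of_tower]
  | add p q hp hq => simp [hp, hq]
  | monomial n a h =>
    rw [pow_succ, ← mul_assoc, map_mul, aeval_X, Module.End.mul_apply, h, d_L, map_mul _ _ X,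
      aeval_X, Module.End.mul_apply]

open Polynomial in
theorem aeval_L_mem_kFil (q : ℂ[X]) {r k : ℕ} {x : FreeOn D (ExtCoef M W (r + 1))}
    (hx : x ∈ K.kFil W (r + 1) k) : aeval (K.L W (r + 1)) q x ∈ K.kFil W (r + 1) k := by
  induction q using Polynomial.induction_on generalizing x with
  | C a => simpa using Submodule.smul_mem _ a hx
  | add p q hp hq => simpa using Submodule.add_mem _ (hp hx) (hq hx)
  | monomial n a h =>
    rw [pow_succ, ← mul_assoc, map_mul, aeval_X, Module.End.mul_apply]
    exact h (K.L_mem_kFil hx)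

-- The elements killed by a polynomial in `L` with nonzero constant term form a subspace, because
-- such polynomials are closed under products. It contains the eigenvectors, whose eigenvalues are
-- positive in positive exterior degree.
open Polynomial in
theorem exists_aeval_L_eq_zero {r k : ℕ} {x : FreeOn D (ExtCoef M W (r + 1))}
    (hx : x ∈ K.kFil W (r + 1) k) :
    ∃ q : ℂ[X], q.eval 0 ≠ 0 ∧ aeval (K.L W (r + 1)) q x = 0 := by
  let S : Submodule ℂ (FreeOn D (ExtCoef M W (r + 1))) :=
    { carrier := {x | ∃ q : ℂ[X], q.eval 0 ≠ 0 ∧ aeval (K.L W (r + 1)) q x = 0}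
      zero_mem' := ⟨1, by simp, by simp⟩
      add_mem' := by
        rintro x y ⟨p, hp, hx⟩ ⟨q, hq, hy⟩
        refine ⟨p * q, by simp [hp, hq], ?_⟩
        rw [map_add, mul_comm, map_mul, Module.End.mul_apply, hx, ← map_mul, mul_comm, map_mul,
          Module.End.mul_apply, hy, map_zero, map_zero, add_zero]
      smul_mem' := by
        rintro c x ⟨q, hq, hx⟩
        exact ⟨q, hq, by rw [map_smul, hx, smul_zero]⟩ }
  suffices h : K.kFil W (r + 1) k ≤ S from h hx
  rw [kFil, Submodule.span_le]
  rintro _ ⟨j, n, P, t, w, hP, -, -, rfl⟩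
  suffices h : K.eigenSum ≤ S.comap
      (((triple (r + 1)).flip (exteriorPower.ιMulti ℂ (r + 1) t)).flip w) from
    h (K.mem_eigenSum (K.mem_adjoin hP))
  rw [eigenSum, Submodule.span_le]
  rintro Q ⟨n, hn⟩
  -- The eigenvalue is n from `euler` plus the exterior degree r + 1, hence nonzero even for n = 0.
  refine ⟨X - C ((n + (r + 1) : ℕ) : ℂ), ?_, ?_⟩
  · rw [eval_sub, eval_X, eval_C, zero_sub, neg_ne_zero, Nat.cast_ne_zero]
    omega
  · have h : K.L W (r + 1) (kos Q t w) = ((n + (r + 1) : ℕ) : ℂ) • kos Q t w := by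
      rw [L_kos, hn]
      simp only [kos, map_smul, LinearMap.smul_apply, ← add_smul, Nat.cast_add]
    rw [map_sub, aeval_X, aeval_C, LinearMap.sub_apply]
    exact sub_eq_zero.2 h

-- If q = q(0) + X p kills x and q(0) ≠ 0, then -p(L)/q(0) inverts L on x. An inverse of this form
-- preserves the filtration and commutes with d.
open Polynomial in
theorem exists_aeval_L_L_eq {r k : ℕ} {x : FreeOn D (ExtCoef M W (r + 1))}
    (hx : x ∈ K.kFil W (r + 1) k) :
    ∃ q : ℂ[X], aeval (K.L W (r + 1)) q (K.L W (r + 1) x) = x := by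
  obtain ⟨q, hq, h⟩ := K.exists_aeval_L_eq_zero hx
  obtain ⟨p, hp⟩ : X ∣ q - C (q.eval 0) := by
    rw [X_dvd_iff]
    simp [coeff_zero_eq_eval_zero]
  refine ⟨-C ((q.eval 0)⁻¹) * p, ?_⟩
  have h1 : aeval (K.L W (r + 1)) (p * X) x = -(q.eval 0 • x) := by
    rw [mul_comm, ← hp, map_sub, LinearMap.sub_apply, h, zero_sub, aeval_C]
    rfl
  rw [map_mul, aeval_X, Module.End.mul_apply] at h1
  rw [map_mul, Module.End.mul_apply, h1, map_neg, map_neg, aeval_C, LinearMap.neg_apply, neg_neg,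
    Module.algebraMap_end_apply, smul_smul, inv_mul_cancel₀ hq, one_smul]

/-- The Koszul complex is acyclic in positive degrees in a way compatible with the filtrations. -/
theorem exists_sub_d_mem_kFil {r k : ℕ} {x : FreeOn D (ExtCoef M W (r + 1))}
    (hx : x ∈ K.kFil W (r + 1) (k + 1)) (hdx : K.d W r x ∈ K.kFil W r k) :
    ∃ y ∈ K.kFil W (r + 2) (k + 1), x - K.d W (r + 1) y ∈ K.kFil W (r + 1) k := by
  obtain ⟨q, hq⟩ := K.exists_aeval_L_L_eq hx
  -- The witness is y = q(L) h x. From x = q(L)(dh + hd) x the remainder is x - d y = q(L) h d x,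
  -- and this lies where d x lies.
  refine ⟨_, K.aeval_L_mem_kFil q (K.h_mem_kFil hx), ?_⟩
  rw [d_aeval_L]
  nth_rw 1 [← hq]
  rw [← d_h_add_h_d, map_add, add_sub_cancel_left]
  exact K.aeval_L_mem_kFil q (K.h_mem_kFil hdx)

end KoszulFrame

end QuiverD

/-! ### The Weyl algebra inside `DiffOp R`: commutation relations, denominators and order. -/

namespace QuiverD

/-! ### Relations between differential operators -/

section Relations

theorem sum_derivation_apply {R ι : Type*} [CommRing R] [Algebra ℂ R] (s : Finset ι)
    (δ : ι → Derivation ℂ R R) (x : R) : (∑ i ∈ s, δ i) x = ∑ i ∈ s, δ i x := by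
  have h := map_sum (Derivation.coeFnAddMonoidHom (R := ℂ) (A := R) (M := R)) δ s
  exact (congrFun h x).trans (Finset.sum_apply _ _ _)

/-- A derivation of a localization of the polynomial ring which vanishes on the variables is
zero. -/
theorem derivation_eq_zero {N : ℕ} (S : Submonoid (PolyRing N)) {R : Type} [CommRing R]
    [Algebra ℂ R] [Algebra (PolyRing N) R] [IsScalarTower ℂ (PolyRing N) R] [IsLocalization S R]
    {δ : Derivation ℂ R R}
    (h : ∀ i, δ (algebraMap (PolyRing N) R (MvPolynomial.X i)) = 0) : δ = 0 := by
  have h1 : ∀ p : PolyRing N, δ (algebraMap (PolyRing N) R p) = 0 := by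
    intro p
    induction p using MvPolynomial.induction_on with
    | C a =>
      have hC : algebraMap (PolyRing N) R (MvPolynomial.C a) = algebraMap ℂ R a :=
        (IsScalarTower.algebraMap_apply ℂ (PolyRing N) R a).symm
      rw [hC, Derivation.map_algebraMap]
    | add p q hp hq => rw [map_add, map_add, hp, hq, add_zero]
    | mul_X p i hp => rw [map_mul, Derivation.leibniz, hp, h, smul_zero, smul_zero, add_zero]
  ext x
  obtain ⟨⟨p, s⟩, hx⟩ := IsLocalization.surj S x
  have h2 := h1 p
  rw [← hx, Derivation.leibniz, h1, smul_zero, zero_add, smul_eq_mul] at h2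
  exact (IsLocalization.map_units R s).mul_right_eq_zero.1 h2

variable {N : ℕ} (S : Submonoid (PolyRing N)) (R : Type) [CommRing R] [Algebra ℂ R]
  [Algebra (PolyRing N) R] [IsScalarTower ℂ (PolyRing N) R] [IsLocalization S R]

/-- Differential operators as endomorphisms. -/
def toEnd : DiffOp R →ₐ[ℂ] Module.End ℂ R := (diffOp R).val

variable {R} in
theorem toEnd_injective : Function.Injective (toEnd R) := Subtype.val_injective

/-- The multiplication operators. -/
def mulOp : R →ₐ[ℂ] DiffOp R :=
  (Algebra.lmul ℂ R).codRestrict (diffOp R) fun r => Algebra.subset_adjoin (Or.inl ⟨r, rfl⟩)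

/-- The derivations as differential operators. -/
def derOp : Derivation ℂ R R →ₗ[ℂ] DiffOp R where
  toFun δ := (⟨(δ : R →ₗ[ℂ] R), Algebra.subset_adjoin (Or.inr ⟨δ, rfl⟩)⟩ : diffOp R)
  map_add' _ _ := rfl
  map_smul' _ _ := rfl

theorem toEnd_mulOp (r x : R) : toEnd R (mulOp R r) x = r * x := rfl

theorem toEnd_derOp (δ : Derivation ℂ R R) (x : R) : toEnd R (derOp R δ) x = δ x := rfl

theorem fieldOp_eq (ξ : Aff N) : fieldOp S R ξ = derOp R (constField S R ξ) := rfl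

theorem funOp_eq (f : AffFun N) : funOp R f = mulOp R (algebraMap (PolyRing N) R (affPoly f)) :=
  rfl

variable {R} in
theorem derOp_mul_mulOp (δ : Derivation ℂ R R) (r : R) :
    derOp R δ * mulOp R r = mulOp R r * derOp R δ + mulOp R (δ r) := by
  refine toEnd_injective (LinearMap.ext fun x => ?_)
  simp only [map_mul, map_add, Module.End.mul_apply, LinearMap.add_apply, toEnd_mulOp, toEnd_derOp,
    Derivation.leibniz, smul_eq_mul]
  ring

theorem constField_X (ξ : Aff N) (i : Fin N) :
    constField S R ξ (algebraMap (PolyRing N) R (MvPolynomial.X i)) = algebraMap ℂ R (ξ i) := by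
  have h : constField S R ξ = ∑ i, ξ i • locDerivation S R (MvPolynomial.pderiv i) := rfl
  rw [h, sum_derivation_apply, Finset.sum_eq_single i]
  · rw [Derivation.smul_apply, locDerivation_algebraMap, MvPolynomial.pderiv_X_self, map_one,
      Algebra.smul_def, mul_one]
  · intro j _ hj
    rw [Derivation.smul_apply, locDerivation_algebraMap, MvPolynomial.pderiv_X_of_ne hj.symm,
      map_zero, smul_zero]
  · simp

theorem constField_affPoly (ξ : Aff N) (f : AffFun N) :
    constField S R ξ (algebraMap (PolyRing N) R (affPoly f)) = algebraMap ℂ R (f.linear ξ) := by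
  have hC : ∀ c : ℂ, algebraMap (PolyRing N) R (MvPolynomial.C c) = algebraMap ℂ R c := fun c =>
    (IsScalarTower.algebraMap_apply ℂ (PolyRing N) R c).symm
  have h : affPoly f = MvPolynomial.C (f 0) +
    ∑ i, MvPolynomial.C (f.linear (Pi.single i 1)) * MvPolynomial.X i := rfl
  rw [h]
  simp only [map_add, map_sum, map_mul, hC, Derivation.leibniz, constField_X,
    Derivation.map_algebraMap, smul_eq_mul, mul_zero, add_zero, zero_add]
  conv_rhs => rw [LinearMap.pi_apply_eq_sum_univ f.linear ξ]
  simp only [map_sum, smul_eq_mul, map_mul]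
  refine Finset.sum_congr rfl fun i _ => ?_
  rw [mul_comm]
  congr 3
  ext j
  simp [Pi.single_apply, eq_comm]

/-- The bracket of two constant fields is a derivation which kills the coordinates, since their
images under a constant field are constants. -/
theorem fieldOp_comm (ξ η : Aff N) :
    fieldOp S R ξ * fieldOp S R η = fieldOp S R η * fieldOp S R ξ := by
  have h : ⁅constField S R ξ, constField S R η⁆ = 0 := by
    refine derivation_eq_zero S fun i => ?_
    rw [Derivation.commutator_apply, constField_X, constField_X, Derivation.map_algebraMap,
      Derivation.map_algebraMap, sub_zero]
  refine toEnd_injective (LinearMap.ext fun x => ?_)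
  have h1 := congrArg (fun δ : Derivation ℂ R R => δ x) h
  simp only [Derivation.commutator_apply, Derivation.zero_apply] at h1
  exact sub_eq_zero.1 h1

theorem funOp_comm (f g : AffFun N) : funOp R f * funOp R g = funOp R g * funOp R f := by
  rw [funOp_eq, funOp_eq, ← map_mul, mul_comm, map_mul]

theorem ad_funOp_fieldOp (ξ : Aff N) (f : AffFun N) :
    ad (funOp R f) (fieldOp S R ξ) = algebraMap ℂ (DiffOp R) (f.linear ξ) := by
  rw [ad_apply, fieldOp_eq, funOp_eq, derOp_mul_mulOp, add_sub_cancel_left, constField_affPoly,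
    AlgHom.commutes]

theorem ad_funOp_funOp (f g : AffFun N) : ad (funOp R f) (funOp R g) = 0 := by
  rw [ad_apply, funOp_comm, sub_self]

theorem affPoly_const (c : ℂ) : affPoly (AffineMap.const ℂ (Aff N) c) = MvPolynomial.C c := by
  simp [affPoly]

theorem funOp_const (c : ℂ) :
    funOp R (AffineMap.const ℂ (Aff N) c) = algebraMap ℂ (DiffOp R) c := by
  rw [funOp_eq, affPoly_const, ← MvPolynomial.algebraMap_eq,
    ← IsScalarTower.algebraMap_apply ℂ (PolyRing N) R, AlgHom.commutes]

/-! ### Operators with polynomial coefficients -/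

/-- The operators with polynomial coefficients: the subalgebra generated by the affine functions
and the constant vector fields. -/
def polyOp : Subalgebra ℂ (DiffOp R) :=
  Algebra.adjoin ℂ (Set.range (fieldOp S R) ∪ Set.range (funOp (N := N) R))

theorem fieldOp_mem (ξ : Aff N) : fieldOp S R ξ ∈ polyOp S R :=
  Algebra.subset_adjoin (Or.inl ⟨ξ, rfl⟩)

theorem funOp_mem (f : AffFun N) : funOp R f ∈ polyOp S R :=
  Algebra.subset_adjoin (Or.inr ⟨f, rfl⟩)

theorem mulOp_mem (p : PolyRing N) : mulOp R (algebraMap (PolyRing N) R p) ∈ polyOp S R := by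
  induction p using MvPolynomial.induction_on with
  | C a =>
    rw [← affPoly_const, ← funOp_eq]
    exact funOp_mem S R _
  | add p q hp hq =>
    rw [map_add, map_add]
    exact add_mem hp hq
  | mul_X p i hp =>
    have h : affPoly (LinearMap.proj i : Aff N →ₗ[ℂ] ℂ).toAffineMap = MvPolynomial.X i := by
      simp [affPoly, Pi.single_apply, ite_mul, apply_ite MvPolynomial.C]
    rw [map_mul, map_mul, ← h, ← funOp_eq]
    exact mul_mem hp (funOp_mem S R _)

variable {R} in
theorem derOp_eq (δ : Derivation ℂ R R) : derOp R δ =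
    ∑ i, mulOp R (δ (algebraMap (PolyRing N) R (MvPolynomial.X i))) *
      fieldOp S R (Pi.single i 1) := by
  have h : δ = ∑ i, δ (algebraMap (PolyRing N) R (MvPolynomial.X i)) •
      constField S R (Pi.single i 1) := by
    rw [← sub_eq_zero]
    refine derivation_eq_zero S fun j => ?_
    rw [Derivation.sub_apply, sum_derivation_apply, Finset.sum_eq_single j]
    · rw [Derivation.smul_apply, constField_X]
      simp
    · intro i _ hij
      rw [Derivation.smul_apply, constField_X, Pi.single_eq_of_ne hij.symm]
      simp
    · simp
  refine toEnd_injective (LinearMap.ext fun x => ?_)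
  rw [toEnd_derOp, map_sum, LinearMap.sum_apply]
  conv_lhs => rw [h]
  rw [sum_derivation_apply]
  rfl

/-- The operators which acquire polynomial coefficients after left multiplication by some s in S
form a subspace containing 1. It is stable under left multiplication by R and by constant fields,
and these generate all differential operators because a derivation is a combination of the ∂/∂z_i.
-/
theorem exists_smul_mem_polyOp (Q : DiffOp R) :
    ∃ s ∈ S, mulOp R (algebraMap (PolyRing N) R s) * Q ∈ polyOp S R := by
  let 𝓛 : Submodule ℂ (DiffOp R) :=
    { carrier := {Q | ∃ s ∈ S, mulOp R (algebraMap (PolyRing N) R s) * Q ∈ polyOp S R}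
      zero_mem' := ⟨1, S.one_mem, by simp⟩
      add_mem' := by
        rintro P Q ⟨s, hs, hP⟩ ⟨t, ht, hQ⟩
        refine ⟨s * t, S.mul_mem hs ht, ?_⟩
        rw [mul_add]
        refine add_mem ?_ ?_
        · rw [mul_comm s t, map_mul, map_mul, mul_assoc]
          exact mul_mem (mulOp_mem S R t) hP
        · rw [map_mul, map_mul, mul_assoc]
          exact mul_mem (mulOp_mem S R s) hQ
      smul_mem' := by
        rintro c Q ⟨s, hs, hQ⟩
        refine ⟨s, hs, ?_⟩
        rw [mul_smul_comm]
        exact Subalgebra.smul_mem _ hQ c }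
  have hmul : ∀ (r : R), ∀ Q ∈ 𝓛, mulOp R r * Q ∈ 𝓛 := by
    rintro r Q ⟨s, hs, hQ⟩
    obtain ⟨⟨p, t⟩, hr⟩ := IsLocalization.surj S r
    refine ⟨t * s, S.mul_mem t.2 hs, ?_⟩
    have h : mulOp R (algebraMap (PolyRing N) R (t * s)) * (mulOp R r * Q) =
        mulOp R (algebraMap (PolyRing N) R p) * (mulOp R (algebraMap (PolyRing N) R s) * Q) := by
      rw [← hr, ← mul_assoc, ← mul_assoc, ← map_mul, ← map_mul]
      congr 2
      rw [map_mul]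
      ring
    rw [h]
    exact mul_mem (mulOp_mem S R p) hQ
  have hfield : ∀ (ξ : Aff N), ∀ Q ∈ 𝓛, fieldOp S R ξ * Q ∈ 𝓛 := by
    rintro ξ Q ⟨s, hs, hQ⟩
    -- The second factor s is spent on moving s past the field: s² ξ Q = s ξ (s Q) - ξ(s) (s Q).
    refine ⟨s * s, S.mul_mem hs hs, ?_⟩
    have hd : ∃ q, constField S R ξ (algebraMap (PolyRing N) R s) =
        algebraMap (PolyRing N) R q := by
      refine ⟨∑ i, ξ i • MvPolynomial.pderiv i s, ?_⟩
      have h : constField S R ξ = ∑ i, ξ i • locDerivation S R (MvPolynomial.pderiv i) := rfl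
      rw [h, sum_derivation_apply, map_sum]
      refine Finset.sum_congr rfl fun i _ => ?_
      rw [Derivation.smul_apply, locDerivation_algebraMap]
      exact (map_smul (IsScalarTower.toAlgHom ℂ (PolyRing N) R) _ _).symm
    obtain ⟨q, hq⟩ := hd
    have h1 := derOp_mul_mulOp (constField S R ξ) (algebraMap (PolyRing N) R s)
    rw [hq, ← fieldOp_eq] at h1
    have h : mulOp R (algebraMap (PolyRing N) R (s * s)) * (fieldOp S R ξ * Q) =
        mulOp R (algebraMap (PolyRing N) R s) * (fieldOp S R ξ *
          (mulOp R (algebraMap (PolyRing N) R s) * Q)) -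
        mulOp R (algebraMap (PolyRing N) R q) * (mulOp R (algebraMap (PolyRing N) R s) * Q) := by
      have h2 : mulOp R (algebraMap (PolyRing N) R q) * mulOp R (algebraMap (PolyRing N) R s) =
          mulOp R (algebraMap (PolyRing N) R s) * mulOp R (algebraMap (PolyRing N) R q) := by
        rw [← map_mul, mul_comm, map_mul]
      rw [← mul_assoc (fieldOp S R ξ), h1, ← mul_assoc (mulOp R _) (mulOp R _) Q, h2, map_mul,
        map_mul]
      noncomm_ring
    rw [h]
    exact sub_mem (mul_mem (mulOp_mem S R s) (mul_mem (fieldOp_mem S R ξ) hQ))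
      (mul_mem (mulOp_mem S R q) hQ)
  have hone : (1 : DiffOp R) ∈ 𝓛 := ⟨1, S.one_mem, by simp⟩
  suffices h : ∀ (Q : Module.End ℂ R) (hQ : Q ∈ diffOp R), (⟨Q, hQ⟩ : diffOp R) ∈ 𝓛 from h Q.1 Q.2
  intro Q hQ
  have hQ' := hQ
  rw [diffOp, ← Subalgebra.mem_toSubmodule, Algebra.adjoin_eq_span] at hQ'
  -- The generation by multiplications and derivations is known in `Module.End ℂ R`, so the
  -- induction runs on the image of 𝓛 there.
  suffices h : ∃ P ∈ 𝓛, toEnd R P = Q by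
    obtain ⟨P, hP, rfl⟩ := h
    exact hP
  suffices h : Submodule.span ℂ _ ≤ 𝓛.map (toEnd R).toLinearMap from h hQ'
  refine Submodule.span_le.2 ?_
  intro a ha
  induction ha using Submonoid.closure_induction_left with
  | one => exact ⟨1, hone, map_one (toEnd R)⟩
  | mul_left a ha Q _ hQ =>
    obtain ⟨P, hP, rfl⟩ := hQ
    obtain ⟨r, rfl⟩ | ⟨δ, rfl⟩ := ha
    · exact ⟨mulOp R r * P, hmul r P hP, map_mul (toEnd R) _ _⟩
    · refine ⟨derOp R δ * P, ?_, map_mul (toEnd R) _ _⟩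
      rw [derOp_eq S, Finset.sum_mul]
      refine Submodule.sum_mem _ fun i _ => ?_
      rw [mul_assoc]
      exact hmul _ _ (hfield _ _ hP)

/-! ### The filtration by the order -/

/-- The filtration of the operators with polynomial coefficients by the order, shifted by one. -/
def ordFil : ℕ → Submodule ℂ (DiffOp R)
  | 0 => ⊥
  | k + 1 => Subalgebra.toSubmodule (polyOp S R) ⊓
      ⨅ f : AffFun N, (ordFil k).comap (ad (funOp R f))

theorem ordFil_zero : ordFil S R 0 = ⊥ := rfl

variable {R}

theorem mem_ordFil_succ {k : ℕ} {P : DiffOp R} : P ∈ ordFil S R (k + 1) ↔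
    P ∈ polyOp S R ∧ ∀ f : AffFun N, ad (funOp R f) P ∈ ordFil S R k := by
  simp [ordFil]

theorem mem_polyOp_of_mem_ordFil {k : ℕ} {P : DiffOp R} (hP : P ∈ ordFil S R k) :
    P ∈ polyOp S R := by
  obtain _ | k := k
  · rw [ordFil_zero, Submodule.mem_bot] at hP
    rw [hP]
    exact zero_mem _
  · exact ((mem_ordFil_succ S).1 hP).1

theorem ordFil_le_succ (k : ℕ) : ordFil S R k ≤ ordFil S R (k + 1) := by
  induction k with
  | zero => exact bot_le
  | succ k ih =>
    intro P hP
    rw [mem_ordFil_succ] at hP ⊢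
    exact ⟨hP.1, fun f => ih (hP.2 f)⟩

theorem mul_funOp_mem_ordFil {k : ℕ} {P : DiffOp R} (hP : P ∈ ordFil S R k) (g : AffFun N) :
    P * funOp R g ∈ ordFil S R k := by
  induction k generalizing P with
  | zero =>
    rw [ordFil_zero, Submodule.mem_bot] at hP
    rw [hP, zero_mul]
    exact zero_mem _
  | succ k ih =>
    rw [mem_ordFil_succ] at hP ⊢
    refine ⟨mul_mem hP.1 (funOp_mem S R g), fun f => ?_⟩
    rw [ad_mul, ad_funOp_funOp, mul_zero, zero_add]
    exact ih (hP.2 f)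

theorem mul_fieldOp_mem_ordFil {k : ℕ} {P : DiffOp R} (hP : P ∈ ordFil S R k) (ξ : Aff N) :
    P * fieldOp S R ξ ∈ ordFil S R (k + 1) := by
  induction k generalizing P with
  | zero =>
    rw [ordFil_zero, Submodule.mem_bot] at hP
    rw [hP, zero_mul]
    exact zero_mem _
  | succ k ih =>
    have hP' := (mem_ordFil_succ S).1 hP
    rw [mem_ordFil_succ]
    refine ⟨mul_mem hP'.1 (fieldOp_mem S R ξ), fun f => ?_⟩
    rw [ad_mul, ad_funOp_fieldOp, ← Algebra.commutes, ← Algebra.smul_def]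
    exact add_mem (Submodule.smul_mem _ _ hP) (ih (hP'.2 f))

/-- Commutators with a field and with an affine function commute, because the commutator of the
field and the function is a constant; induction on the order then applies. -/
theorem ad_fieldOp_mem_ordFil {k : ℕ} {P : DiffOp R} (hP : P ∈ ordFil S R k) (ξ : Aff N) :
    ad (fieldOp S R ξ) P ∈ ordFil S R k := by
  induction k generalizing P with
  | zero =>
    rw [ordFil_zero, Submodule.mem_bot] at hP
    rw [hP, map_zero]
    exact zero_mem _
  | succ k ih =>
    rw [mem_ordFil_succ] at hP ⊢
    refine ⟨sub_mem (mul_mem hP.1 (fieldOp_mem S R ξ)) (mul_mem (fieldOp_mem S R ξ) hP.1),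
      fun f => ?_⟩
    have h1 : fieldOp S R ξ * funOp R f = funOp R f * fieldOp S R ξ +
        algebraMap ℂ (DiffOp R) (f.linear ξ) := by
      rw [← ad_funOp_fieldOp S, ad_apply]
      abel
    have h2 := Algebra.commutes (f.linear ξ) P
    have h : ad (funOp R f) (ad (fieldOp S R ξ) P) = ad (fieldOp S R ξ) (ad (funOp R f) P) := by
      have h3 : P * (fieldOp S R ξ * funOp R f) - P * (funOp R f * fieldOp S R ξ) =
          fieldOp S R ξ * funOp R f * P - funOp R f * fieldOp S R ξ * P := by
        rw [h1, mul_add, add_mul, h2]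
        abel
      rw [← sub_eq_zero] at h3 ⊢
      rw [← h3]
      simp only [ad_apply]
      noncomm_ring
    rw [h]
    exact ih (hP.2 f)

/-- In a word in the generators, each field multiplied on the right raises the order by at most one
and each function does not raise it. -/
theorem exists_mem_ordFil {P : DiffOp R} (hP : P ∈ polyOp S R) : ∃ k, P ∈ ordFil S R k := by
  have hmono : Monotone (ordFil S R) := monotone_nat_of_le_succ (ordFil_le_succ S)
  rw [← Subalgebra.mem_toSubmodule, polyOp, Algebra.adjoin_eq_span] at hP
  induction hP using Submodule.span_induction with
  | zero => exact ⟨0, zero_mem _⟩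
  | add P Q _ _ hP hQ =>
    obtain ⟨k, hk⟩ := hP
    obtain ⟨l, hl⟩ := hQ
    exact ⟨max k l, add_mem (hmono (le_max_left k l) hk) (hmono (le_max_right k l) hl)⟩
  | smul c P _ hP =>
    obtain ⟨k, hk⟩ := hP
    exact ⟨k, Submodule.smul_mem _ c hk⟩
  | mem P hP =>
    induction hP using Submonoid.closure_induction_right with
    | one =>
      refine ⟨1, (mem_ordFil_succ S).2 ⟨one_mem _, fun f => ?_⟩⟩
      rw [ad_apply, one_mul, mul_one, sub_self]
      exact zero_mem _
    | mul_right Q _ a ha hQ =>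
      obtain ⟨k, hk⟩ := hQ
      obtain ⟨ξ, rfl⟩ | ⟨f, rfl⟩ := ha
      · exact ⟨k + 1, mul_fieldOp_mem_ordFil S hk ξ⟩
      · exact ⟨k, mul_funOp_mem_ordFil S hk f⟩

end Relations

end QuiverD

/-! ### Coordinates adapted to a stratum and the resulting Koszul frame. -/

namespace QuiverD

open Arrangement

/-! ### Coordinates adapted to a stratum -/

namespace Arrangement.Vertex

variable {N : ℕ} {𝒜 : Arrangement N} (α : 𝒜.Vertex)

/-- A complement of `T_α`. -/
def cT : Submodule ℂ (Aff N) := (Submodule.exists_isCompl α.T).choose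

theorem isCompl_cT : IsCompl α.T α.cT := (Submodule.exists_isCompl α.T).choose_spec

/-- A point of the stratum. -/
def pt : Aff N := α.2.1.choose

theorem pt_mem : α.pt ∈ α.closure := α.2.1.choose_spec

/-- A basis of `T_α`. -/
def bT : Module.Basis (Fin α.dim) ℂ α.T := Module.finBasis ℂ α.T

/-- A basis of the complement of `T_α`. -/
def bC : Module.Basis (Fin (Module.finrank ℂ α.cT)) ℂ α.cT := Module.finBasis ℂ α.cT

theorem vsub_pt_mem {x : Aff N} (hx : x ∈ α.closure) : x - α.pt ∈ α.T :=
  AffineSubspace.vsub_mem_direction hx α.pt_mem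

/-- The affine function with the given linear part which vanishes at the point of the stratum. -/
def affOfLinear (φ : Aff N →ₗ[ℂ] ℂ) : AffFun N :=
  φ.toAffineMap - AffineMap.const ℂ (Aff N) (φ α.pt)

theorem affOfLinear_apply (φ : Aff N →ₗ[ℂ] ℂ) (x : Aff N) :
    α.affOfLinear φ x = φ (x - α.pt) := by
  simp [affOfLinear]

theorem affOfLinear_linear (φ : Aff N →ₗ[ℂ] ℂ) : (α.affOfLinear φ).linear = φ := by
  ext
  simp [affOfLinear]

theorem aff_apply (f : AffFun N) (x : Aff N) : f x = f.linear (x - α.pt) + f α.pt := by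
  have h := f.map_vadd α.pt (x - α.pt)
  simpa using h

/-- The linear forms dual to the basis of `T_α`. -/
def formT (i : Fin α.dim) : Aff N →ₗ[ℂ] ℂ :=
  α.bT.coord i ∘ₗ α.T.projectionOnto α.cT α.isCompl_cT

/-- The linear forms dual to the basis of the complement of `T_α`. -/
def formC (i : Fin (Module.finrank ℂ α.cT)) : Aff N →ₗ[ℂ] ℂ :=
  α.bC.coord i ∘ₗ α.cT.projectionOnto α.T α.isCompl_cT.symm

theorem formT_of_mem (i : Fin α.dim) (ξ : α.T) : α.formT i ξ = α.bT.coord i ξ := by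
  rw [formT, LinearMap.comp_apply, Submodule.projectionOnto_apply_left]

theorem formT_bC (i : Fin α.dim) (j : Fin (Module.finrank ℂ α.cT)) :
    α.formT i (α.bC j) = 0 := by
  rw [formT, LinearMap.comp_apply, Submodule.projectionOnto_apply_right, map_zero]

theorem formC_of_mem (i : Fin (Module.finrank ℂ α.cT)) {ξ : Aff N} (hξ : ξ ∈ α.T) :
    α.formC i ξ = 0 := by
  rw [formC, LinearMap.comp_apply, Submodule.projectionOnto_apply_of_mem_right _ hξ, map_zero]

theorem formC_bC (i j : Fin (Module.finrank ℂ α.cT)) :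
    α.formC i (α.bC j) = α.bC.coord i (α.bC j) := by
  rw [formC, LinearMap.comp_apply, Submodule.projectionOnto_apply_left]

theorem sum_forms (ξ : Aff N) :
    ∑ i, α.formT i ξ • (α.bT i : Aff N) + ∑ i, α.formC i ξ • (α.bC i : Aff N) = ξ := by
  have h1 := congrArg α.T.subtype (α.bT.sum_repr (α.T.projectionOnto α.cT α.isCompl_cT ξ))
  have h2 := congrArg α.cT.subtype (α.bC.sum_repr (α.cT.projectionOnto α.T α.isCompl_cT.symm ξ))
  rw [map_sum] at h1 h2
  simp only [map_smul] at h1 h2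
  have h3 := Submodule.projection_add_projection_eq_self α.isCompl_cT ξ
  rw [Submodule.projection_apply, Submodule.projection_apply] at h3
  exact (congrArg₂ (· + ·) h1 h2).trans h3

/-- The functions of `F_α` dual to the basis of the complement of `T_α`. -/
def funF (j : Fin (Module.finrank ℂ α.cT)) : α.F :=
  ⟨α.affOfLinear (α.formC j), fun x hx => by
    rw [affOfLinear_apply, α.formC_of_mem j (α.vsub_pt_mem hx)]⟩

/-- A function of F_α vanishes at the base point and its linear part kills T_α, so it is determined
by its linear part on the complement. -/
theorem sum_funF (f : α.F) : ∑ j, (f : AffFun N).linear (α.bC j) • α.funF j = f := by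
  apply Subtype.ext
  ext x
  have h : ((∑ j, (f : AffFun N).linear (α.bC j) • α.funF j : α.F) : AffFun N) x =
      ∑ j, (f : AffFun N).linear (α.bC j) * α.formC j (x - α.pt) := by
    rw [Submodule.coe_sum]
    have h := map_sum (⟨⟨fun g : AffFun N => g x, rfl⟩, fun _ _ => rfl⟩ : AffFun N →+ ℂ)
      (fun j => ((((f : AffFun N).linear (α.bC j) • α.funF j : α.F)) : AffFun N)) Finset.univ
    refine h.trans (Finset.sum_congr rfl fun j _ => ?_)
    change (f : AffFun N).linear (α.bC j) * α.affOfLinear (α.formC j) x = _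
    rw [affOfLinear_apply]
  rw [h, α.aff_apply f x, f.2 _ α.pt_mem, add_zero]
  conv_rhs => rw [← α.sum_forms (x - α.pt)]
  simp only [map_add, map_sum, map_smul, smul_eq_mul]
  have h0 : ∀ i, (f : AffFun N).linear (α.bT i) = 0 := fun i => linear_eq_zero f.2 (α.bT i).2
  simp only [h0, mul_zero, Finset.sum_const_zero, zero_add]
  exact Finset.sum_congr rfl fun j _ => mul_comm _ _

/-- A basis of `F_α`. -/
def bF : Module.Basis (Fin (Module.finrank ℂ α.cT)) ℂ α.F :=
  Module.Basis.ofEquivFun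
    { toFun := fun f j => (f : AffFun N).linear (α.bC j)
      invFun := fun c => ∑ j, c j • α.funF j
      map_add' := fun f g => by
        ext
        simp
      map_smul' := fun c f => by
        ext
        simp
      left_inv := fun f => α.sum_funF f
      right_inv := fun c => by
        classical
        funext j
        have h := map_sum (pairField (α.bC j : Aff N) ∘ₗ α.F.subtype) (fun i => c i • α.funF i)
          Finset.univ
        refine h.trans ?_
        rw [Finset.sum_eq_single j]
        · rw [map_smul]
          change c j * (α.affOfLinear (α.formC j)).linear (α.bC j) = _
          simp [affOfLinear_linear, formC_bC]
        · intro i _ hij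
          rw [map_smul]
          change c i * (α.affOfLinear (α.formC i)).linear (α.bC j) = _
          simp [affOfLinear_linear, formC_bC, Finsupp.single_eq_of_ne hij]
        · simp }

theorem bF_coord (j : Fin (Module.finrank ℂ α.cT)) (f : α.F) :
    α.bF.coord j f = (f : AffFun N).linear (α.bC j) := by
  simp [bF]

theorem bF_apply (j : Fin (Module.finrank ℂ α.cT)) : α.bF j = α.funF j := by
  classical
  simp [bF, Pi.single_apply]

/-- F_α is dual to a complement of T_α, so the two dimensions add up to N. -/
theorem finrank_TF : Module.finrank ℂ α.TF = N := by
  rw [Module.finrank_prod, Module.finrank_eq_card_basis α.bF, Fintype.card_fin,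
    Submodule.finrank_add_eq_of_isCompl α.isCompl_cT]
  simp

theorem dim_le : α.dim ≤ N := by
  exact (Submodule.finrank_le α.T).trans_eq (by simp)

end Arrangement.Vertex

/-! ### The dual frame of a stratum -/

section Frame

variable {N : ℕ} {𝒜 : Arrangement N} (S : Submonoid (PolyRing N)) (R : Type) [CommRing R]
  [Algebra ℂ R] [Algebra (PolyRing N) R] [IsScalarTower ℂ (PolyRing N) R] [IsLocalization S R]
  (α : 𝒜.Vertex)

theorem symbolOp_apply (t : α.TF) :
    ArrQuiver.symbolOp S R α t = fieldOp S R (t.1 : Aff N) + funOp R (t.2 : AffFun N) := rfl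

theorem ad_neg_fieldOp_funOp (ξ : Aff N) (f : AffFun N) :
    ad (-fieldOp S R ξ) (funOp R f) = algebraMap ℂ (DiffOp R) (f.linear ξ) := by
  rw [← ad_funOp_fieldOp S, ad_apply, ad_apply]
  noncomm_ring

theorem ad_neg_fieldOp_fieldOp (ξ η : Aff N) : ad (-fieldOp S R ξ) (fieldOp S R η) = 0 := by
  rw [ad_apply, mul_neg, neg_mul, fieldOp_comm, sub_self]

/-- The only commutators in question are those of a field along the stratum with a function
vanishing on it, and these are zero. -/
theorem symbolOp_comm (s t : α.TF) :
    ArrQuiver.symbolOp S R α s * ArrQuiver.symbolOp S R α t =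
      ArrQuiver.symbolOp S R α t * ArrQuiver.symbolOp S R α s := by
  have h : ∀ (ξ : α.T) (f : α.F), fieldOp S R (ξ : Aff N) * funOp R (f : AffFun N) =
      funOp R (f : AffFun N) * fieldOp S R (ξ : Aff N) := by
    intro ξ f
    have h := ad_funOp_fieldOp S R (ξ : Aff N) (f : AffFun N)
    rw [Vertex.linear_eq_zero f.2 ξ.2, map_zero, ad_apply] at h
    exact sub_eq_zero.1 h
  simp only [symbolOp_apply, mul_add, add_mul, h, fieldOp_comm S R (s.1 : Aff N),
    funOp_comm R (s.2 : AffFun N)]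
  abel

/-- The differential operators dual to the basis of `T_α ⊕ F_α`. -/
def dualOp : Fin α.dim ⊕ Fin (Module.finrank ℂ α.cT) → DiffOp R :=
  Sum.elim (fun i => funOp R (α.affOfLinear (α.formT i))) (fun j => -fieldOp S R (α.bC j : Aff N))

/-- The basis of `T_α ⊕ F_α`. -/
def bTF : Module.Basis (Fin α.dim ⊕ Fin (Module.finrank ℂ α.cT)) ℂ α.TF := α.bT.prod α.bF

theorem symbolOp_bTF_inl (i : Fin α.dim) :
    ArrQuiver.symbolOp S R α (bTF α (Sum.inl i)) = fieldOp S R (α.bT i : Aff N) := by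
  rw [symbolOp_apply, bTF, Module.Basis.prod_apply_inl_fst, Module.Basis.prod_apply_inl_snd]
  simp

theorem symbolOp_bTF_inr (j : Fin (Module.finrank ℂ α.cT)) :
    ArrQuiver.symbolOp S R α (bTF α (Sum.inr j)) = funOp R (α.affOfLinear (α.formC j)) := by
  rw [symbolOp_apply, bTF, Module.Basis.prod_apply_inr_fst, Module.Basis.prod_apply_inr_snd,
    Vertex.bF_apply]
  simp [Vertex.funF]

/-- The generators give the derivatives and the coordinates both along the stratum and across it, up
to sign: a full set of generators of the Weyl algebra in adapted coordinates. -/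
theorem polyOp_le_adjoin : polyOp S R ≤
    Algebra.adjoin ℂ (Set.range (ArrQuiver.symbolOp S R α ∘ bTF α) ∪
      Set.range (dualOp S R α)) := by
  set 𝓑 := Algebra.adjoin ℂ (Set.range (ArrQuiver.symbolOp S R α ∘ bTF α) ∪
    Set.range (dualOp S R α)) with h𝓑
  have h1 : ∀ i, fieldOp S R (α.bT i : Aff N) ∈ 𝓑 := fun i =>
    Algebra.subset_adjoin (Or.inl ⟨Sum.inl i, symbolOp_bTF_inl S R α i⟩)
  have h2 : ∀ j, funOp R (α.affOfLinear (α.formC j)) ∈ 𝓑 := fun j =>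
    Algebra.subset_adjoin (Or.inl ⟨Sum.inr j, symbolOp_bTF_inr S R α j⟩)
  have h3 : ∀ i, funOp R (α.affOfLinear (α.formT i)) ∈ 𝓑 := fun i =>
    Algebra.subset_adjoin (Or.inr ⟨Sum.inl i, rfl⟩)
  have h4 : ∀ j, fieldOp S R (α.bC j : Aff N) ∈ 𝓑 := fun j => by
    have h : dualOp S R α (Sum.inr j) ∈ 𝓑 := Algebra.subset_adjoin (Or.inr ⟨Sum.inr j, rfl⟩)
    simpa [dualOp] using neg_mem h
  rw [polyOp, Algebra.adjoin_le_iff]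
  rintro _ (⟨ξ, rfl⟩ | ⟨f, rfl⟩)
  · rw [← α.sum_forms ξ, map_add, map_sum, map_sum]
    refine add_mem (sum_mem fun i _ => ?_) (sum_mem fun i _ => ?_)
    · rw [map_smul]
      exact Subalgebra.smul_mem _ (h1 i) _
    · rw [map_smul]
      exact Subalgebra.smul_mem _ (h4 i) _
  · have hf : f = ∑ i, f.linear (α.bT i) • α.affOfLinear (α.formT i) +
        ∑ j, f.linear (α.bC j) • α.affOfLinear (α.formC j) +
        AffineMap.const ℂ (Aff N) (f α.pt) := by
      ext x
      have hev := fun (ι : Type) (s : Finset ι) (g : ι → AffFun N) =>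
        map_sum (⟨⟨fun g : AffFun N => g x, rfl⟩, fun _ _ => rfl⟩ : AffFun N →+ ℂ) g s
      have hT := hev _ Finset.univ (fun i => f.linear (α.bT i) • α.affOfLinear (α.formT i))
      have hC := hev _ Finset.univ (fun j => f.linear (α.bC j) • α.affOfLinear (α.formC j))
      rw [α.aff_apply f x]
      refine congrArg₂ (· + ·) ?_ rfl
      refine Eq.trans ?_ (congrArg₂ (· + ·) hT hC).symm
      conv_lhs => rw [← α.sum_forms (x - α.pt)]
      simp only [map_add, map_sum, map_smul, smul_eq_mul]
      refine congrArg₂ (· + ·) (Finset.sum_congr rfl fun i _ => ?_)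
        (Finset.sum_congr rfl fun i _ => ?_)
      · refine (mul_comm _ _).trans ?_
        rw [← Vertex.affOfLinear_apply]
        rfl
      · refine (mul_comm _ _).trans ?_
        rw [← Vertex.affOfLinear_apply]
        rfl
    rw [hf, map_add, map_add, map_sum, map_sum, funOp_const]
    refine add_mem (add_mem (sum_mem fun i _ => ?_) (sum_mem fun i _ => ?_))
      (Subalgebra.algebraMap_mem _ _)
    · rw [map_smul]
      exact Subalgebra.smul_mem _ (h3 i) _
    · rw [map_smul]
      exact Subalgebra.smul_mem _ (h2 i) _

/-- The frame attached to a stratum. -/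
def frame : KoszulFrame (DiffOp R) α.TF (Fin α.dim ⊕ Fin (Module.finrank ℂ α.cT)) where
  τ := ArrQuiver.symbolOp S R α
  b := bTF α
  y := dualOp S R α
  comm := symbolOp_comm S R α
  y_comm := by
    have h : ∀ i j, funOp R (α.affOfLinear (α.formT i)) * -fieldOp S R (α.bC j : Aff N) =
        -fieldOp S R (α.bC j : Aff N) * funOp R (α.affOfLinear (α.formT i)) := by
      intro i j
      have h := ad_neg_fieldOp_funOp S R (α.bC j : Aff N) (α.affOfLinear (α.formT i))
      rw [Vertex.affOfLinear_linear, Vertex.formT_bC, map_zero, ad_apply] at h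
      exact sub_eq_zero.1 h
    rintro (i | i) (j | j)
    · exact funOp_comm R _ _
    · exact h i j
    · exact (h j i).symm
    · change -fieldOp S R _ * -fieldOp S R _ = -fieldOp S R _ * -fieldOp S R _
      rw [neg_mul_neg, neg_mul_neg, fieldOp_comm]
  ad_y := by
    rintro t (i | j)
    · change ad (funOp R (α.affOfLinear (α.formT i))) _ = algebraMap ℂ _ (α.bT.coord i t.1)
      rw [symbolOp_apply, map_add, ad_funOp_funOp, add_zero, ad_funOp_fieldOp,
        Vertex.affOfLinear_linear, Vertex.formT_of_mem]
    · change ad (-fieldOp S R (α.bC j : Aff N)) _ = algebraMap ℂ _ (α.bF.coord j t.2)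
      rw [symbolOp_apply, map_add, ad_neg_fieldOp_funOp, ad_neg_fieldOp_fieldOp, zero_add,
        Vertex.bF_coord]
  Fil := ordFil S R
  -- The vectors of degree zero are the functions; vector fields count one, as they raise the order.
  M₀ := LinearMap.ker (LinearMap.fst ℂ α.T α.F)
  Fil_zero := rfl
  mem_adjoin hP := polyOp_le_adjoin S R α (mem_polyOp_of_mem_ordFil S hP)
  mul_mem t hP := by
    rw [symbolOp_apply, mul_add]
    exact add_mem (mul_fieldOp_mem_ordFil S hP _)
      (ordFil_le_succ S _ (mul_funOp_mem_ordFil S hP _))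
  mul_mem₀ {k P t} ht hP := by
    have h : t.1 = 0 := ht
    rw [symbolOp_apply, h, Submodule.coe_zero, map_zero, zero_add]
    exact mul_funOp_mem_ordFil S hP _
  -- The dual of a field is a coordinate, and bracketing with it lowers the order; the dual of a
  -- function is minus a field, and bracketing with it keeps the order.
  ad_mem := by
    rintro (i | j)
    · exact Or.inr fun hP => ((mem_ordFil_succ S).1 hP).2 _
    · refine Or.inl ⟨Module.Basis.prod_apply_inr_fst α.bT α.bF j, fun {k P} hP => ?_⟩
      have h : ad (dualOp S R α (Sum.inr j)) P = -ad (fieldOp S R (α.bC j : Aff N)) P := by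
        simp only [dualOp, Sum.elim_inr, ad_apply]
        noncomm_ring
      rw [h]
      exact neg_mem (ad_fieldOp_mem_ordFil S hP _)

end Frame

end QuiverD

/-! ### The edge contractions compared inside the exterior algebra of T ⊕ F. -/

namespace QuiverD

open Arrangement

/-! ### Contractions in the exterior algebra -/

section Contraction

variable {M M' V : Type} [AddCommGroup M] [Module ℂ M] [AddCommGroup M'] [Module ℂ M']
  [AddCommGroup V] [Module ℂ V]

/-- The contraction of the exterior algebra with a linear form. -/
def extContract (φ : M →ₗ[ℂ] ℂ) : ExteriorAlgebra ℂ M →ₗ[ℂ] ExteriorAlgebra ℂ M :=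
  CliffordAlgebra.contractLeft (Q := (0 : QuadraticForm ℂ M)) φ

theorem extContract_ι_mul (φ : M →ₗ[ℂ] ℂ) (m : M) (x : ExteriorAlgebra ℂ M) :
    extContract φ (ExteriorAlgebra.ι ℂ m * x) =
      φ m • x - ExteriorAlgebra.ι ℂ m * extContract φ x :=
  CliffordAlgebra.contractLeft_ι_mul (Q := (0 : QuadraticForm ℂ M)) φ m x

theorem extContract_algebraMap (φ : M →ₗ[ℂ] ℂ) (c : ℂ) :
    extContract φ (algebraMap ℂ (ExteriorAlgebra ℂ M) c) = 0 :=
  CliffordAlgebra.contractLeft_algebraMap (Q := (0 : QuadraticForm ℂ M)) φ c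

theorem extContract_self (φ : M →ₗ[ℂ] ℂ) (x : ExteriorAlgebra ℂ M) :
    extContract φ (extContract φ x) = 0 :=
  CliffordAlgebra.contractLeft_contractLeft (Q := (0 : QuadraticForm ℂ M)) φ x

theorem extContract_comm (φ ψ : M →ₗ[ℂ] ℂ) (x : ExteriorAlgebra ℂ M) :
    extContract φ (extContract ψ x) = -extContract ψ (extContract φ x) :=
  CliffordAlgebra.contractLeft_comm (Q := (0 : QuadraticForm ℂ M)) φ ψ x

theorem extContract_comb (φ ψ : M →ₗ[ℂ] ℂ) (a b : ℂ) (x : ExteriorAlgebra ℂ M) :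
    extContract (a • φ + b • ψ) x = a • extContract φ x + b • extContract ψ x := by
  simp [extContract]

theorem extContract_zero (x : ExteriorAlgebra ℂ M) : extContract 0 x = 0 := by
  simp [extContract]

/-- Contractions anticommute and square to zero, so a change of two forms acts on their double
contraction through its determinant. -/
theorem extContract_comb_comb (φ ψ : M →ₗ[ℂ] ℂ) (a b a' b' : ℂ) (x : ExteriorAlgebra ℂ M) :
    extContract (a' • φ + b' • ψ) (extContract (a • φ + b • ψ) x) =
      (a * b' - a' * b) • extContract ψ (extContract φ x) := by
  rw [extContract_comb, extContract_comb, map_add, map_add, map_smul, map_smul, map_smul, map_smul,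
    extContract_self, extContract_self, extContract_comm φ ψ]
  module

theorem exteriorAlgebra_induction {p : ExteriorAlgebra ℂ M → Prop}
    (h0 : ∀ c, p (algebraMap ℂ _ c)) (hadd : ∀ x y, p x → p y → p (x + y))
    (hmul : ∀ m x, p x → p (ExteriorAlgebra.ι ℂ m * x)) (x : ExteriorAlgebra ℂ M) : p x :=
  CliffordAlgebra.left_induction (0 : QuadraticForm ℂ M) (P := p) h0 hadd
    (fun x m hx => hmul m x hx) x

theorem extContract_map (φ : V →ₗ[ℂ] ℂ) (j : M →ₗ[ℂ] V) (x : ExteriorAlgebra ℂ M) :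
    extContract φ (ExteriorAlgebra.map j x) = ExteriorAlgebra.map j (extContract (φ ∘ₗ j) x) := by
  induction x using exteriorAlgebra_induction with
  | h0 c => rw [AlgHom.commutes, extContract_algebraMap, extContract_algebraMap, map_zero]
  | hadd x y hx hy => simp only [map_add, hx, hy]
  | hmul m x hx =>
    rw [map_mul, ExteriorAlgebra.map_apply_ι, extContract_ι_mul, hx, extContract_ι_mul, map_sub,
      map_smul, map_mul, ExteriorAlgebra.map_apply_ι]
    rfl

theorem ι_mul_ι_mul_comm (u w : V) (x : ExteriorAlgebra ℂ V) :
    ExteriorAlgebra.ι ℂ u * (ExteriorAlgebra.ι ℂ w * x) =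
      -(ExteriorAlgebra.ι ℂ w * (ExteriorAlgebra.ι ℂ u * x)) := by
  have h := ExteriorAlgebra.ι_add_mul_swap (R := ℂ) u w
  rw [← mul_assoc, ← mul_assoc, eq_neg_of_add_eq_zero_left h, neg_mul]

/-- A shear by one vector c changes the map of exterior algebras only to first order: the terms
containing c twice vanish because c ∧ c = 0. -/
theorem map_sub_smulRight (j q : M →ₗ[ℂ] V) (φ : M →ₗ[ℂ] ℂ) (c : V)
    (hq : ∀ m, q m = j m - φ m • c) (x : ExteriorAlgebra ℂ M) :
    ExteriorAlgebra.map q x = ExteriorAlgebra.map j x -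
      ExteriorAlgebra.ι ℂ c * ExteriorAlgebra.map j (extContract φ x) := by
  induction x using exteriorAlgebra_induction with
  | h0 k =>
    rw [AlgHom.commutes, AlgHom.commutes, extContract_algebraMap, map_zero, mul_zero, sub_zero]
  | hadd x y hx hy =>
    simp only [map_add, hx, hy, mul_add]
    abel
  | hmul m x hx =>
    rw [map_mul, map_mul, ExteriorAlgebra.map_apply_ι, ExteriorAlgebra.map_apply_ι, hx,
      extContract_ι_mul, map_sub, map_smul, map_mul, ExteriorAlgebra.map_apply_ι, hq, map_sub,
      map_smul, sub_mul, mul_sub, mul_sub, mul_sub, smul_mul_assoc, smul_mul_assoc, mul_smul_comm,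
      ι_mul_ι_mul_comm (j m) c, ← mul_assoc (ExteriorAlgebra.ι ℂ c) (ExteriorAlgebra.ι ℂ c),
      ExteriorAlgebra.ι_sq_zero, zero_mul, smul_zero]
    abel

/-- After contraction with φ the shear q may be replaced by j, as the correction c ∧ j(i_φ ·) is
killed by i_φ² = 0. This makes the projections built into the edge maps invisible in the ambient
algebra. -/
theorem sum_ιMulti_removeNth (j q : M →ₗ[ℂ] V) (φ : M →ₗ[ℂ] ℂ) (c : V)
    (hq : ∀ m, q m = j m - φ m • c) (r : ℕ) (t : Fin (r + 1) → M) :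
    ∑ i : Fin (r + 1), (-1 : ℤ) ^ (i : ℕ) • φ (t i) •
        ExteriorAlgebra.map q (ExteriorAlgebra.ιMulti ℂ r (i.removeNth t)) =
      ExteriorAlgebra.map j (extContract φ (ExteriorAlgebra.ιMulti ℂ (r + 1) t)) := by
  have hR : ExteriorAlgebra.map j (extContract φ (ExteriorAlgebra.ιMulti ℂ (r + 1) t)) =
      φ (t 0) • ExteriorAlgebra.map j (ExteriorAlgebra.ιMulti ℂ r (Matrix.vecTail t)) -
      ExteriorAlgebra.ι ℂ (j (t 0)) *
        ExteriorAlgebra.map j (extContract φ (ExteriorAlgebra.ιMulti ℂ r (Matrix.vecTail t))) := by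
    rw [ExteriorAlgebra.ιMulti_succ_apply, extContract_ι_mul, map_sub, map_smul, map_mul,
      ExteriorAlgebra.map_apply_ι]
  have h0 : (0 : Fin (r + 1)).removeNth t = Matrix.vecTail t := by
    ext i
    simp [Fin.removeNth, Matrix.vecTail]
  rw [hR, Fin.sum_univ_succ, Fin.val_zero, pow_zero, one_smul, h0, map_sub_smulRight j q φ c hq]
  clear hR h0
  induction r with
  | zero =>
    have h1 : ExteriorAlgebra.ιMulti ℂ 0 (Matrix.vecTail t) =
        algebraMap ℂ (ExteriorAlgebra ℂ M) 1 := by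
      rw [ExteriorAlgebra.ιMulti_zero_apply, map_one]
    rw [h1, extContract_algebraMap]
    simp
  | succ r ih =>
    have h2 : ∀ i : Fin (r + 1), i.succ.removeNth t =
        Matrix.vecCons (t 0) (i.removeNth (Matrix.vecTail t)) := by
      intro i
      rw [← removeNth_succ_vecCons]
      congr 1
      exact (Matrix.cons_head_tail t).symm
    have h3 : ∑ i : Fin (r + 1), (-1 : ℤ) ^ (i.succ : ℕ) • φ (t i.succ) •
        ExteriorAlgebra.map q (ExteriorAlgebra.ιMulti ℂ (r + 1) (i.succ.removeNth t)) =
        -(ExteriorAlgebra.ι ℂ (q (t 0)) * ∑ i : Fin (r + 1), (-1 : ℤ) ^ (i : ℕ) •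
          φ (Matrix.vecTail t i) • ExteriorAlgebra.map q
            (ExteriorAlgebra.ιMulti ℂ r (i.removeNth (Matrix.vecTail t)))) := by
      rw [Finset.mul_sum, ← Finset.sum_neg_distrib]
      refine Finset.sum_congr rfl fun i _ => ?_
      rw [h2, ExteriorAlgebra.ιMulti_succ_apply, map_mul, ExteriorAlgebra.map_apply_ι,
        Fin.val_succ, pow_succ, mul_neg, mul_one, neg_smul, mul_smul_comm, mul_smul_comm]
      rfl
    have h4 : ∑ i : Fin (r + 1), (-1 : ℤ) ^ (i : ℕ) •
          φ (Matrix.vecTail t i) • ExteriorAlgebra.map q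
            (ExteriorAlgebra.ιMulti ℂ r (i.removeNth (Matrix.vecTail t))) =
        ExteriorAlgebra.map j
          (extContract φ (ExteriorAlgebra.ιMulti ℂ (r + 1) (Matrix.vecTail t))) := by
      have h0' : (0 : Fin (r + 1)).removeNth (Matrix.vecTail t) =
          Matrix.vecTail (Matrix.vecTail t) := by
        ext i
        simp [Fin.removeNth, Matrix.vecTail]
      rw [ExteriorAlgebra.ιMulti_succ_apply, extContract_ι_mul, map_sub, map_smul, map_mul,
        ExteriorAlgebra.map_apply_ι, Fin.sum_univ_succ, Fin.val_zero, pow_zero, one_smul, h0',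
        map_sub_smulRight j q φ c hq]
      exact ih (Matrix.vecTail t)
    rw [h3, h4, hq, map_sub, map_smul, sub_mul, smul_mul_assoc, smul_sub]
    abel

theorem map_contract (j : M →ₗ[ℂ] V) (j' : M' →ₗ[ℂ] V) (φ : M →ₗ[ℂ] ℂ) (p : M →ₗ[ℂ] M') (c : V)
    (hp : ∀ m, j' (p m) = j m - φ m • c) (r : ℕ) (ω : ⋀[ℂ]^(r + 1) M) :
    ExteriorAlgebra.map j' (contract φ p r ω : ExteriorAlgebra ℂ M') =
      ExteriorAlgebra.map j (extContract φ (ω : ExteriorAlgebra ℂ M)) := by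
  have hω : ω ∈ Submodule.span ℂ (Set.range (exteriorPower.ιMulti ℂ (r + 1) (M := M))) := by
    rw [exteriorPower.ιMulti_span]
    trivial
  induction hω using Submodule.span_induction with
  | zero => simp
  | add x y _ _ hx hy => simp only [map_add, Submodule.coe_add, hx, hy]
  | smul k x _ hx => simp only [map_smul, Submodule.coe_smul, hx]
  | mem x hx =>
    obtain ⟨t, rfl⟩ := hx
    rw [contract_ιMulti, exteriorPower.ιMulti_apply_coe,
      ← sum_ιMulti_removeNth j (j' ∘ₗ p) φ c hp, Submodule.coe_sum, map_sum]
    refine Finset.sum_congr rfl fun i _ => ?_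
    rw [← Int.cast_smul_eq_zsmul ℂ, ← Int.cast_smul_eq_zsmul ℂ, Submodule.coe_smul,
      Submodule.coe_smul, map_smul, map_smul, exteriorPower.ιMulti_apply_coe]
    congr 2
    rw [ExteriorAlgebra.map_apply_ιMulti, ExteriorAlgebra.map_apply_ιMulti]
    rfl

end Contraction

/-! ### The maps of edges in the ambient space -/

section Ambient

variable {N : ℕ} {𝒜 : Arrangement N}

/-- The inclusion of `T_α ⊕ F_α` into `T ⊕ F`. -/
def ambient (α : 𝒜.Vertex) : α.TF →ₗ[ℂ] Aff N × AffFun N := α.T.subtype.prodMap α.F.subtype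

theorem ambient_injective (α : 𝒜.Vertex) : Function.Injective (ambient α) :=
  Prod.map_injective.2 ⟨Subtype.val_injective, Subtype.val_injective⟩

theorem map_ambient_injective (α : 𝒜.Vertex) :
    Function.Injective (ExteriorAlgebra.map (ambient α)) :=
  ExteriorAlgebra.map_injective_field (LinearMap.ker_eq_bot.2 (ambient_injective α))

/-- The differential of an affine function as a linear form on `T ⊕ F`. -/
def formOfFun (f : AffFun N) : Aff N × AffFun N →ₗ[ℂ] ℂ := f.linear ∘ₗ LinearMap.fst ℂ _ _

/-- The pairing with a vector field as a linear form on `T ⊕ F`. -/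
def formOfField (ξ : Aff N) : Aff N × AffFun N →ₗ[ℂ] ℂ := pairField ξ ∘ₗ LinearMap.snd ℂ _ _

/-- A map between the exterior powers of the spaces of two strata which is induced by the
contraction with a linear form on the ambient space. -/
def IsContraction {α β : 𝒜.Vertex} {r : ℕ} (ψ : Aff N × AffFun N →ₗ[ℂ] ℂ)
    (C : ⋀[ℂ]^(r + 1) α.TF →ₗ[ℂ] ⋀[ℂ]^r β.TF) : Prop :=
  ∀ ω, ExteriorAlgebra.map (ambient β) (C ω : ExteriorAlgebra ℂ β.TF) =
    ExteriorAlgebra.map (ambient α) (extContract (ψ ∘ₗ ambient α) (ω : ExteriorAlgebra ℂ α.TF))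

theorem IsContraction.comp {α β γ : 𝒜.Vertex} {r : ℕ} {ψ ψ' : Aff N × AffFun N →ₗ[ℂ] ℂ}
    {C : ⋀[ℂ]^(r + 2) α.TF →ₗ[ℂ] ⋀[ℂ]^(r + 1) β.TF} {C' : ⋀[ℂ]^(r + 1) β.TF →ₗ[ℂ] ⋀[ℂ]^r γ.TF}
    (hC : IsContraction ψ C) (hC' : IsContraction ψ' C') (ω : ⋀[ℂ]^(r + 2) α.TF) :
    ExteriorAlgebra.map (ambient γ) (C' (C ω) : ExteriorAlgebra ℂ γ.TF) =
      ExteriorAlgebra.map (ambient α) (extContract (ψ' ∘ₗ ambient α)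
        (extContract (ψ ∘ₗ ambient α) (ω : ExteriorAlgebra ℂ α.TF))) := by
  rw [hC', ← extContract_map, hC, extContract_map]

/-- The spaces at the end stratum embed in the ambient exterior algebra, where both sides are double
contractions of the same element; the scalar is the determinant of the change of forms on T_α ⊕ F_α.
-/
theorem IsContraction.comp_eq_smul {α β β' γ : 𝒜.Vertex} {r : ℕ}
    {ψ₁ ψ₂ ψ₁' ψ₂' : Aff N × AffFun N →ₗ[ℂ] ℂ}
    {C₁ : ⋀[ℂ]^(r + 2) α.TF →ₗ[ℂ] ⋀[ℂ]^(r + 1) β.TF} {C₂ : ⋀[ℂ]^(r + 1) β.TF →ₗ[ℂ] ⋀[ℂ]^r γ.TF}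
    {C₁' : ⋀[ℂ]^(r + 2) α.TF →ₗ[ℂ] ⋀[ℂ]^(r + 1) β'.TF}
    {C₂' : ⋀[ℂ]^(r + 1) β'.TF →ₗ[ℂ] ⋀[ℂ]^r γ.TF}
    (h₁ : IsContraction ψ₁ C₁) (h₂ : IsContraction ψ₂ C₂) (h₁' : IsContraction ψ₁' C₁')
    (h₂' : IsContraction ψ₂' C₂') {a b a' b' : ℂ}
    (h : ψ₁ ∘ₗ ambient α = a • (ψ₁' ∘ₗ ambient α) + b • (ψ₂' ∘ₗ ambient α))
    (h' : ψ₂ ∘ₗ ambient α = a' • (ψ₁' ∘ₗ ambient α) + b' • (ψ₂' ∘ₗ ambient α)) :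
    C₂ ∘ₗ C₁ = (a * b' - a' * b) • (C₂' ∘ₗ C₁') := by
  refine LinearMap.ext fun ω => Subtype.ext (map_ambient_injective γ ?_)
  rw [LinearMap.comp_apply, h₁.comp h₂, LinearMap.smul_apply, LinearMap.comp_apply,
    Submodule.coe_smul, map_smul, h₁'.comp h₂', h, h', extContract_comb_comb, map_smul]

theorem IsContraction.comp_eq_zero {α β γ : 𝒜.Vertex} {r : ℕ} {ψ ψ' : Aff N × AffFun N →ₗ[ℂ] ℂ}
    {C : ⋀[ℂ]^(r + 2) α.TF →ₗ[ℂ] ⋀[ℂ]^(r + 1) β.TF} {C' : ⋀[ℂ]^(r + 1) β.TF →ₗ[ℂ] ⋀[ℂ]^r γ.TF}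
    (hC : IsContraction ψ C) (hC' : IsContraction ψ' C') (h : ψ' ∘ₗ ambient α = 0) :
    C' ∘ₗ C = 0 := by
  refine LinearMap.ext fun ω => Subtype.ext (map_ambient_injective γ ?_)
  rw [LinearMap.comp_apply, hC.comp hC', h, extContract_zero, map_zero, LinearMap.zero_apply,
    Submodule.coe_zero, map_zero]

variable (fr : EdgeFraming 𝒜) {α β : 𝒜.Vertex}

theorem ambient_projT (h : α.Succ β) (t : α.TF) :
    ambient β ((fr.projT h).prodMap (Submodule.inclusion h.F_le) t) = ambient α t -
      (fr.f α β).linear (t.1 : Aff N) • ((fr.pairing α β)⁻¹ • fr.ξ α β, (0 : AffFun N)) := by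
  refine Prod.ext ?_ ?_
  · refine (fr.projT_apply h t.1).trans ?_
    rw [mul_comm, mul_smul]
    rfl
  · change (t.2 : AffFun N) = t.2 - _ • (0 : AffFun N)
    rw [smul_zero, sub_zero]

theorem ambient_projF (h : α.Succ β) (t : β.TF) :
    ambient α ((Submodule.inclusion h.T_le).prodMap (fr.projF h) t) = ambient β t -
      (t.2 : AffFun N).linear (fr.ξ α β) • ((0 : Aff N), (fr.pairing α β)⁻¹ • fr.f α β) := by
  refine Prod.ext ?_ ?_
  · change (t.1 : Aff N) = t.1 - _ • (0 : Aff N)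
    rw [smul_zero, sub_zero]
  · refine (fr.projF_apply h t.2).trans ?_
    rw [mul_comm, mul_smul]
    rfl

theorem isContraction_contractDown (h : α.Succ β) (r : ℕ) :
    IsContraction (formOfFun (fr.f α β)) (fr.contractDown h r) :=
  map_contract _ _ _ _ _ (ambient_projT fr h) r

theorem isContraction_contractUp (h : α.Succ β) (r : ℕ) :
    IsContraction (formOfField (fr.ξ α β)) (fr.contractUp h r) :=
  map_contract _ _ _ _ _ (ambient_projF fr h) r

end Ambient

end QuiverD

/-! ### The geometry of two-step paths and d₀² = 0. -/

namespace QuiverD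

open Arrangement

variable {N : ℕ} {𝒜 : Arrangement N}

/-! ### Tangent spaces along edges -/

namespace Arrangement.Vertex

variable {α β γ δ : 𝒜.Vertex}

/-- T_β is the kernel of df_{βα} on T_α, so any vector of T_α outside T_β spans T_α modulo T_β. -/
theorem Succ.exists_sub_smul_mem (fr : EdgeFraming 𝒜) (h : α.Succ β) {u t : Aff N} (hu : u ∈ α.T)
    (hu' : u ∉ β.T) (ht : t ∈ α.T) : ∃ s : ℂ, t - s • u ∈ β.T := by
  have h0 : (fr.f α β).linear u ≠ 0 := fun h0 =>
    (h.mem_or_mem (fr.f_mem h) hu h0).elim (fr.f_notMem h) hu'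
  refine ⟨(fr.f α β).linear t / (fr.f α β).linear u, ?_⟩
  refine (h.mem_or_mem (fr.f_mem h) (α.T.sub_mem ht (α.T.smul_mem _ hu)) ?_).resolve_left
    (fr.f_notMem h)
  rw [map_sub, map_smul, smul_eq_mul, div_mul_cancel₀ _ h0, sub_self]

theorem Succ.not_succ (h : α.Succ β) : ¬ β.Succ α := fun h' => by
  have h1 := h.2
  have h2 := h'.2
  omega

theorem Succ.l_eq (h : α.Succ β) : (β.l : ℤ) = α.l + 1 := by
  have h1 := h.2
  have h2 := α.dim_le
  simp only [l]
  omega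

theorem eq_of_T_eq (h : α.T = γ.T) (hα : δ.closure ≤ α.closure) (hγ : δ.closure ≤ γ.closure) :
    α = γ := by
  obtain ⟨x, hx⟩ := δ.2.1
  exact Subtype.ext (AffineSubspace.ext_of_direction_eq h ⟨x, hα hx, hγ hx⟩)

/-- A common tangent vector outside T_δ would span both T_α and T_γ modulo T_δ; then the strata
would be parallel and share the points of X_δ, hence be equal. -/
theorem Succ.mem_of_mem_mem (fr : EdgeFraming 𝒜) (hα : α.Succ δ) (hγ : γ.Succ δ) (hne : α ≠ γ)
    {u : Aff N} (h1 : u ∈ α.T) (h2 : u ∈ γ.T) : u ∈ δ.T := by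
  by_contra hu
  refine hne (eq_of_T_eq (le_antisymm ?_ ?_) hα.1 hγ.1)
  · intro t ht
    obtain ⟨s, hs⟩ := hα.exists_sub_smul_mem fr h1 hu ht
    have h := γ.T.add_mem (hγ.T_le hs) (γ.T.smul_mem s h2)
    rwa [sub_add_cancel] at h
  · intro t ht
    obtain ⟨s, hs⟩ := hγ.exists_sub_smul_mem fr h2 hu ht
    have h := α.T.add_mem (hα.T_le hs) (α.T.smul_mem s h1)
    rwa [sub_add_cancel] at h

/-- The intersection of the two closures has tangent space T_δ and also T_δ', so both lower strata
have this intersection as closure. Hence at most one path goes down and then up between distinct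
strata. -/
theorem Succ.eq_of_succ (fr : EdgeFraming 𝒜) {δ' : 𝒜.Vertex} (hα : α.Succ δ) (hγ : γ.Succ δ)
    (hα' : α.Succ δ') (hγ' : γ.Succ δ') (hne : α ≠ γ) : δ = δ' := by
  have hT : δ.T = δ'.T := le_antisymm
    (fun t ht => hα'.mem_of_mem_mem fr hγ' hne (hα.T_le ht) (hγ.T_le ht))
    (fun t ht => hα.mem_of_mem_mem fr hγ hne (hα'.T_le ht) (hγ'.T_le ht))
  obtain ⟨x, hx⟩ := δ.2.1
  obtain ⟨y, hy⟩ := δ'.2.1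
  have hxy : y - x ∈ δ.T := hα.mem_of_mem_mem fr hγ hne
    (AffineSubspace.vsub_mem_direction (hα'.1 hy) (hα.1 hx))
    (AffineSubspace.vsub_mem_direction (hγ'.1 hy) (hγ.1 hx))
  have hy' : y ∈ δ.closure := by
    have h := AffineSubspace.vadd_mem_of_mem_direction hxy hx
    simpa using h
  exact Subtype.ext (AffineSubspace.ext_of_direction_eq hT ⟨y, hy', hy⟩)

/-- Two strata of codimension one in the closure of a third stratum which are not parallel have a
common stratum of codimension one in their closures. -/
theorem exists_succ_of_linear_ne_zero (fr : EdgeFraming 𝒜) (hα : β.Succ α) (hγ : β.Succ γ)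
    (hne : ∃ t ∈ α.T, (fr.f β γ).linear t ≠ 0) : ∃ δ : 𝒜.Vertex, α.Succ δ ∧ γ.Succ δ := by
  obtain ⟨t, ht, h0⟩ := hne
  set g := fr.f β γ with hg
  obtain ⟨x, hx⟩ := α.2.1
  obtain ⟨z, hz⟩ := γ.2.1
  -- As g is not constant on the closure of X_α, moving from x along t reaches a zero of g; this
  -- zero lies in the closure of X_γ.
  set y : Aff N := x - (g x / g.linear t) • t with hy
  have hyα : y ∈ α.closure := by
    have h := AffineSubspace.vadd_mem_of_mem_direction
      (α.T.smul_mem (-(g x / g.linear t)) ht) hx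
    rw [vadd_eq_add] at h
    convert h using 1
    rw [hy, neg_smul]
    abel
  have hgy : g y = 0 := by
    have h := g.map_vadd x (-(g x / g.linear t) • t)
    rw [vadd_eq_add, map_smul, smul_eq_mul, vadd_eq_add, neg_mul, div_mul_cancel₀ _ h0,
      neg_add_cancel] at h
    rw [← h, hy, neg_smul]
    congr 1
    abel
  have hyγ : y ∈ γ.closure := by
    have h1 : y - z ∈ β.T := AffineSubspace.vsub_mem_direction (hα.1 hyα) (hγ.1 hz)
    have h2 : g.linear (y - z) = 0 := by
      have h := AffineMap.linearMap_vsub g y z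
      rw [hgy, (fr.f_mem hγ) z hz, vsub_self] at h
      exact h
    have h3 := (hγ.mem_or_mem (fr.f_mem hγ) h1 h2).resolve_left (fr.f_notMem hγ)
    have h4 := AffineSubspace.vadd_mem_of_mem_direction h3 hz
    simpa using h4
  obtain ⟨J, hJ, hJα⟩ := α.2.2
  obtain ⟨J', hJ', hJγ⟩ := γ.2.2
  classical
  let δ : 𝒜.Vertex := ⟨α.closure ⊓ γ.closure, ⟨y, hyα, hyγ⟩, J ∪ J', Finset.union_subset hJ hJ', by
    rw [Finset.coe_union, sInf_union, ← hJα, ← hJγ]⟩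
  have hδT : δ.T = α.T ⊓ LinearMap.ker g.linear := by
    have h1 : δ.T = α.T ⊓ γ.T := AffineSubspace.direction_inf_of_mem hyα hyγ
    rw [h1]
    refine le_antisymm (inf_le_inf_left _ fun u hu => ?_) (le_inf inf_le_left fun u hu => ?_)
    · exact linear_eq_zero (fr.f_mem hγ) hu
    · exact (hγ.mem_or_mem (fr.f_mem hγ) (hα.T_le hu.1) hu.2).resolve_left (fr.f_notMem hγ)
  have hdim : α.dim = δ.dim + 1 := by
    have h1 : Submodule.map α.T.subtype (LinearMap.ker (g.linear ∘ₗ α.T.subtype)) = δ.T := by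
      rw [hδT, LinearMap.ker_comp, Submodule.map_comap_subtype]
    have h2 : Module.finrank ℂ (LinearMap.ker (g.linear ∘ₗ α.T.subtype)) = δ.dim := by
      rw [dim, ← h1]
      exact (LinearEquiv.finrank_eq (Submodule.equivMapOfInjective _ α.T.injective_subtype _))
    have h3 := Module.Dual.finrank_ker_add_one_of_ne_zero (f := g.linear ∘ₗ α.T.subtype)
      fun h => h0 (LinearMap.congr_fun h ⟨t, ht⟩)
    rw [h2] at h3
    exact h3.symm
  refine ⟨δ, ⟨inf_le_left, hdim⟩, ⟨inf_le_right, ?_⟩⟩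
  have h1 := hα.2
  have h2 := hγ.2
  omega

end Arrangement.Vertex

/-! ### Substitution of two vector fields into a top form -/

section TopForm

variable {α β γ : 𝒜.Vertex}

/-- The value of a form on `X_α` on two vectors followed by vectors of a subspace of codimension
two. -/
def insertTwo (hd : α.dim = γ.dim + 2) (ω : α.Ω) (v : Fin γ.dim → α.T) :
    α.T →ₗ[ℂ] α.T →ₗ[ℂ] ℂ :=
  LinearMap.mk₂ ℂ
    (fun x y => (ω.domDomCongr (finCongr hd)) (Matrix.vecCons x (Matrix.vecCons y v)))
    (fun _ _ _ => AlternatingMap.map_vecCons_add _ _ _ _)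
    (fun _ _ _ => AlternatingMap.map_vecCons_smul _ _ _ _)
    (fun x y y' => congrArg (fun η => η v)
      (((ω.domDomCongr (finCongr hd)).curryLeft x).curryLeft.map_add y y'))
    (fun c x y => congrArg (fun η => η v)
      (((ω.domDomCongr (finCongr hd)).curryLeft x).curryLeft.map_smul c y))

theorem insertTwo_apply (hd : α.dim = γ.dim + 2) (ω : α.Ω) (v : Fin γ.dim → α.T) (x y : α.T) :
    insertTwo hd ω v x y =
      (ω.domDomCongr (finCongr hd)) (Matrix.vecCons x (Matrix.vecCons y v)) := rfl

theorem insertTwo_self (hd : α.dim = γ.dim + 2) (ω : α.Ω) (v : Fin γ.dim → α.T) (x : α.T) :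
    insertTwo hd ω v x x = 0 := by
  rw [insertTwo_apply]
  exact (ω.domDomCongr (finCongr hd)).map_eq_zero_of_eq _ (i := 0) (j := 1) rfl (by simp)

theorem insertTwo_swap (hd : α.dim = γ.dim + 2) (ω : α.Ω) (v : Fin γ.dim → α.T) (x y : α.T) :
    insertTwo hd ω v x y = -insertTwo hd ω v y x := by
  have h := insertTwo_self hd ω v (x + y)
  simp only [map_add, LinearMap.add_apply, insertTwo_self, zero_add, add_zero] at h
  rw [add_comm] at h
  exact eq_neg_of_add_eq_zero_left h

/-- dim T_γ + 1 vectors of T_γ are linearly dependent. So the form induced on pairs of vectors lives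
on the plane T_α / T_γ. -/
theorem insertTwo_right_eq_zero (hd : α.dim = γ.dim + 2) (hle : γ.T ≤ α.T) (ω : α.Ω)
    (v : Fin γ.dim → γ.T) (x : α.T) {y : α.T} (hy : (y : Aff N) ∈ γ.T) :
    insertTwo hd ω (Submodule.inclusion hle ∘ v) x y = 0 := by
  rw [insertTwo_apply]
  refine AlternatingMap.map_linearDependent _ _ fun hli => ?_
  have h1 : LinearIndependent ℂ (Matrix.vecCons y (Submodule.inclusion hle ∘ v)) :=
    (linearIndependent_finCons.1 hli).1
  have h2 : Matrix.vecCons y (Submodule.inclusion hle ∘ v) =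
      Submodule.inclusion hle ∘ Matrix.vecCons (⟨y, hy⟩ : γ.T) v := by
    funext i
    refine Fin.cases ?_ (fun i => ?_) i <;> rfl
  rw [h2] at h1
  have h3 := (LinearIndependent.of_comp _ h1).fintype_card_le_finrank
  rw [Fintype.card_fin] at h3
  change γ.dim + 1 ≤ γ.dim at h3
  omega

theorem insertTwo_left_eq_zero (hd : α.dim = γ.dim + 2) (hle : γ.T ≤ α.T) (ω : α.Ω)
    (v : Fin γ.dim → γ.T) {x : α.T} (hx : (x : Aff N) ∈ γ.T) (y : α.T) :
    insertTwo hd ω (Submodule.inclusion hle ∘ v) x y = 0 := by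
  rw [insertTwo_swap, insertTwo_right_eq_zero hd hle ω v y hx, neg_zero]

/-- An alternating form on the plane T_α / T_γ changes by the determinant of the coordinates. -/
theorem insertTwo_comb (hd : α.dim = γ.dim + 2) (hle : γ.T ≤ α.T) (ω : α.Ω)
    (v : Fin γ.dim → γ.T) {X Y x y : α.T} {s u s' u' : ℂ}
    (hx : (x - s • X - u • Y : Aff N) ∈ γ.T) (hy : (y - s' • X - u' • Y : Aff N) ∈ γ.T) :
    insertTwo hd ω (Submodule.inclusion hle ∘ v) x y =
      (s * u' - s' * u) * insertTwo hd ω (Submodule.inclusion hle ∘ v) X Y := by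
  set B := insertTwo hd ω (Submodule.inclusion hle ∘ v) with hB
  have h1 : B x y = B (s • X + u • Y) y := by
    have h := insertTwo_left_eq_zero hd hle ω v (x := x - s • X - u • Y) hx y
    rw [← hB, map_sub, map_sub, LinearMap.sub_apply, LinearMap.sub_apply] at h
    rw [map_add, LinearMap.add_apply]
    linear_combination h
  have h2 : B (s • X + u • Y) y = B (s • X + u • Y) (s' • X + u' • Y) := by
    have h := insertTwo_right_eq_zero hd hle ω v (s • X + u • Y) (y := y - s' • X - u' • Y) hy
    rw [← hB, map_sub, map_sub] at h
    rw [map_add (B (s • X + u • Y))]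
    linear_combination h
  have h3 : B Y X = -B X Y := insertTwo_swap _ _ _ _ _
  rw [h1, h2]
  simp only [map_add, map_smul, LinearMap.add_apply, LinearMap.smul_apply, smul_eq_mul, h3]
  rw [hB, insertTwo_self, insertTwo_self]
  ring

theorem contractForm_contractForm (fr : EdgeFraming 𝒜) (h : α.Succ β) (h' : β.Succ γ)
    (hd : α.dim = γ.dim + 2) (ω : α.Ω) (v : Fin γ.dim → γ.T) :
    fr.contractForm h' (fr.contractForm h ω) v =
      insertTwo hd ω (Submodule.inclusion (h'.T_le.trans h.T_le) ∘ v)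
        ⟨fr.ξ α β, fr.ξ_mem h⟩ ⟨fr.ξ β γ, h.T_le (fr.ξ_mem h')⟩ := by
  rw [insertTwo_apply]
  change ω _ = ω _
  congr 1
  funext i
  obtain ⟨k, rfl⟩ := (finCongr hd).symm.surjective i
  simp only [Function.comp_apply, Equiv.apply_symm_apply]
  refine Fin.cases ?_ (fun k => ?_) k
  · have h0 : finCongr h.2 ((finCongr hd).symm 0) = 0 := by
      apply Fin.ext
      simp
    rw [h0]
    rfl
  · have h0 : finCongr h.2 ((finCongr hd).symm k.succ) = ((finCongr h'.2).symm k).succ := by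
      apply Fin.ext
      simp
    rw [h0]
    refine Fin.cases ?_ (fun k => ?_) k
    · simp
      rfl
    · simp
      rfl

end TopForm

end QuiverD

namespace QuiverD

open Arrangement

variable {N : ℕ} {𝒜 : Arrangement N}

/-! ### Comparison of the paths between two strata -/

section Paths

variable (fr : EdgeFraming 𝒜) {α β β' γ δ : 𝒜.Vertex}

theorem formOfFun_ambient (f : AffFun N) (t : α.TF) :
    (formOfFun f ∘ₗ ambient α) t = f.linear (t.1 : Aff N) := rfl

theorem formOfField_ambient (ξ : Aff N) (t : α.TF) :
    (formOfField ξ ∘ₗ ambient α) t = (t.2 : AffFun N).linear ξ := rfl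

theorem exists_comb (h₁ : α.Succ β) (h₂ : β.Succ γ) {t : Aff N} (ht : t ∈ α.T) :
    ∃ s u : ℂ, t - s • fr.ξ α β - u • fr.ξ β γ ∈ γ.T := by
  obtain ⟨s, hs⟩ := h₁.exists_sub_smul_mem fr (fr.ξ_mem h₁) (fr.ξ_notMem h₁) ht
  obtain ⟨u, hu⟩ := h₂.exists_sub_smul_mem fr (fr.ξ_mem h₂) (fr.ξ_notMem h₂) hs
  exact ⟨s, u, hu⟩

theorem linear_comb {f : AffFun N} (hf : f ∈ γ.F) {t X Y : Aff N} {s u : ℂ}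
    (ht : t - s • X - u • Y ∈ γ.T) : f.linear t = s * f.linear X + u * f.linear Y := by
  have h := Vertex.linear_eq_zero hf ht
  rw [map_sub, map_sub, map_smul, map_smul, smul_eq_mul, smul_eq_mul] at h
  linear_combination h

theorem piDown_piDown_apply (h₁ : α.Succ β) (h₂ : β.Succ γ) (hd : α.dim = γ.dim + 2) (ω : α.Ω)
    (v : Fin γ.dim → γ.T) : fr.piDown h₂ (fr.piDown h₁ ω) v =
      (fr.pairing β γ)⁻¹ * ((fr.pairing α β)⁻¹ *
        insertTwo hd ω (Submodule.inclusion (h₂.T_le.trans h₁.T_le) ∘ v)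
          ⟨fr.ξ α β, fr.ξ_mem h₁⟩ ⟨fr.ξ β γ, h₁.T_le (fr.ξ_mem h₂)⟩) := by
  simp only [EdgeFraming.piDown, LinearMap.smul_apply, map_smul, AlternatingMap.smul_apply,
    smul_eq_mul, contractForm_contractForm fr h₁ h₂ hd]
  exact mul_left_comm _ _ _

/-- The differentials along one path are combinations, on T_α, of those along the other, with
coefficients found by evaluating on the framing vectors. The determinant rescales the double
contraction, and inverting df ∧ · turns it into the same factor on the other side for top forms. -/
theorem down_down (h₁ : α.Succ β) (h₂ : β.Succ γ) (h₁' : α.Succ β') (h₂' : β'.Succ γ) (r : ℕ) :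
    ∃ c : ℂ, fr.contractDown h₂ r ∘ₗ fr.contractDown h₁ (r + 1) =
        c • (fr.contractDown h₂' r ∘ₗ fr.contractDown h₁' (r + 1)) ∧
      fr.piDown h₂' ∘ₗ fr.piDown h₁' = c • (fr.piDown h₂ ∘ₗ fr.piDown h₁) := by
  have hd : α.dim = γ.dim + 2 := by rw [h₁.2, h₂.2]
  have hp₁ := fr.pairing_ne_zero h₁
  have hp₂ := fr.pairing_ne_zero h₂
  have hp₁' := fr.pairing_ne_zero h₁'
  have hp₂' := fr.pairing_ne_zero h₂'
  have hf₁ := h₂.F_le (fr.f_mem h₁)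
  have hf₂ := fr.f_mem h₂
  have hf₁' := h₂'.F_le (fr.f_mem h₁')
  have hf₂' := fr.f_mem h₂'
  have hY : (fr.f α β).linear (fr.ξ β γ) = 0 :=
    Vertex.linear_eq_zero (fr.f_mem h₁) (fr.ξ_mem h₂)
  have hY' : (fr.f α β').linear (fr.ξ β' γ) = 0 :=
    Vertex.linear_eq_zero (fr.f_mem h₁') (fr.ξ_mem h₂')
  have hcomb : ∀ f : AffFun N, f ∈ γ.F → formOfFun f ∘ₗ ambient α =
      ((f.linear (fr.ξ α β') - f.linear (fr.ξ β' γ) / fr.pairing β' γ *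
        (fr.f β' γ).linear (fr.ξ α β')) / fr.pairing α β') •
          (formOfFun (fr.f α β') ∘ₗ ambient α) +
      (f.linear (fr.ξ β' γ) / fr.pairing β' γ) • (formOfFun (fr.f β' γ) ∘ₗ ambient α) := by
    intro f hf
    refine LinearMap.ext fun t => ?_
    rw [LinearMap.add_apply, LinearMap.smul_apply, LinearMap.smul_apply, formOfFun_ambient,
      formOfFun_ambient, formOfFun_ambient, smul_eq_mul, smul_eq_mul]
    obtain ⟨s, u, ht⟩ := exists_comb fr h₁' h₂' t.1.2
    rw [linear_comb hf ht, linear_comb hf₁' ht, linear_comb hf₂' ht, hY']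
    unfold EdgeFraming.pairing at hp₁' hp₂' ⊢
    field_simp
    ring
  refine ⟨_, (isContraction_contractDown fr h₁ (r + 1)).comp_eq_smul
    (isContraction_contractDown fr h₂ r) (isContraction_contractDown fr h₁' (r + 1))
    (isContraction_contractDown fr h₂' r) (hcomb _ hf₁) (hcomb _ hf₂), ?_⟩
  refine LinearMap.ext fun ω => AlternatingMap.ext fun v => ?_
  rw [LinearMap.comp_apply, LinearMap.smul_apply, LinearMap.comp_apply, AlternatingMap.smul_apply,
    piDown_piDown_apply fr h₁ h₂ hd, piDown_piDown_apply fr h₁' h₂' hd, smul_eq_mul]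
  obtain ⟨s, u, hX⟩ := exists_comb fr h₁ h₂ (fr.ξ_mem h₁')
  obtain ⟨s', u', hY''⟩ := exists_comb fr h₁ h₂ (h₁'.T_le (fr.ξ_mem h₂'))
  rw [insertTwo_comb hd _ ω v (X := ⟨fr.ξ α β, fr.ξ_mem h₁⟩)
    (Y := ⟨fr.ξ β γ, h₁.T_le (fr.ξ_mem h₂)⟩) hX hY'']
  rw [linear_comb hf₁ hX, linear_comb hf₁ hY'', linear_comb hf₂ hX, linear_comb hf₂ hY'', hY]
  generalize insertTwo hd ω _ _ _ = z
  unfold EdgeFraming.pairing at *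
  field_simp
  ring

/-- Modulo T_α, the framing vectors of one path are combinations of those of the other. Their
determinant governs the double contraction of functions and, through i_ξ, the top forms. -/
theorem up_up (h₁ : β.Succ α) (h₂ : γ.Succ β) (h₁' : β'.Succ α) (h₂' : γ.Succ β') (r : ℕ) :
    ∃ c : ℂ, fr.contractUp h₂ r ∘ₗ fr.contractUp h₁ (r + 1) =
        c • (fr.contractUp h₂' r ∘ₗ fr.contractUp h₁' (r + 1)) ∧
      fr.piUp h₂' ∘ₗ fr.piUp h₁' = c • (fr.piUp h₂ ∘ₗ fr.piUp h₁) := by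
  have hd : γ.dim = α.dim + 2 := by rw [h₂.2, h₁.2]
  obtain ⟨s, u, hY⟩ := exists_comb fr h₂' h₁' (fr.ξ_mem h₂)
  obtain ⟨s', u', hX⟩ := exists_comb fr h₂' h₁' (h₂.T_le (fr.ξ_mem h₁))
  have hcomb : ∀ {ξ : Aff N} {s u : ℂ}, ξ - s • fr.ξ γ β' - u • fr.ξ β' α ∈ α.T →
      formOfField ξ ∘ₗ ambient α = u • (formOfField (fr.ξ β' α) ∘ₗ ambient α) +
        s • (formOfField (fr.ξ γ β') ∘ₗ ambient α) := by
    intro ξ s u hξ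
    refine LinearMap.ext fun t => ?_
    rw [LinearMap.add_apply, LinearMap.smul_apply, LinearMap.smul_apply, formOfField_ambient,
      formOfField_ambient, formOfField_ambient, smul_eq_mul, smul_eq_mul, linear_comb t.2.2 hξ,
      add_comm]
  refine ⟨_, (isContraction_contractUp fr h₁ (r + 1)).comp_eq_smul
    (isContraction_contractUp fr h₂ r) (isContraction_contractUp fr h₁' (r + 1))
    (isContraction_contractUp fr h₂' r) (hcomb hX) (hcomb hY), ?_⟩
  refine LinearMap.ext fun ω => ?_
  rw [LinearMap.comp_apply, LinearMap.smul_apply, LinearMap.comp_apply]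
  set η := fr.piUp h₂ (fr.piUp h₁ ω) with hη
  -- Writing the form on X_α as a double contraction of η reduces the comparison to two contractions
  -- of the same form on X_γ.
  have h1 : fr.contractForm h₁ (fr.contractForm h₂ η) = ω := by
    rw [(fr.piUp_eq_iff h₂ _ _).1 hη.symm, (fr.piUp_eq_iff h₁ ω _).1 rfl]
  rw [fr.piUp_eq_iff, eq_comm, fr.piUp_eq_iff, ← h1]
  refine AlternatingMap.ext fun v => ?_
  rw [contractForm_contractForm fr h₂' h₁' hd, contractForm_contractForm fr h₂ h₁ hd,
    insertTwo_comb hd _ η v (X := ⟨fr.ξ γ β', fr.ξ_mem h₂'⟩)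
      (Y := ⟨fr.ξ β' α, h₂'.T_le (fr.ξ_mem h₁')⟩) hY hX]
  have h2 : ∀ c : ℂ, insertTwo hd (c • η) (Submodule.inclusion (h₁'.T_le.trans h₂'.T_le) ∘ v)
      ⟨fr.ξ γ β', fr.ξ_mem h₂'⟩ ⟨fr.ξ β' α, h₂'.T_le (fr.ξ_mem h₁')⟩ =
      c * insertTwo hd η (Submodule.inclusion (h₁'.T_le.trans h₂'.T_le) ∘ v)
      ⟨fr.ξ γ β', fr.ξ_mem h₂'⟩ ⟨fr.ξ β' α, h₂'.T_le (fr.ξ_mem h₁')⟩ := fun c => rfl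
  rw [h2]
  ring

/-- The framing vectors a of α ≻ δ and b of γ ≻ δ form a basis of T_β / T_δ, because a common
tangent vector lies in T_δ. In this basis the exchange of the two contractions is antidiagonal, and
its sign matches the one from interchanging two vectors in a form. -/
theorem up_down (hne : α ≠ γ) (h₁ : α.Succ δ) (h₂ : γ.Succ δ) (h₁' : β.Succ α) (h₂' : β.Succ γ)
    (r : ℕ) :
    ∃ c : ℂ, fr.contractDown h₂' r ∘ₗ fr.contractUp h₁' (r + 1) =
        c • (fr.contractUp h₂ r ∘ₗ fr.contractDown h₁ (r + 1)) ∧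
      fr.piUp h₂ ∘ₗ fr.piDown h₁ = c • (fr.piDown h₂' ∘ₗ fr.piUp h₁') := by
  have hd : β.dim = δ.dim + 2 := by rw [h₁'.2, h₁.2]
  set a := fr.ξ α δ with ha
  set b := fr.ξ γ δ with hb
  set x := fr.ξ β α with hx
  set y := fr.ξ β γ with hy
  have haα : a ∈ α.T := fr.ξ_mem h₁
  have hbγ : b ∈ γ.T := fr.ξ_mem h₂
  have haγ : a ∉ γ.T := fun h => fr.ξ_notMem h₁ (h₁.mem_of_mem_mem fr h₂ hne haα h)
  have hbα : b ∉ α.T := fun h => fr.ξ_notMem h₂ (h₁.mem_of_mem_mem fr h₂ hne h hbγ)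
  obtain ⟨e, he⟩ := h₁'.exists_sub_smul_mem fr (h₂'.T_le hbγ) hbα (fr.ξ_mem h₁')
  obtain ⟨k, hk⟩ := h₁.exists_sub_smul_mem fr haα (fr.ξ_notMem h₁) he
  obtain ⟨m, hm⟩ := h₂'.exists_sub_smul_mem fr (h₁'.T_le haα) haγ (fr.ξ_mem h₂')
  obtain ⟨z, hz⟩ := h₂.exists_sub_smul_mem fr hbγ (fr.ξ_notMem h₂) hm
  rw [← hx] at he hk
  rw [← hy] at hm hz
  have hp := fr.pairing_ne_zero h₁
  have hq := fr.pairing_ne_zero h₂'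
  have hpa : fr.pairing α δ = (fr.f α δ).linear a := rfl
  have hqy : fr.pairing β γ = m * (fr.f β γ).linear a := by
    have h := Vertex.linear_eq_zero (fr.f_mem h₂') hm
    rw [map_sub, map_smul, smul_eq_mul, sub_eq_zero] at h
    exact h
  have hψ₁ : formOfField x ∘ₗ ambient α = (0 : ℂ) • (formOfFun (fr.f α δ) ∘ₗ ambient α) +
      e • (formOfField b ∘ₗ ambient α) := by
    refine LinearMap.ext fun t => ?_
    rw [LinearMap.add_apply, LinearMap.smul_apply, LinearMap.smul_apply, formOfField_ambient,
      formOfField_ambient, zero_smul, zero_add, smul_eq_mul]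
    have h := Vertex.linear_eq_zero t.2.2 he
    rw [map_sub, map_smul, smul_eq_mul, sub_eq_zero] at h
    exact h
  have hψ₂ : formOfFun (fr.f β γ) ∘ₗ ambient α =
      ((fr.f β γ).linear a / fr.pairing α δ) • (formOfFun (fr.f α δ) ∘ₗ ambient α) +
      (0 : ℂ) • (formOfField b ∘ₗ ambient α) := by
    refine LinearMap.ext fun t => ?_
    rw [LinearMap.add_apply, LinearMap.smul_apply, LinearMap.smul_apply, formOfFun_ambient,
      formOfFun_ambient, zero_smul, add_zero, smul_eq_mul]
    obtain ⟨s, hs⟩ := h₁.exists_sub_smul_mem fr haα (fr.ξ_notMem h₁) t.1.2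
    have h1 := Vertex.linear_eq_zero (fr.f_mem h₁) hs
    have h2 := Vertex.linear_eq_zero (fr.f_mem h₂') (h₂.T_le hs)
    rw [map_sub, map_smul, smul_eq_mul, sub_eq_zero] at h1 h2
    rw [h1, h2, hpa]
    rw [hpa] at hp
    field_simp
  refine ⟨_, (isContraction_contractUp fr h₁' (r + 1)).comp_eq_smul
    (isContraction_contractDown fr h₂' r) (isContraction_contractDown fr h₁ (r + 1))
    (isContraction_contractUp fr h₂ r) hψ₁ hψ₂, ?_⟩
  refine LinearMap.ext fun ω => ?_
  rw [LinearMap.comp_apply, LinearMap.smul_apply, LinearMap.comp_apply]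
  set η := fr.piUp h₁' ω with hη
  have h1 : fr.contractForm h₁' η = ω := (fr.piUp_eq_iff h₁' ω _).1 hη.symm
  rw [fr.piUp_eq_iff, ← h1, EdgeFraming.piDown, EdgeFraming.piDown, map_smul,
    LinearMap.smul_apply, map_smul, LinearMap.smul_apply]
  refine AlternatingMap.ext fun v => ?_
  rw [AlternatingMap.smul_apply, AlternatingMap.smul_apply, AlternatingMap.smul_apply,
    contractForm_contractForm fr h₂' h₂ hd, contractForm_contractForm fr h₁' h₁ hd]
  have hX : (x - k • a - e • b : Aff N) ∈ δ.T := by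
    rwa [sub_right_comm]
  have hY : (a - (1 : ℂ) • a - (0 : ℂ) • b : Aff N) ∈ δ.T := by simp
  have hX' : (b - (0 : ℂ) • a - (1 : ℂ) • b : Aff N) ∈ δ.T := by simp
  have e1 := insertTwo_comb hd (h₂.T_le.trans h₂'.T_le) η v (X := ⟨a, h₁'.T_le haα⟩)
    (Y := ⟨b, h₂'.T_le hbγ⟩) (x := ⟨y, fr.ξ_mem h₂'⟩) (y := ⟨b, h₂'.T_le hbγ⟩) hz hX'
  have e2 := insertTwo_comb hd (h₂.T_le.trans h₂'.T_le) η v (X := ⟨a, h₁'.T_le haα⟩)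
    (Y := ⟨b, h₂'.T_le hbγ⟩) (x := ⟨x, fr.ξ_mem h₁'⟩) (y := ⟨a, h₁'.T_le haα⟩) hX hY
  refine (congrArg (fun w : ℂ => (0 * 0 - (fr.f β γ).linear a / fr.pairing α δ * e) •
    (fr.pairing β γ)⁻¹ • w) e1).trans
      (Eq.trans ?_ (congrArg (fun w : ℂ => (fr.pairing α δ)⁻¹ • w) e2).symm)
  generalize insertTwo hd η _ _ _ = w
  rw [hqy] at hq ⊢
  have hm0 := left_ne_zero_of_mul hq
  have hg0 := right_ne_zero_of_mul hq
  simp only [smul_eq_mul]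
  field_simp
  ring

theorem comp_eq_zero_of_succ (h : α.Succ β) (r : ℕ) :
    fr.contractUp h r ∘ₗ fr.contractDown h (r + 1) = 0 := by
  refine (isContraction_contractDown fr h (r + 1)).comp_eq_zero (isContraction_contractUp fr h r)
    (LinearMap.ext fun t => ?_)
  rw [formOfField_ambient]
  exact Vertex.linear_eq_zero t.2.2 (fr.ξ_mem h)

/-- This covers the paths up and then down for which no quiver relation is assumed: returning paths,
and paths between parallel strata. -/
theorem comp_eq_zero_of_linear_eq_zero (h : β.Succ α) (h' : β.Succ γ)
    (hf : ∀ t ∈ α.T, (fr.f β γ).linear t = 0) (r : ℕ) :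
    fr.contractDown h' r ∘ₗ fr.contractUp h (r + 1) = 0 := by
  refine (isContraction_contractUp fr h (r + 1)).comp_eq_zero (isContraction_contractDown fr h' r)
    (LinearMap.ext fun t => ?_)
  rw [formOfFun_ambient]
  exact hf _ t.1.2

end Paths

/-! ### The square of `d₀` -/

namespace ArrQuiver

variable (𝒱 : ArrQuiver.{v} 𝒜) (fr : EdgeFraming 𝒜) {α β γ : 𝒜.Vertex}

theorem edgeMap_down (h : α.Succ β) (r : ℕ) : 𝒱.edgeMap fr r β α =
    ExtCoef.map (fr.contractDown h r) (𝒱.coefMap (fr.piDown h) (𝒱.A β α)) := dif_pos h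

theorem edgeMap_up (h : β.Succ α) (r : ℕ) : 𝒱.edgeMap fr r β α =
    ExtCoef.map (fr.contractUp h r) (𝒱.coefMap (fr.piUp h) (𝒱.A β α)) :=
  (dif_neg h.not_succ).trans (dif_pos h)

theorem edgeMap_eq_zero (h : ¬ (α.Succ β ∨ β.Succ α)) (r : ℕ) : 𝒱.edgeMap fr r β α = 0 := by
  rw [not_or] at h
  exact (dif_neg h.1).trans (dif_neg h.2)

/-- The map given by a map of exterior powers, a map of spaces of forms and a map of the spaces of
the quiver. -/
def pathMap {r s : ℕ} (C : ⋀[ℂ]^r α.TF →ₗ[ℂ] ⋀[ℂ]^s γ.TF) (p : α.Ω →ₗ[ℂ] γ.Ω) :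
    (𝒱.V α →ₗ[ℂ] 𝒱.V γ) →ₗ[ℂ] 𝒱.Gen r α →ₗ[ℂ] 𝒱.Gen s γ where
  toFun A := ExtCoef.map C (𝒱.coefMap p A)
  map_add' A B := TensorProduct.ext' fun x y => by
    have h : 𝒱.coefMap p (A + B) = 𝒱.coefMap p A + 𝒱.coefMap p B :=
      TensorProduct.map_add_right p A B
    rw [h]
    exact LinearMap.congr_fun (TensorProduct.map_add_right C (𝒱.coefMap p A) (𝒱.coefMap p B)) _
  map_smul' c A := TensorProduct.ext' fun x y => by
    have h : 𝒱.coefMap p (c • A) = c • 𝒱.coefMap p A := TensorProduct.map_smul_right c p A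
    rw [h]
    exact LinearMap.congr_fun (TensorProduct.map_smul_right c C (𝒱.coefMap p A)) _

theorem pathMap_apply {r s : ℕ} (C : ⋀[ℂ]^r α.TF →ₗ[ℂ] ⋀[ℂ]^s γ.TF) (p : α.Ω →ₗ[ℂ] γ.Ω)
    (A : 𝒱.V α →ₗ[ℂ] 𝒱.V γ) : 𝒱.pathMap C p A = ExtCoef.map C (𝒱.coefMap p A) := rfl

theorem map_comp_map {r s u : ℕ} (C : ⋀[ℂ]^r α.TF →ₗ[ℂ] ⋀[ℂ]^s β.TF)
    (C' : ⋀[ℂ]^s β.TF →ₗ[ℂ] ⋀[ℂ]^u γ.TF) (p : α.Ω →ₗ[ℂ] β.Ω) (p' : β.Ω →ₗ[ℂ] γ.Ω)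
    (A : 𝒱.V α →ₗ[ℂ] 𝒱.V β) (A' : 𝒱.V β →ₗ[ℂ] 𝒱.V γ) :
    ExtCoef.map C' (𝒱.coefMap p' A') ∘ₗ ExtCoef.map C (𝒱.coefMap p A) =
      𝒱.pathMap (C' ∘ₗ C) (p' ∘ₗ p) (A' ∘ₗ A) := by
  have h : 𝒱.coefMap p' A' ∘ₗ 𝒱.coefMap p A = 𝒱.coefMap (p' ∘ₗ p) (A' ∘ₗ A) :=
    (TensorProduct.map_comp p' A' p A).symm
  rw [pathMap_apply, ← h]
  exact (TensorProduct.map_comp C' _ C _).symm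

theorem pathMap_zero {r s : ℕ} (p : α.Ω →ₗ[ℂ] γ.Ω) :
    𝒱.pathMap (0 : ⋀[ℂ]^r α.TF →ₗ[ℂ] ⋀[ℂ]^s γ.TF) p = 0 :=
  LinearMap.ext fun A => TensorProduct.ext' fun _ y =>
    TensorProduct.zero_tmul _ (𝒱.coefMap p A y)

/-- The constant moves across the tensor product from the exterior factor to the top forms. -/
theorem pathMap_eq {r s : ℕ} {C C' : ⋀[ℂ]^r α.TF →ₗ[ℂ] ⋀[ℂ]^s γ.TF} {p p' : α.Ω →ₗ[ℂ] γ.Ω}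
    (h : ∃ c : ℂ, C = c • C' ∧ p' = c • p) : 𝒱.pathMap C p = 𝒱.pathMap C' p' := by
  obtain ⟨c, rfl, rfl⟩ := h
  refine LinearMap.ext fun A => TensorProduct.ext' fun x y => ?_
  have h : 𝒱.coefMap (c • p) A = c • 𝒱.coefMap p A := TensorProduct.map_smul_left c p A
  rw [pathMap_apply, pathMap_apply, h]
  exact TensorProduct.smul_tmul c (C' x) (𝒱.coefMap p A y)

theorem sum_comp_eq_zero_of_pathMap {r : ℕ} (Z : (𝒱.V α →ₗ[ℂ] 𝒱.V γ) →ₗ[ℂ]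
      𝒱.Gen (r + 2) α →ₗ[ℂ] 𝒱.Gen r γ)
    (hA : ∑ β, 𝒱.A γ β ∘ₗ 𝒱.A β α = 0)
    (hZ : ∀ β, (α.Succ β ∨ β.Succ α) → (β.Succ γ ∨ γ.Succ β) →
      𝒱.edgeMap fr r γ β ∘ₗ 𝒱.edgeMap fr (r + 1) β α = Z (𝒱.A γ β ∘ₗ 𝒱.A β α)) :
    ∑ β, 𝒱.edgeMap fr r γ β ∘ₗ 𝒱.edgeMap fr (r + 1) β α = 0 := by
  rw [← map_zero Z, ← hA, map_sum]
  refine Finset.sum_congr rfl fun β _ => ?_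
  by_cases h1 : α.Succ β ∨ β.Succ α
  · by_cases h2 : β.Succ γ ∨ γ.Succ β
    · exact hZ β h1 h2
    · rw [edgeMap_eq_zero 𝒱 fr h2, 𝒱.A_eq_zero γ β (by rwa [or_comm]), LinearMap.zero_comp,
        LinearMap.zero_comp, map_zero]
  · rw [edgeMap_eq_zero 𝒱 fr h1, 𝒱.A_eq_zero β α (by rwa [or_comm]), LinearMap.comp_zero,
      LinearMap.comp_zero, map_zero]

/-- The dimensions of the ends decide which paths exist. If the ends differ by two steps, or are
distinct with a common lower stratum, all paths have one geometric factor and a quiver relation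
applies. Otherwise every path vanishes by itself. -/
theorem sum_edgeMap_comp (r : ℕ) (α γ : 𝒜.Vertex) :
    ∑ β, 𝒱.edgeMap fr r γ β ∘ₗ 𝒱.edgeMap fr (r + 1) β α = 0 := by
  by_cases hdd : ∃ β₀, α.Succ β₀ ∧ β₀.Succ γ
  · obtain ⟨β₀, h₁, h₂⟩ := hdd
    refine 𝒱.sum_comp_eq_zero_of_pathMap fr
      (𝒱.pathMap (fr.contractDown h₂ r ∘ₗ fr.contractDown h₁ (r + 1))
        (fr.piDown h₂ ∘ₗ fr.piDown h₁)) ?_ fun β hα hγ => ?_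
    · refine 𝒱.sum_eq_zero_of_two γ α ?_
      rw [h₂.l_eq, h₁.l_eq]
      norm_num [add_assoc]
    · have e₁ := h₁.2
      have e₂ := h₂.2
      have h₁' : α.Succ β := hα.resolve_right fun h => by
        have e := h.2
        rcases hγ with h' | h' <;> have e' := h'.2 <;> omega
      have h₂' : β.Succ γ := hγ.resolve_right fun h => by
        have e := h.2
        have e' := h₁'.2
        omega
      rw [edgeMap_down 𝒱 fr h₁', edgeMap_down 𝒱 fr h₂', map_comp_map,
        𝒱.pathMap_eq (down_down fr h₁' h₂' h₁ h₂ r)]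
  by_cases huu : ∃ β₀, β₀.Succ α ∧ γ.Succ β₀
  · obtain ⟨β₀, h₁, h₂⟩ := huu
    refine 𝒱.sum_comp_eq_zero_of_pathMap fr
      (𝒱.pathMap (fr.contractUp h₂ r ∘ₗ fr.contractUp h₁ (r + 1))
        (fr.piUp h₂ ∘ₗ fr.piUp h₁)) ?_ fun β hα hγ => ?_
    · refine 𝒱.sum_eq_zero_of_two γ α ?_
      rw [h₁.l_eq, h₂.l_eq, abs_sub_comm]
      norm_num [add_assoc]
    · have e₁ := h₁.2
      have e₂ := h₂.2
      have h₁' : β.Succ α := hα.resolve_left fun h => by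
        have e := h.2
        rcases hγ with h' | h' <;> have e' := h'.2 <;> omega
      have h₂' : γ.Succ β := hγ.resolve_left fun h => by
        have e := h.2
        have e' := h₁'.2
        omega
      rw [edgeMap_up 𝒱 fr h₁', edgeMap_up 𝒱 fr h₂', map_comp_map,
        𝒱.pathMap_eq (up_up fr h₁' h₂' h₁ h₂ r)]
  by_cases hδ : α ≠ γ ∧ ∃ δ, α.Succ δ ∧ γ.Succ δ
  · obtain ⟨hne, δ, h₁, h₂⟩ := hδ
    refine 𝒱.sum_comp_eq_zero_of_pathMap fr
      (𝒱.pathMap (fr.contractUp h₂ r ∘ₗ fr.contractDown h₁ (r + 1))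
        (fr.piUp h₂ ∘ₗ fr.piDown h₁)) ?_ fun β hα hγ => ?_
    · refine 𝒱.sum_eq_zero_of_ne γ α ?_ hne.symm ⟨δ, h₂, h₁⟩
      have e₁ := h₁.l_eq
      have e₂ := h₂.l_eq
      omega
    · rcases hα with hα | hα <;> rcases hγ with hγ | hγ
      · exact absurd ⟨β, hα, hγ⟩ hdd
      · obtain rfl := h₁.eq_of_succ fr h₂ hα hγ hne
        rw [edgeMap_down 𝒱 fr h₁, edgeMap_up 𝒱 fr h₂, map_comp_map]
      · rw [edgeMap_up 𝒱 fr hα, edgeMap_down 𝒱 fr hγ, map_comp_map,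
          𝒱.pathMap_eq (up_down fr hne h₁ h₂ hα hγ r)]
      · exact absurd ⟨β, hα, hγ⟩ huu
  · refine Finset.sum_eq_zero fun β _ => ?_
    by_cases hα : α.Succ β ∨ β.Succ α
    · by_cases hγ : β.Succ γ ∨ γ.Succ β
      · rcases hα with hα | hα <;> rcases hγ with hγ | hγ
        · exact absurd ⟨β, hα, hγ⟩ hdd
        · obtain rfl : α = γ := by
            by_contra hne
            exact hδ ⟨hne, β, hα, hγ⟩
          rw [edgeMap_down 𝒱 fr hα, edgeMap_up 𝒱 fr hα, map_comp_map, comp_eq_zero_of_succ,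
            pathMap_zero, LinearMap.zero_apply]
        · rw [edgeMap_up 𝒱 fr hα, edgeMap_down 𝒱 fr hγ, map_comp_map,
            comp_eq_zero_of_linear_eq_zero, pathMap_zero, LinearMap.zero_apply]
          -- A nonzero differential of f_{γβ} on T_α would give either a contradiction when α = γ,
          -- or a common lower stratum, already excluded.
          by_contra! h
          by_cases hne : α = γ
          · subst hne
            obtain ⟨t, ht, h⟩ := h
            exact h (Vertex.linear_eq_zero (fr.f_mem hγ) ht)
          · exact hδ ⟨hne, Vertex.exists_succ_of_linear_ne_zero fr hα hγ h⟩
        · exact absurd ⟨β, hα, hγ⟩ huu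
      · rw [edgeMap_eq_zero 𝒱 fr hγ, LinearMap.zero_comp]
    · rw [edgeMap_eq_zero 𝒱 fr hα, LinearMap.comp_zero]

end ArrQuiver

end QuiverD

/-! ### The components of the differential and d² = 0. -/

namespace QuiverD

open Arrangement

/-! ### The components of the differential -/

theorem extend_incl_comp_tmul {D : Type} [Ring D] [Algebra ℂ D] {G G' : Type v} [AddCommGroup G]
    [Module ℂ G] [AddCommGroup G'] [Module ℂ G'] (g : G →ₗ[ℂ] G') (P : D) (x : G) :
    FreeOn.extend D (FreeOn.incl D ∘ₗ g) (FreeOn.tmul D P x) = FreeOn.tmul D P (g x) := by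
  have h : P • FreeOn.tmul D 1 (g x) = FreeOn.tmul D (P * 1) (g x) := rfl
  rw [mul_one] at h
  exact h

theorem component_lof {D ι : Type} [Ring D] [DecidableEq ι] {G : ι → Type v}
    [∀ i, AddCommGroup (G i)] [∀ i, Module D (G i)] (i : ι) (x : G i) :
    (DirectSum.lof D ι G i x) i = x := DirectSum.component.lof_self D i x

theorem component_lof_ne {D ι : Type} [Ring D] [DecidableEq ι] {G : ι → Type v}
    [∀ i, AddCommGroup (G i)] [∀ i, Module D (G i)] {i j : ι} (h : i ≠ j) (x : G i) :
    (DirectSum.lof D ι G i x) j = 0 :=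
  (DirectSum.component.of D j i x).trans (dif_neg h)

namespace ArrQuiver

variable {N : ℕ} {𝒜 : Arrangement N} (𝒱 : ArrQuiver.{v} 𝒜) (fr : EdgeFraming 𝒜)

section

variable (R : Type) [CommRing R] [Algebra ℂ R]

/-- The component of the differential `d₀` from the summand of `α` to the summand of `β`. -/
def edgeOp (r : ℕ) (β α : 𝒜.Vertex) :
    FreeOn (DiffOp R) (𝒱.Gen (r + 1) α) →ₗ[DiffOp R] FreeOn (DiffOp R) (𝒱.Gen r β) :=
  FreeOn.extend (DiffOp R) (FreeOn.incl (DiffOp R) ∘ₗ 𝒱.edgeMap fr r β α)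

variable {α β : 𝒜.Vertex}

theorem edgeOp_down (h : α.Succ β) (r : ℕ) : 𝒱.edgeOp fr R r β α =
    baseMap (fr.contractDown h r) (𝒱.coefMap (fr.piDown h) (𝒱.A β α)) := by
  rw [edgeOp, edgeMap_down 𝒱 fr h]
  rfl

theorem edgeOp_up (h : β.Succ α) (r : ℕ) : 𝒱.edgeOp fr R r β α =
    baseMap (fr.contractUp h r) (𝒱.coefMap (fr.piUp h) (𝒱.A β α)) := by
  rw [edgeOp, edgeMap_up 𝒱 fr h]
  rfl

theorem edgeOp_eq_zero (h : ¬ (α.Succ β ∨ β.Succ α)) (r : ℕ) : 𝒱.edgeOp fr R r β α = 0 := by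
  refine hom_ext_kos' fun t w => ?_
  have h1 := extend_incl_comp_tmul (𝒱.edgeMap fr r β α) (1 : DiffOp R) (ExtCoef.mk t w)
  rw [edgeMap_eq_zero 𝒱 fr h] at h1
  rw [edgeOp, edgeMap_eq_zero 𝒱 fr h]
  exact h1.trans (TensorProduct.tmul_zero _ _)

theorem sum_edgeOp_edgeOp (r : ℕ) (α γ : 𝒜.Vertex) (x : FreeOn (DiffOp R) (𝒱.Gen (r + 2) α)) :
    ∑ β, 𝒱.edgeOp fr R r γ β (𝒱.edgeOp fr R (r + 1) β α x) = 0 := by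
  induction x using kos_induction with
  | h0 => simp
  | hadd x y hx hy => simp [Finset.sum_add_distrib, hx, hy]
  | hkos P t w =>
    let f : 𝒱.Gen r γ →ₗ[ℂ] FreeOn (DiffOp R) (𝒱.Gen r γ) :=
      (FreeOn.equiv (DiffOp R)).toLinearMap ∘ₗ TensorProduct.mk ℂ (DiffOp R) (𝒱.Gen r γ) P
    have h : ∀ β, 𝒱.edgeOp fr R r γ β (𝒱.edgeOp fr R (r + 1) β α (kos P t w)) =
        f ((𝒱.edgeMap fr r γ β ∘ₗ 𝒱.edgeMap fr (r + 1) β α) (ExtCoef.mk t w)) := by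
      intro β
      have h1 : 𝒱.edgeOp fr R (r + 1) β α (kos P t w) =
          FreeOn.tmul (DiffOp R) P (𝒱.edgeMap fr (r + 1) β α (ExtCoef.mk t w)) :=
        extend_incl_comp_tmul _ P (ExtCoef.mk t w)
      rw [h1]
      exact extend_incl_comp_tmul _ _ _
    rw [Finset.sum_congr rfl fun β _ => h β, ← map_sum, ← LinearMap.sum_apply,
      𝒱.sum_edgeMap_comp fr, LinearMap.zero_apply, map_zero]

end

section

variable (S : Submonoid (PolyRing N)) (R : Type) [CommRing R] [Algebra ℂ R]
  [Algebra (PolyRing N) R] [IsScalarTower ℂ (PolyRing N) R] [IsLocalization S R]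

theorem symbolOp_projT {α β : 𝒜.Vertex} (h : α.Succ β) (t : α.TF) :
    symbolOp S R β ((fr.projT h).prodMap (Submodule.inclusion h.F_le) t) =
      symbolOp S R α t - ((fr.f α β).linear ∘ₗ α.T.subtype ∘ₗ LinearMap.fst ℂ α.T α.F) t •
        ((fr.pairing α β)⁻¹ • fieldOp S R (fr.ξ α β)) := by
  have h1 : ((fr.projT h).prodMap (Submodule.inclusion h.F_le) t) =
      (fr.projT h t.1, Submodule.inclusion h.F_le t.2) := rfl
  have h2 : ((fr.f α β).linear ∘ₗ α.T.subtype ∘ₗ LinearMap.fst ℂ α.T α.F) t =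
      (fr.f α β).linear (t.1 : Aff N) := rfl
  rw [h1, h2, symbolOp_apply, symbolOp_apply, EdgeFraming.projT_apply, map_sub, map_smul, smul_smul,
    Submodule.coe_inclusion, mul_comm]
  abel

theorem symbolOp_projF {α β : 𝒜.Vertex} (h : β.Succ α) (t : α.TF) :
    symbolOp S R β ((Submodule.inclusion h.T_le).prodMap (fr.projF h) t) =
      symbolOp S R α t - (pairField (fr.ξ β α) ∘ₗ α.F.subtype ∘ₗ LinearMap.snd ℂ α.T α.F) t •
        ((fr.pairing β α)⁻¹ • funOp R (fr.f β α)) := by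
  have h1 : ((Submodule.inclusion h.T_le).prodMap (fr.projF h) t) =
      (Submodule.inclusion h.T_le t.1, fr.projF h t.2) := rfl
  have h2 : (pairField (fr.ξ β α) ∘ₗ α.F.subtype ∘ₗ LinearMap.snd ℂ α.T α.F) t =
      (t.2 : AffFun N).linear (fr.ξ β α) := rfl
  rw [h1, h2, symbolOp_apply, symbolOp_apply, EdgeFraming.projF_apply, map_sub, map_smul, smul_smul,
    Submodule.coe_inclusion, mul_comm]
  abel

/-- For an edge the operator c of `dK_baseMap_add` is the framing field or function divided by the
pairing of the edge. -/
theorem dK_edgeOp_add (r : ℕ) (α β : 𝒜.Vertex) (x : FreeOn (DiffOp R) (𝒱.Gen (r + 2) α)) :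
    dK (𝒱.Coef β) (symbolOp S R β) r (𝒱.edgeOp fr R (r + 1) β α x) +
      𝒱.edgeOp fr R r β α (dK (𝒱.Coef α) (symbolOp S R α) (r + 1) x) = 0 := by
  by_cases h : α.Succ β
  · rw [edgeOp_down 𝒱 fr R h, edgeOp_down 𝒱 fr R h]
    exact LinearMap.congr_fun (dK_baseMap_add _ _ _ _ _ (symbolOp_projT fr S R h) _ r) x
  by_cases h' : β.Succ α
  · rw [edgeOp_up 𝒱 fr R h', edgeOp_up 𝒱 fr R h']
    exact LinearMap.congr_fun (dK_baseMap_add _ _ _ _ _ (symbolOp_projF fr S R h') _ r) x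
  · rw [edgeOp_eq_zero 𝒱 fr R (by tauto), edgeOp_eq_zero 𝒱 fr R (by tauto)]
    simp

theorem d_lof (r : ℕ) (α : 𝒜.Vertex) (x : FreeOn (DiffOp R) (𝒱.Gen (r + 1) α)) :
    𝒱.d fr S R r
        (DirectSum.lof (DiffOp R) 𝒜.Vertex (fun α => FreeOn (DiffOp R) (𝒱.Gen (r + 1) α)) α x) =
      DirectSum.lof (DiffOp R) 𝒜.Vertex (fun α => FreeOn (DiffOp R) (𝒱.Gen r α)) α
        (dK (𝒱.Coef α) (symbolOp S R α) r x) -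
      ∑ β, DirectSum.lof (DiffOp R) 𝒜.Vertex (fun α => FreeOn (DiffOp R) (𝒱.Gen r α)) β
        (𝒱.edgeOp fr R r β α x) := by
  rw [d, LinearMap.sub_apply, d₁, d₀, DirectSum.toModule_lof, DirectSum.toModule_lof,
    LinearMap.sum_apply]
  rfl

theorem d_apply (r : ℕ) (x : 𝒱.Res R (r + 1)) (β : 𝒜.Vertex) : 𝒱.d fr S R r x β =
    dK (𝒱.Coef β) (symbolOp S R β) r (x β) - ∑ α, 𝒱.edgeOp fr R r β α (x α) := by
  induction x using DirectSum.induction_on with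
  | zero => simp
  | add x y hx hy =>
    rw [map_add, DirectSum.add_apply, hx, hy, DirectSum.add_apply, map_add]
    simp only [DirectSum.add_apply, map_add, Finset.sum_add_distrib]
    abel
  | of α x =>
    have h := congrArg (fun y => y β) (𝒱.d_lof fr S R r α x)
    refine h.trans ?_
    change _ = dK (𝒱.Coef β) (symbolOp S R β) r ((DirectSum.lof (DiffOp R) 𝒜.Vertex
      (fun α => FreeOn (DiffOp R) (𝒱.Gen (r + 1) α)) α x) β) -
      ∑ γ, 𝒱.edgeOp fr R r β γ ((DirectSum.lof (DiffOp R) 𝒜.Vertex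
      (fun α => FreeOn (DiffOp R) (𝒱.Gen (r + 1) α)) α x) γ)
    have h1 : ∑ γ, 𝒱.edgeOp fr R r β γ ((DirectSum.lof (DiffOp R) 𝒜.Vertex
        (fun α => FreeOn (DiffOp R) (𝒱.Gen (r + 1) α)) α x) γ) = 𝒱.edgeOp fr R r β α x := by
      rw [Finset.sum_eq_single α (fun γ _ hγ => by rw [component_lof_ne hγ.symm, map_zero])
        (by simp), component_lof]
    rw [h1, DirectSum.sub_apply, DirectSum.sum_apply, Finset.sum_eq_single β
        (fun γ _ hγ => component_lof_ne hγ _) (by simp), component_lof]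
    congr 1
    by_cases hα : α = β
    · subst hα
      rw [component_lof, component_lof]
    · rw [component_lof_ne hα, component_lof_ne hα, map_zero]

theorem d_d (r : ℕ) (x : 𝒱.Res R (r + 2)) : 𝒱.d fr S R r (𝒱.d fr S R (r + 1) x) = 0 := by
  refine DFinsupp.ext fun γ => ?_
  have h1 := LinearMap.congr_fun (dK_comp_dK (W := 𝒱.Coef γ) (symbolOp S R γ)
    (symbolOp_comm S R γ) r) (x γ)
  rw [LinearMap.comp_apply, LinearMap.zero_apply] at h1
  have h2 : ∑ α, ∑ β, 𝒱.edgeOp fr R r γ β (𝒱.edgeOp fr R (r + 1) β α (x α)) = 0 :=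
    Finset.sum_eq_zero fun α _ => 𝒱.sum_edgeOp_edgeOp fr R r α γ (x α)
  have h3 : ∑ α, (dK (𝒱.Coef γ) (symbolOp S R γ) r (𝒱.edgeOp fr R (r + 1) γ α (x α)) +
      𝒱.edgeOp fr R r γ α (dK (𝒱.Coef α) (symbolOp S R α) (r + 1) (x α))) = 0 :=
    Finset.sum_eq_zero fun α _ => 𝒱.dK_edgeOp_add fr S R r α γ (x α)
  rw [Finset.sum_add_distrib] at h3
  rw [Finset.sum_comm] at h2
  refine (𝒱.d_apply fr S R r _ γ).trans ?_
  simp only [d_apply, map_sub, map_sum, Finset.sum_sub_distrib, h1, h2]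
  rw [zero_sub, sub_zero, ← neg_add', h3, neg_zero]
  rfl

end

end ArrQuiver

end QuiverD

/-! ### The filtration of the complex and exactness in positive degrees. -/

namespace QuiverD

open Arrangement

theorem isUnit_mulOp {N : ℕ} (S : Submonoid (PolyRing N)) {R : Type} [CommRing R] [Algebra ℂ R]
    [Algebra (PolyRing N) R] [IsLocalization S R] {s : PolyRing N} (hs : s ∈ S) :
    IsUnit (mulOp R (algebraMap (PolyRing N) R s)) :=
  (IsLocalization.map_units R (⟨s, hs⟩ : S)).map (mulOp R)

/-! ### The filtration of the complex and its exactness -/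

namespace KoszulFrame

variable {D : Type} [Ring D] [Algebra ℂ D] {M M' : Type} [AddCommGroup M] [Module ℂ M]
  [AddCommGroup M'] [Module ℂ M'] {ι ι' : Type} [Fintype ι] [Fintype ι'] (K : KoszulFrame D M ι)
  (K' : KoszulFrame D M' ι') {W W' : Type v} [AddCommGroup W] [Module ℂ W] [AddCommGroup W']
  [Module ℂ W']

theorem baseMap_contract_mem_kFil (hFil : K'.Fil = K.Fil) (φ : M →ₗ[ℂ] ℂ) (p : M →ₗ[ℂ] M')
    (hp : ∀ t ∈ K.M₀, p t ∈ K'.M₀) (g : W →ₗ[ℂ] W') {r k : ℕ}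
    {x : FreeOn D (ExtCoef M W (r + 1))} (hx : x ∈ K.kFil W (r + 1) k) :
    baseMap (contract φ p r) g x ∈ K'.kFil W' r k := by
  refine K.kFil_le_comap K' ((baseMap (contract φ p r) g).restrictScalars ℂ)
    (fun j n P t w hP ht hk => ?_) hx
  rw [LinearMap.restrictScalars_apply, baseMap_contract_kos]
  refine Submodule.sum_mem _ fun i _ => ?_
  rw [← Int.cast_smul_eq_zsmul ℂ]
  refine Submodule.smul_mem _ _ (Submodule.smul_mem _ _ ?_)
  rw [Fin.sum_univ_succAbove n i] at hk
  refine K'.kos_mem_kFil (i.removeNth n) _ (hFil ▸ hP) (fun l hl => hp _ (ht _ hl)) ?_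
  refine le_trans ?_ hk
  exact Nat.add_le_add_left (Nat.le_add_left _ _) _

/-- A form that kills `M₀` can only remove a vector of weight at least one, so the level drops. -/
theorem baseMap_contract_mem_kFil_pred (hFil : K'.Fil = K.Fil) (φ : M →ₗ[ℂ] ℂ)
    (hφ : ∀ t ∈ K.M₀, φ t = 0) (p : M →ₗ[ℂ] M') (hp : ∀ t ∈ K.M₀, p t ∈ K'.M₀) (g : W →ₗ[ℂ] W')
    {r k : ℕ} {x : FreeOn D (ExtCoef M W (r + 1))} (hx : x ∈ K.kFil W (r + 1) k) :
    baseMap (contract φ p r) g x ∈ K'.kFil W' r (k - 1) := by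
  refine K.kFil_le_comap K' ((baseMap (contract φ p r) g).restrictScalars ℂ)
    (fun j n P t w hP ht hk => ?_) hx
  rw [LinearMap.restrictScalars_apply, baseMap_contract_kos]
  refine Submodule.sum_mem _ fun i _ => ?_
  by_cases hi : n i = 0
  · rw [hφ _ (ht i hi), zero_smul, smul_zero]
    exact Submodule.zero_mem _
  rw [← Int.cast_smul_eq_zsmul ℂ]
  refine Submodule.smul_mem _ _ (Submodule.smul_mem _ _ ?_)
  rw [Fin.sum_univ_succAbove n i] at hk
  refine K'.kos_mem_kFil (i.removeNth n) _ (hFil ▸ hP) (fun l hl => hp _ (ht _ hl)) ?_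
  change j + ∑ l, n (i.succAbove l) ≤ k - 1
  omega

end KoszulFrame

namespace ArrQuiver

variable {N : ℕ} {𝒜 : Arrangement N} (𝒱 : ArrQuiver.{v} 𝒜) (fr : EdgeFraming 𝒜)
  (S : Submonoid (PolyRing N)) (R : Type) [CommRing R] [Algebra ℂ R]
  [Algebra (PolyRing N) R] [IsScalarTower ℂ (PolyRing N) R] [IsLocalization S R]

/-- The weight of the summand of `α` in the `w`-th step of the filtration. -/
def weight (w : ℕ) (α : 𝒜.Vertex) : ℕ := (w + α.dim - N) / 2

/-- The `w`-th step of the filtration of the complex. -/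
def Bounded (w : ℕ) {r : ℕ} (x : 𝒱.Res R r) : Prop :=
  ∀ α, x α ∈ (frame S R α).kFil (𝒱.Coef α) r (weight w α)

variable {S R}

/-- Downwards, a vector field is removed and the dimension falls by one; upwards, the level does not
rise and the dimension grows by one. With half of w + dim as the bound, both cost exactly one unit
of w. -/
theorem edgeOp_mem_kFil {r w : ℕ} {α β : 𝒜.Vertex} {x : FreeOn (DiffOp R) (𝒱.Gen (r + 1) α)}
    (hx : x ∈ (frame S R α).kFil (𝒱.Coef α) (r + 1) (weight (w + 1) α)) :
    𝒱.edgeOp fr R r β α x ∈ (frame S R β).kFil (𝒱.Coef β) r (weight w β) := by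
  by_cases h : α.Succ β
  · rw [edgeOp_down 𝒱 fr R h]
    have hd := h.2
    refine (frame S R β).kFil_mono (k := weight (w + 1) α - 1) (by unfold weight; omega) ?_
    refine (frame S R α).baseMap_contract_mem_kFil_pred (frame S R β) rfl _ (fun t ht => ?_) _
      (fun t ht => ?_) _ hx
    · have h0 : t.1 = 0 := ht
      change (fr.f α β).linear (t.1 : Aff N) = 0
      rw [h0, Submodule.coe_zero, map_zero]
    · have h0 : t.1 = 0 := ht
      change fr.projT h t.1 = 0
      rw [h0, map_zero]
  by_cases h' : β.Succ α
  · rw [edgeOp_up 𝒱 fr R h']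
    have hd := h'.2
    refine (frame S R β).kFil_mono (k := weight (w + 1) α) (by unfold weight; omega) ?_
    refine (frame S R α).baseMap_contract_mem_kFil (frame S R β) rfl _ _ (fun t ht => ?_) _ hx
    have h0 : t.1 = 0 := ht
    change Submodule.inclusion h'.T_le t.1 = 0
    rw [h0, map_zero]
  · rw [edgeOp_eq_zero 𝒱 fr R (by tauto)]
    exact Submodule.zero_mem _

/-- In a cycle, d₁ of each component equals a sum of d₀ terms and so lies one step lower in w.
Filtered exactness of d₁ then corrects each component by a boundary, and the d₀ part of that
boundary again lies one step lower. -/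
theorem exists_d_eq_of_bounded (w : ℕ) {r : ℕ} (x : 𝒱.Res R (r + 1)) (hx : 𝒱.Bounded S R w x)
    (hdx : 𝒱.d fr S R r x = 0) : ∃ y, 𝒱.d fr S R (r + 1) y = x := by
  induction w generalizing x with
  | zero =>
    refine ⟨0, ?_⟩
    rw [map_zero]
    refine DFinsupp.ext fun α => ?_
    -- The dimension is at most N, so the truncated difference is zero at w = 0, where the
    -- filtration is zero.
    have h : weight 0 α = 0 := by
      have := α.dim_le
      unfold weight
      omega
    have h1 := hx α
    rw [h, KoszulFrame.kFil_zero, Submodule.mem_bot] at h1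
    exact h1.symm
  | succ w ih =>
    have hy : ∀ α, ∃ y ∈ (frame S R α).kFil (𝒱.Coef α) (r + 2) (weight (w + 1) α),
        x α - dK (𝒱.Coef α) (symbolOp S R α) (r + 1) y ∈
          (frame S R α).kFil (𝒱.Coef α) (r + 1) (weight w α) := by
      intro α
      -- Because of the halving the level on a given stratum moves at most by one; if it does not
      -- move, no correction is needed there.
      have h : weight (w + 1) α = weight w α ∨ weight (w + 1) α = weight w α + 1 := by
        unfold weight
        omega
      obtain h | h := h
      · refine ⟨0, Submodule.zero_mem _, ?_⟩
        rw [map_zero, sub_zero, ← h]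
        exact hx α
      · have h1 := hx α
        rw [h] at h1 ⊢
        refine (frame S R α).exists_sub_d_mem_kFil h1 ?_
        have h2 := congrArg (fun z => z α) hdx
        have h3 : dK (𝒱.Coef α) (symbolOp S R α) r (x α) =
            ∑ β, 𝒱.edgeOp fr R r α β (x β) :=
          sub_eq_zero.1 ((𝒱.d_apply fr S R r x α).symm.trans h2)
        refine (congrArg (· ∈ (frame S R α).kFil (𝒱.Coef α) r (weight w α)) h3).mpr ?_
        exact Submodule.sum_mem _ fun β _ => 𝒱.edgeOp_mem_kFil fr (hx β)
    choose y hy hxy using hy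
    let z : 𝒱.Res R (r + 2) := (DirectSum.linearEquivFunOnFintype (DiffOp R) 𝒜.Vertex
      (fun α => FreeOn (DiffOp R) (𝒱.Gen (r + 2) α))).symm y
    have hz : ∀ α, z α = y α := fun α => congrFun ((DirectSum.linearEquivFunOnFintype (DiffOp R)
      𝒜.Vertex (fun α => FreeOn (DiffOp R) (𝒱.Gen (r + 2) α))).apply_symm_apply y) α
    have hb : 𝒱.Bounded S R w (x - 𝒱.d fr S R (r + 1) z) := by
      intro α
      rw [DirectSum.sub_apply, d_apply, ← sub_add, hz]
      refine Submodule.add_mem _ (hxy α) (Submodule.sum_mem _ fun β _ => ?_)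
      refine 𝒱.edgeOp_mem_kFil fr ?_
      rw [hz]
      exact hy β
    obtain ⟨u, hu⟩ := ih _ hb (by rw [map_sub, hdx, d_d, sub_zero])
    exact ⟨u + z, by rw [map_add, hu, sub_add_cancel]⟩

theorem Bounded.mono {w w' r : ℕ} (h : w ≤ w') {x : 𝒱.Res R r} (hx : 𝒱.Bounded S R w x) :
    𝒱.Bounded S R w' x := fun α =>
  (frame S R α).kFil_mono (by unfold weight; omega) (hx α)

theorem Bounded.add {w r : ℕ} {x y : 𝒱.Res R r} (hx : 𝒱.Bounded S R w x)
    (hy : 𝒱.Bounded S R w y) : 𝒱.Bounded S R w (x + y) := fun α => by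
  rw [DirectSum.add_apply]
  exact Submodule.add_mem _ (hx α) (hy α)

variable (S)

/-- The extra polynomial factor p lets denominators be combined: for a sum with denominators s and t
the product s t serves, each summand using the other denominator as part of its p. -/
theorem exists_bounded {r : ℕ} (x : 𝒱.Res R r) : ∃ s ∈ S, ∀ p : PolyRing N, ∃ w, 𝒱.Bounded S R w
    (mulOp R (algebraMap (PolyRing N) R (p * s)) • x) := by
  have hzero : ∃ s ∈ S, ∀ p : PolyRing N, ∃ w, 𝒱.Bounded S R w
      (mulOp R (algebraMap (PolyRing N) R (p * s)) • (0 : 𝒱.Res R r)) :=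
    ⟨1, S.one_mem, fun p => ⟨0, fun α => by
      rw [smul_zero]
      exact Submodule.zero_mem _⟩⟩
  have hadd : ∀ x y : 𝒱.Res R r,
      (∃ s ∈ S, ∀ p : PolyRing N, ∃ w, 𝒱.Bounded S R w
        (mulOp R (algebraMap (PolyRing N) R (p * s)) • x)) →
      (∃ s ∈ S, ∀ p : PolyRing N, ∃ w, 𝒱.Bounded S R w
        (mulOp R (algebraMap (PolyRing N) R (p * s)) • y)) →
      ∃ s ∈ S, ∀ p : PolyRing N, ∃ w, 𝒱.Bounded S R w
        (mulOp R (algebraMap (PolyRing N) R (p * s)) • (x + y)) := by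
    rintro x y ⟨s, hs, hx⟩ ⟨t, ht, hy⟩
    refine ⟨s * t, S.mul_mem hs ht, fun p => ?_⟩
    obtain ⟨w, hw⟩ := hx (p * t)
    obtain ⟨w', hw'⟩ := hy (p * s)
    refine ⟨max w w', ?_⟩
    rw [smul_add]
    refine Bounded.add 𝒱 ?_ ?_
    · rw [mul_comm s t, ← mul_assoc]
      exact hw.mono 𝒱 (le_max_left _ _)
    · rw [← mul_assoc]
      exact hw'.mono 𝒱 (le_max_right _ _)
  induction x using DirectSum.induction_on with
  | zero => exact hzero
  | add x y hx hy => exact hadd x y hx hy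
  | of α x =>
    change ∃ s ∈ S, ∀ p : PolyRing N, ∃ w, 𝒱.Bounded S R w
      (mulOp R (algebraMap (PolyRing N) R (p * s)) • DirectSum.lof (DiffOp R) 𝒜.Vertex
        (fun α => FreeOn (DiffOp R) (𝒱.Gen r α)) α x)
    induction x using kos_induction with
    | h0 =>
      rw [map_zero]
      exact hzero
    | hadd x y hx hy =>
      rw [map_add]
      exact hadd _ _ hx hy
    | hkos P t w =>
      obtain ⟨s, hs, hP⟩ := exists_smul_mem_polyOp S R P
      refine ⟨s, hs, fun p => ?_⟩
      obtain ⟨k, hk⟩ := exists_mem_ordFil S ((polyOp S R).mul_mem (mulOp_mem S R p) hP)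
      -- With this w the weight on every stratum is at least k + r: operator level k, plus one for
      -- each of the r exterior factors.
      refine ⟨2 * (k + r) + N, fun β => ?_⟩
      rw [← map_smul, smul_kos, map_mul, map_mul, mul_assoc]
      by_cases hβ : α = β
      · subst hβ
        rw [component_lof]
        exact (frame S R α).kFil_mono (by unfold weight; omega)
          ((frame S R α).kos_mem_kFil_add t w hk)
      · rw [component_lof_ne hβ]
        exact Submodule.zero_mem _

variable (R)

/-- A cycle multiplied by s has polynomial coefficients and is a boundary; s is a unit of `DiffOp R`
and d is linear over it, so the cycle is a boundary too. -/
theorem exact_d_d (r : ℕ) : Function.Exact (𝒱.d fr S R (r + 1)) (𝒱.d fr S R r) := by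
  intro x
  refine ⟨fun hx => ?_, ?_⟩
  · obtain ⟨s, hs, h⟩ := 𝒱.exists_bounded S x
    obtain ⟨w, hw⟩ := h 1
    rw [one_mul] at hw
    obtain ⟨y, hy⟩ := 𝒱.exists_d_eq_of_bounded fr w _ hw (by rw [map_smul, hx, smul_zero])
    obtain ⟨u, hu⟩ := isUnit_mulOp S (R := R) hs
    refine ⟨(↑u⁻¹ : DiffOp R) • y, ?_⟩
    rw [map_smul, hy, ← hu, smul_smul, Units.inv_mul, one_smul]
  · rintro ⟨y, rfl⟩
    exact 𝒱.d_d fr S R r y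

end ArrQuiver

end QuiverD

/-! ### The degree zero term, freeness, finiteness and length. -/

namespace QuiverD

open Arrangement

/-! ### The degree zero term and the quiver `D`-module -/

/-- The identification of `⋀^0 M ⊗ W` with `W`. -/
def ExtCoef.zeroEquiv (M : Type) [AddCommGroup M] [Module ℂ M] (W : Type v) [AddCommGroup W]
    [Module ℂ W] : ExtCoef M W 0 ≃ₗ[ℂ] W :=
  (ExtCoef.equiv M W 0).symm ≪≫ₗ (exteriorPower.zeroEquiv ℂ M).rTensor W ≪≫ₗ TensorProduct.lid ℂ W

theorem ExtCoef.zeroEquiv_apply {M : Type} [AddCommGroup M] [Module ℂ M] {W : Type v}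
    [AddCommGroup W] [Module ℂ W] (x : ExtCoef M W 0) :
    ExtCoef.zeroEquiv M W x = ExtCoef.ofZero x := rfl

theorem FreeOn.induction_on {D : Type} [Ring D] [Algebra ℂ D] {G : Type v} [AddCommGroup G]
    [Module ℂ G] {p : FreeOn D G → Prop} (h0 : p 0) (hadd : ∀ x y, p x → p y → p (x + y))
    (htmul : ∀ P g, p (FreeOn.tmul D P g)) (x : FreeOn D G) : p x :=
  TensorProduct.induction_on x h0 htmul hadd

namespace ArrQuiver

variable {N : ℕ} {𝒜 : Arrangement N} (𝒱 : ArrQuiver.{v} 𝒜) (fr : EdgeFraming 𝒜)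

variable {𝒱} in
theorem coef_induction {α : 𝒜.Vertex} {p : 𝒱.Coef α → Prop} (h0 : p 0)
    (hadd : ∀ x y, p x → p y → p (x + y)) (hcoef : ∀ ω v, p (coef ω v)) (x : 𝒱.Coef α) : p x :=
  TensorProduct.induction_on x h0 hcoef hadd

section

variable (R : Type) [CommRing R] [Algebra ℂ R]

/-- The identification of the degree zero term with the free module of which the quiver `D`-module
is a quotient. -/
def resZero : 𝒱.Res R 0 →ₗ[DiffOp R] 𝒱.FreeMod R :=
  DirectSum.toModule (DiffOp R) 𝒜.Vertex _ fun α =>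
    DirectSum.lof (DiffOp R) 𝒜.Vertex (fun α => FreeOn (DiffOp R) (𝒱.Coef α)) α ∘ₗ
      FreeOn.extend (DiffOp R) (FreeOn.incl (DiffOp R) ∘ₗ ExtCoef.ofZero)

/-- The inverse of the identification of the degree zero term. -/
def resZeroInv : 𝒱.FreeMod R →ₗ[DiffOp R] 𝒱.Res R 0 :=
  DirectSum.toModule (DiffOp R) 𝒜.Vertex _ fun α =>
    DirectSum.lof (DiffOp R) 𝒜.Vertex (fun α => FreeOn (DiffOp R) (𝒱.Gen 0 α)) α ∘ₗ
      FreeOn.extend (DiffOp R) (FreeOn.incl (DiffOp R) ∘ₗ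
        ((ExtCoef.zeroEquiv α.TF (𝒱.Coef α)).symm : 𝒱.Coef α →ₗ[ℂ] 𝒱.Gen 0 α))

theorem resZero_kos (α : 𝒜.Vertex) (P : DiffOp R) (t : Fin 0 → α.TF) (w : 𝒱.Coef α) :
    𝒱.resZero R (DirectSum.lof (DiffOp R) 𝒜.Vertex (fun α => FreeOn (DiffOp R) (𝒱.Gen 0 α)) α
      (kos P t w)) = DirectSum.lof (DiffOp R) 𝒜.Vertex (fun α => FreeOn (DiffOp R) (𝒱.Coef α)) α
        (FreeOn.tmul (DiffOp R) P w) := by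
  have h := extend_incl_comp_tmul (ExtCoef.ofZero (M := α.TF) (W := 𝒱.Coef α)) P (ExtCoef.mk t w)
  rw [ExtCoef.ofZero_mk] at h
  rw [resZero, DirectSum.toModule_lof, LinearMap.comp_apply]
  exact congrArg _ h

theorem resZeroInv_tmul (α : 𝒜.Vertex) (P : DiffOp R) (t : Fin 0 → α.TF) (w : 𝒱.Coef α) :
    𝒱.resZeroInv R (DirectSum.lof (DiffOp R) 𝒜.Vertex (fun α => FreeOn (DiffOp R) (𝒱.Coef α)) α
      (FreeOn.tmul (DiffOp R) P w)) = DirectSum.lof (DiffOp R) 𝒜.Vertex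
        (fun α => FreeOn (DiffOp R) (𝒱.Gen 0 α)) α (kos P t w) := by
  have h := extend_incl_comp_tmul ((ExtCoef.zeroEquiv α.TF (𝒱.Coef α)).symm :
    𝒱.Coef α →ₗ[ℂ] 𝒱.Gen 0 α) P w
  have h1 : (ExtCoef.zeroEquiv α.TF (𝒱.Coef α)).symm w = ExtCoef.mk t w := by
    rw [LinearEquiv.symm_apply_eq, ExtCoef.zeroEquiv_apply, ExtCoef.ofZero_mk]
  rw [LinearEquiv.coe_coe, h1] at h
  rw [resZeroInv, DirectSum.toModule_lof, LinearMap.comp_apply]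
  exact congrArg _ h

theorem resZeroInv_comp : 𝒱.resZeroInv R ∘ₗ 𝒱.resZero R = LinearMap.id := by
  refine DirectSum.linearMap_ext (DiffOp R) fun α => hom_ext_kos' fun t w => ?_
  rw [LinearMap.comp_apply, LinearMap.comp_apply, resZero_kos, resZeroInv_tmul 𝒱 R α 1 t]
  rfl

theorem resZero_comp : 𝒱.resZero R ∘ₗ 𝒱.resZeroInv R = LinearMap.id := by
  refine LinearMap.ext fun x => ?_
  induction x using DirectSum.induction_on with
  | zero => rw [map_zero, map_zero]
  | add x y hx hy => rw [map_add, map_add, hx, hy]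
  | of α x =>
    change (𝒱.resZero R ∘ₗ 𝒱.resZeroInv R) (DirectSum.lof (DiffOp R) 𝒜.Vertex
      (fun α => FreeOn (DiffOp R) (𝒱.Coef α)) α x) = DirectSum.lof (DiffOp R) 𝒜.Vertex
      (fun α => FreeOn (DiffOp R) (𝒱.Coef α)) α x
    induction x using FreeOn.induction_on with
    | h0 => rw [map_zero, map_zero]
    | hadd x y hx hy => rw [map_add, map_add, hx, hy]
    | htmul P w => rw [LinearMap.comp_apply, resZeroInv_tmul 𝒱 R α P Fin.elim0, resZero_kos]

theorem resZero_injective : Function.Injective (𝒱.resZero R) :=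
  Function.LeftInverse.injective (g := 𝒱.resZeroInv R)
    (LinearMap.congr_fun (𝒱.resZeroInv_comp R))

theorem resZero_surjective : Function.Surjective (𝒱.resZero R) :=
  Function.RightInverse.surjective (g := 𝒱.resZeroInv R)
    (LinearMap.congr_fun (𝒱.resZero_comp R))

theorem resZero_edgeOp (α β : 𝒜.Vertex) (t : Fin 1 → α.TF) (ω : α.Ω) (v : 𝒱.V α) :
    open Classical in
    𝒱.resZero R (DirectSum.lof (DiffOp R) 𝒜.Vertex (fun α => FreeOn (DiffOp R) (𝒱.Gen 0 α)) β
      (𝒱.edgeOp fr R 0 β α (kos 1 t (coef ω v)))) =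
      (if h : α.Succ β then
        (fr.f α β).linear ((t 0).1 : Aff N) • 𝒱.gen R β 1 (fr.piDown h ω) (𝒱.A β α v) else 0) +
      (if h : β.Succ α then
        ((t 0).2 : AffFun N).linear (fr.ξ β α) • 𝒱.gen R β 1 (fr.piUp h ω) (𝒱.A β α v)
        else 0) := by
  by_cases h : α.Succ β
  · rw [dif_pos h, dif_neg h.not_succ, add_zero, edgeOp_down 𝒱 fr R h, EdgeFraming.contractDown,
      baseMap_contract_kos, Fin.sum_univ_one, Fin.val_zero, pow_zero, one_smul,
      LinearMap.map_smul_of_tower, LinearMap.map_smul_of_tower, resZero_kos]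
    rfl
  by_cases h' : β.Succ α
  · rw [dif_pos h', dif_neg h]
    refine Eq.trans ?_ (zero_add _).symm
    rw [edgeOp_up 𝒱 fr R h', EdgeFraming.contractUp,
      baseMap_contract_kos, Fin.sum_univ_one, Fin.val_zero, pow_zero, one_smul,
      LinearMap.map_smul_of_tower, LinearMap.map_smul_of_tower, resZero_kos]
    rfl
  · rw [dif_neg h, dif_neg h', edgeOp_eq_zero 𝒱 fr R (by tauto), LinearMap.zero_apply, map_zero,
      map_zero, add_zero]

end

section

variable (S : Submonoid (PolyRing N)) (R : Type) [CommRing R] [Algebra ℂ R]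
  [Algebra (PolyRing N) R] [IsScalarTower ℂ (PolyRing N) R] [IsLocalization S R]

theorem ν_eq : 𝒱.ν fr S R = (𝒱.relations fr S R).mkQ ∘ₗ 𝒱.resZero R := rfl

open Classical in
/-- The relation attached to a constant vector field along a stratum. -/
def relT (α : 𝒜.Vertex) (ξ : α.T) (ω : α.Ω) (v : 𝒱.V α) : 𝒱.FreeMod R :=
  𝒱.gen R α (fieldOp S R (ξ : Aff N)) ω v - ∑ β : 𝒜.Vertex,
    if h : α.Succ β then
      (fr.f α β).linear (ξ : Aff N) • 𝒱.gen R β 1 (fr.piDown h ω) (𝒱.A β α v)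
    else 0

open Classical in
/-- The relation attached to an affine function which vanishes on a stratum. -/
def relF (α : 𝒜.Vertex) (f : α.F) (ω : α.Ω) (v : 𝒱.V α) : 𝒱.FreeMod R :=
  𝒱.gen R α (funOp R (f : AffFun N)) ω v - ∑ β : 𝒜.Vertex,
    if h : β.Succ α then
      (f : AffFun N).linear (fr.ξ β α) • 𝒱.gen R β 1 (fr.piUp h ω) (𝒱.A β α v)
    else 0

/-- In degree one d₁ gives the leading terms and d₀ the sums over edges of the two defining
relations, one for each component of t = (ξ, f). -/
theorem resZero_d_kos (α : 𝒜.Vertex) (t : Fin 1 → α.TF) (ω : α.Ω) (v : 𝒱.V α) :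
    𝒱.resZero R (𝒱.d fr S R 0 (DirectSum.lof (DiffOp R) 𝒜.Vertex
      (fun α => FreeOn (DiffOp R) (𝒱.Gen 1 α)) α (kos 1 t (coef ω v)))) =
      𝒱.relT fr S R α (t 0).1 ω v + 𝒱.relF fr R α (t 0).2 ω v := by
  classical
  have h1 : 𝒱.gen R α (symbolOp S R α (t 0)) ω v =
      𝒱.gen R α (fieldOp S R ((t 0).1 : Aff N)) ω v +
        𝒱.gen R α (funOp R ((t 0).2 : AffFun N)) ω v := by
    rw [symbolOp_apply, gen, gen, gen, ← map_add]
    exact congrArg _ (TensorProduct.add_tmul _ _ _)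
  have h2 := dK_kos (symbolOp S R α) 0 1 t (coef ω v)
  rw [Fin.sum_univ_one, Fin.val_zero, pow_zero, one_smul, one_mul] at h2
  have h3 : ∀ P, 𝒱.gen R α P ω v = DirectSum.lof (DiffOp R) 𝒜.Vertex
      (fun α => FreeOn (DiffOp R) (𝒱.Coef α)) α (FreeOn.tmul (DiffOp R) P (coef ω v)) :=
    fun P => rfl
  rw [d_lof, h2, map_sub, resZero_kos, ← h3, h1, map_sum,
    Finset.sum_congr rfl fun β _ => 𝒱.resZero_edgeOp fr R α β t ω v, Finset.sum_add_distrib, relT,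
    relF]
  abel

theorem relT_zero (α : 𝒜.Vertex) (ω : α.Ω) (v : 𝒱.V α) : 𝒱.relT fr S R α 0 ω v = 0 := by
  have h : 𝒱.gen R α 0 ω v = 0 :=
    (congrArg _ (TensorProduct.zero_tmul _ _)).trans (map_zero _)
  rw [relT, Submodule.coe_zero, map_zero, h, zero_sub, neg_eq_zero]
  refine Finset.sum_eq_zero fun β _ => ?_
  rw [map_zero]
  split <;> simp

theorem relF_zero (α : 𝒜.Vertex) (ω : α.Ω) (v : 𝒱.V α) : 𝒱.relF fr R α 0 ω v = 0 := by
  have h : 𝒱.gen R α 0 ω v = 0 :=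
    (congrArg _ (TensorProduct.zero_tmul _ _)).trans (map_zero _)
  rw [relF, Submodule.coe_zero, map_zero, h, zero_sub, neg_eq_zero]
  refine Finset.sum_eq_zero fun β _ => ?_
  rw [AffineMap.zero_linear, LinearMap.zero_apply]
  split <;> simp

theorem relT_mem (α : 𝒜.Vertex) (ξ : α.T) (ω : α.Ω) (v : 𝒱.V α) :
    𝒱.relT fr S R α ξ ω v ∈ 𝒱.relations fr S R :=
  Submodule.subset_span (Or.inl ⟨α, ξ, ω, v, rfl⟩)

theorem relF_mem (α : 𝒜.Vertex) (f : α.F) (ω : α.Ω) (v : 𝒱.V α) :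
    𝒱.relF fr R α f ω v ∈ 𝒱.relations fr S R :=
  Submodule.subset_span (Or.inr ⟨α, f, ω, v, rfl⟩)

/-- Taking t = (ξ, 0) or (0, f) isolates each defining relation; conversely d of any generator is a
sum of one relation of each kind. -/
theorem relations_eq : 𝒱.relations fr S R =
    LinearMap.range (𝒱.resZero R ∘ₗ 𝒱.d fr S R 0) := by
  refine le_antisymm (Submodule.span_le.2 ?_) ?_
  · rintro _ (⟨α, ξ, ω, v, rfl⟩ | ⟨α, f, ω, v, rfl⟩)
    · refine ⟨_, (𝒱.resZero_d_kos fr S R α (fun _ => (ξ, 0)) ω v).trans ?_⟩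
      rw [relF_zero, add_zero]
      rfl
    · refine ⟨_, (𝒱.resZero_d_kos fr S R α (fun _ => (0, f)) ω v).trans ?_⟩
      rw [relT_zero, zero_add]
      rfl
  · rintro _ ⟨x, rfl⟩
    induction x using DirectSum.induction_on with
    | zero =>
      rw [map_zero]
      exact Submodule.zero_mem _
    | add x y hx hy =>
      rw [map_add]
      exact Submodule.add_mem _ hx hy
    | of α x =>
      change (𝒱.resZero R ∘ₗ 𝒱.d fr S R 0) (DirectSum.lof (DiffOp R) 𝒜.Vertex
        (fun α => FreeOn (DiffOp R) (𝒱.Gen 1 α)) α x) ∈ _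
      induction x using kos_induction with
      | h0 =>
        rw [map_zero, map_zero]
        exact Submodule.zero_mem _
      | hadd x y hx hy =>
        rw [map_add, map_add]
        exact Submodule.add_mem _ hx hy
      | hkos P t w =>
        rw [kos_eq_smul, map_smul, map_smul]
        refine Submodule.smul_mem _ P ?_
        induction w using coef_induction with
        | h0 =>
          have h : kos (1 : DiffOp R) t (0 : 𝒱.Coef α) = 0 := map_zero _
          rw [h, map_zero, map_zero]
          exact Submodule.zero_mem _
        | hadd w w' hw hw' =>
          have h : kos (1 : DiffOp R) t (w + w' : 𝒱.Coef α) = kos 1 t w + kos 1 t w' :=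
            map_add _ _ _
          rw [h, map_add, map_add]
          exact Submodule.add_mem _ hw hw'
        | hcoef ω v =>
          have h := 𝒱.resZero_d_kos fr S R α t ω v
          rw [LinearMap.comp_apply, h]
          exact Submodule.add_mem _ (𝒱.relT_mem fr S R α _ ω v) (𝒱.relF_mem fr S R α _ ω v)

theorem exact_d_ν : Function.Exact (𝒱.d fr S R 0) (𝒱.ν fr S R) := by
  intro x
  rw [ν_eq, LinearMap.comp_apply, Submodule.mkQ_apply, Submodule.Quotient.mk_eq_zero,
    relations_eq]
  refine ⟨fun ⟨y, hy⟩ => ⟨y, 𝒱.resZero_injective R hy⟩, ?_⟩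
  rintro ⟨y, rfl⟩
  exact ⟨y, rfl⟩

theorem ν_surjective : Function.Surjective (𝒱.ν fr S R) :=
  (Submodule.mkQ_surjective _).comp (𝒱.resZero_surjective R)

end

/-! ### The terms of the complex -/

section

instance (α : 𝒜.Vertex) : FiniteDimensional ℂ α.Ω :=
  let b : Module.Basis (Fin α.dim) ℂ α.T := Module.finBasis ℂ α.T
  Module.Finite.of_injective
    ({ toFun := fun ω => ω b
       map_add' := fun _ _ => rfl
       map_smul' := fun _ _ => rfl } : α.Ω →ₗ[ℂ] ℂ) fun ω ω' h => by
    rw [ω.eq_smul_basis_det b, ω'.eq_smul_basis_det b]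
    exact congrArg (· • b.det) h

instance (α : 𝒜.Vertex) : FiniteDimensional ℂ (𝒱.Coef α) :=
  inferInstanceAs (FiniteDimensional ℂ (α.Ω ⊗[ℂ] 𝒱.V α))

instance (r : ℕ) (α : 𝒜.Vertex) : FiniteDimensional ℂ (𝒱.Gen r α) :=
  inferInstanceAs (FiniteDimensional ℂ (⋀[ℂ]^r α.TF ⊗[ℂ] 𝒱.Coef α))

variable (R : Type) [CommRing R] [Algebra ℂ R]

instance (r : ℕ) (α : 𝒜.Vertex) : Module.Free (DiffOp R) (FreeOn (DiffOp R) (𝒱.Gen r α)) :=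
  inferInstanceAs (Module.Free (DiffOp R) (DiffOp R ⊗[ℂ] 𝒱.Gen r α))

instance (r : ℕ) (α : 𝒜.Vertex) : Module.Finite (DiffOp R) (FreeOn (DiffOp R) (𝒱.Gen r α)) :=
  inferInstanceAs (Module.Finite (DiffOp R) (DiffOp R ⊗[ℂ] 𝒱.Gen r α))

theorem free_res (r : ℕ) : Module.Free (DiffOp R) (𝒱.Res R r) := inferInstance

theorem finite_res (r : ℕ) : Module.Finite (DiffOp R) (𝒱.Res R r) := inferInstance

theorem subsingleton_res {r : ℕ} (hr : N < r) : Subsingleton (𝒱.Res R r) := by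
  have h : ∀ α : 𝒜.Vertex, Subsingleton (⋀[ℂ]^r α.TF) := fun α => by
    rw [← Module.finrank_zero_iff (R := ℂ), exteriorPower.finrank_eq, α.finrank_TF,
      Nat.choose_eq_zero_of_lt hr]
  refine ⟨fun x y => DFinsupp.ext fun α => ?_⟩
  have hx : ∀ z : FreeOn (DiffOp R) (𝒱.Gen r α), z = 0 := by
    intro z
    induction z using kos_induction with
    | h0 => rfl
    | hadd x y hx hy => rw [hx, hy, add_zero]
    | hkos P t w =>
      rw [kos, Subsingleton.elim (exteriorPower.ιMulti ℂ r t) 0, map_zero, LinearMap.zero_apply]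
  exact (hx _).trans (hx _).symm

end

end ArrQuiver

end QuiverD

end

theorem theorem4p11 (N : ℕ) (𝒜 : QuiverD.Arrangement N) (fr : QuiverD.EdgeFraming 𝒜)
    (𝒱 : QuiverD.ArrQuiver.{v} 𝒜)
    (S : Submonoid (QuiverD.PolyRing N)) (R : Type) [CommRing R] [Algebra ℂ R]
    [Algebra (QuiverD.PolyRing N) R] [IsScalarTower ℂ (QuiverD.PolyRing N) R] [IsLocalization S R] :
    (∀ r : ℕ, Module.Free (QuiverD.DiffOp R) (𝒱.Res R r) ∧
      Module.Finite (QuiverD.DiffOp R) (𝒱.Res R r)) ∧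
    (∀ r : ℕ, N < r → Subsingleton (𝒱.Res R r)) ∧
    (∀ r : ℕ, Function.Exact (𝒱.d fr S R (r + 1)) (𝒱.d fr S R r)) ∧
    Function.Exact (𝒱.d fr S R 0) (𝒱.ν fr S R) ∧
    Function.Surjective (𝒱.ν fr S R) :=
  ⟨fun r => ⟨𝒱.free_res R r, 𝒱.finite_res R r⟩, fun _ hr => 𝒱.subsingleton_res R hr,
    fun r => 𝒱.exact_d_d fr S R r, 𝒱.exact_d_ν fr S R, 𝒱.ν_surjective fr S R⟩
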